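/- **Conventions.** Let $n\ge 1$ and write permutations in $S_n$ in one-line notation. A cover $x\lessdot y$ in the weak order means that $y$ has adjacent entries $y_i=e>a=y_{i+1}$ and $x$ is obtained from $y$ by swapping these two entries. A *generic tiling* is a tiling of an axis-parallel rectangle $S$ by $n$ axis-parallel rectangles such that no point is a corner of four distinct tiles. A tile $U$ is *below* $V$ if the top edge of $U$ meets the bottom edge of $V$, and *left of* $V$ if the right edge of $U$ meets the left edge of $V$. A *generic rectangulation* is a class of generic tilings under the equivalence: there is a bijection between the tiles that exactly preserves the relations "below" and "left of". Let $\mathrm{gRec}_n$ be the set of generic rectangulations with $n$ rectangles. A *wall* of a tiling is a line segment in $S$, not contained in an edge of $S$, that is maximal among segments not meeting the interior of any tile. *Wall shuffles.* Let the tiles be numbered $1,\dots,n$. For a vertical wall $W$, move along $W$ from bottom to top. Record each tile whose right edge lies in $W$, except the bottommost one, at the height of its bottom edge, and each tile whose left edge lies in $W$, except the topmost one, at the height of its top edge. For a horizontal wall $W$, move along $W$ from left to right. Record each tile whose bottom edge lies in $W$, except the rightmost one, at the abscissa of its right edge, and each tile whose top edge lies in $W$, except the leftmost one, at the abscissa of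 its left edge. The resulting sequence of numbers is the wall shuffle $\sigma_W$. *The map $\rho$.* Let $S=[0,n]^2$ with diagonal points $p_k=(k,n-k)$, $0\le k\le n$. The space between $p_{k-1}$ and $p_k$ has the label $k$. Given $x\in S_n$, process $x_1,\dots,x_n$ in order, drawing a rectangle numbered $x_i$ in step $i$. Let $T$ be the union of the left and bottom edges of $S$ and the rectangles already drawn, and let $k=x_i$. The top-left corner of the new rectangle is the rightmost point of $T$ directly left of $p_{k-1}$ if $p_{k-1}\notin T$, and the highest point of $T$ directly above (or equal to) $p_{k-1}$ otherwise. Its bottom-right corner is the highest point of $T$ directly below $p_k$ if $p_k\notin T$, and the rightmost point of $T$ directly right of (or equal to) $p_k$ otherwise. The resulting numbered tiling is $\rho(x)$. *The map $\gamma$.* $\gamma(x)\in\mathrm{gRec}_n$ is the generic rectangulation with a representative $R$ whose tiles can be numbered $1,\dots,n$ so that (i) $R$ is equivalent to $\rho(x)$ as a mosaic floorplan, respecting the numbering: there is a bijection from the walls of $\rho(x)$ to the walls of $R$ that preserves orientation and, for each of the two sides of a wall, the set of numbers of the tiles adjacent to the wall on that side; and (ii) for each wall $W$ of $\rho(x)$,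 the wall shuffle of the corresponding wall of $R$ is the subsequence of $x_1\cdots x_n$ formed by the numbers that occur in the wall shuffle of $W$ in $\rho(x)$. **Proposition.** For every $x\in S_n$ there is exactly one such generic rectangulation, so that $\gamma:S_n\to\mathrm{gRec}_n$ is a well-defined map. Suppose that $x\lessdot y$ in the weak order, and let $e$ and $a$, with $a<e$, be the adjacent entries that are swapped to convert $y$ to $x$. Then $\gamma(x)=\gamma(y)$ if and only if there are entries $b$, $c$ and $d$ in $y$ with $a<b<c<d<e$ such that $b$ and $d$ are on the same side of the pair $ea$ in $y$ (both before it or both after it), while $c$ is on the other side. -/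

import Mathlib

namespace Rectangulation

/-- An axis-parallel rectangle in the plane, given by the coordinates of its four edges.  It is
nondegenerate exactly when `IsProper` holds. -/
structure Rect where
  left : ℝ
  right : ℝ
  bottom : ℝ
  top : ℝ

namespace Rect

def IsProper (U : Rect) : Prop := U.left < U.right ∧ U.bottom < U.top

/-- The closed rectangle as a set of points. -/
def toSet (U : Rect) : Set (ℝ × ℝ) :=
  {p | U.left ≤ p.1 ∧ p.1 ≤ U.right ∧ U.bottom ≤ p.2 ∧ p.2 ≤ U.top}

def inner (U : Rect) : Set (ℝ × ℝ) :=
  {p | U.left < p.1 ∧ p.1 < U.right ∧ U.bottom < p.2 ∧ p.2 < U.top}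

def leftEdge (U : Rect) : Set (ℝ × ℝ) :=
  {p | p.1 = U.left ∧ U.bottom ≤ p.2 ∧ p.2 ≤ U.top}

def rightEdge (U : Rect) : Set (ℝ × ℝ) :=
  {p | p.1 = U.right ∧ U.bottom ≤ p.2 ∧ p.2 ≤ U.top}

def bottomEdge (U : Rect) : Set (ℝ × ℝ) :=
  {p | p.2 = U.bottom ∧ U.left ≤ p.1 ∧ p.1 ≤ U.right}

def topEdge (U : Rect) : Set (ℝ × ℝ) :=
  {p | p.2 = U.top ∧ U.left ≤ p.1 ∧ p.1 ≤ U.right}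

def corners (U : Rect) : Set (ℝ × ℝ) :=
  {(U.left, U.bottom), (U.left, U.top), (U.right, U.bottom), (U.right, U.top)}

/-- `U` is below `V`: the top edge of `U` meets the bottom edge of `V`. -/
def IsBelow (U V : Rect) : Prop := (U.topEdge ∩ V.bottomEdge).Nonempty

/-- `U` is left of `V`: the right edge of `U` meets the left edge of `V`. -/
def IsLeftOf (U V : Rect) : Prop := (U.rightEdge ∩ V.leftEdge).Nonempty

end Rect

/-- An outer rectangle `S` together with `n` numbered rectangles. -/
structure Drawing (n : ℕ) where
  outer : Rect
  tile : Fin n → Rect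

/-- The numbered rectangles tile the outer rectangle, and there is no cross, i.e. no point is a
corner of four distinct tiles. -/
structure Drawing.IsGenericTiling {n : ℕ} (R : Drawing n) : Prop where
  outer_proper : R.outer.IsProper
  tile_proper : ∀ i, (R.tile i).IsProper
  cover : ⋃ i, (R.tile i).toSet = R.outer.toSet
  disjoint : ∀ i j, i ≠ j → Disjoint (R.tile i).inner (R.tile j).inner
  no_cross : ¬ ∃ (p : ℝ × ℝ) (f : Fin 4 → Fin n),
    Function.Injective f ∧ ∀ k, p ∈ (R.tile (f k)).corners

/-- Generic tilings of some rectangle by `n` rectangles. -/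
def GenericTiling (n : ℕ) : Type := {R : Drawing n // R.IsGenericTiling}

/-- Combinatorial equivalence: some bijection between the tiles exactly preserves the relations
"below" and "left of".  The numbering of the tiles plays no role. -/
def CombEquiv {n : ℕ} (R R' : GenericTiling n) : Prop :=
  ∃ σ : Equiv.Perm (Fin n), ∀ i j,
    ((R.1.tile i).IsBelow (R.1.tile j) ↔ (R'.1.tile (σ i)).IsBelow (R'.1.tile (σ j))) ∧
    ((R.1.tile i).IsLeftOf (R.1.tile j) ↔ (R'.1.tile (σ i)).IsLeftOf (R'.1.tile (σ j)))

theorem combEquiv_equivalence (n : ℕ) : Equivalence (@CombEquiv n) where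
  refl _ := ⟨Equiv.refl _, fun _ _ => ⟨Iff.rfl, Iff.rfl⟩⟩
  symm := by
    rintro R R' ⟨σ, h⟩
    refine ⟨σ.symm, fun i j => ?_⟩
    have := h (σ.symm i) (σ.symm j)
    simp only [Equiv.apply_symm_apply] at this
    exact ⟨this.1.symm, this.2.symm⟩
  trans := by
    rintro R R' R'' ⟨σ, h⟩ ⟨τ, h'⟩
    exact ⟨σ.trans τ, fun i j =>
      ⟨(h i j).1.trans (h' (σ i) (σ j)).1, (h i j).2.trans (h' (σ i) (σ j)).2⟩⟩

def combSetoid (n : ℕ) : Setoid (GenericTiling n) := ⟨CombEquiv, combEquiv_equivalence n⟩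

/-- A generic rectangulation with `n` rectangles: a combinatorial equivalence class of generic
tilings. -/
def GRec (n : ℕ) : Type := Quotient (combSetoid n)

def GRec.mk {n : ℕ} (R : GenericTiling n) : GRec n := Quotient.mk (combSetoid n) R

/-! ### Walls and wall shuffles -/

/-- A vertical segment `{u} × [lo, hi]` or a horizontal segment `[lo, hi] × {v}`. -/
inductive Seg where
  | vert (u lo hi : ℝ)
  | horiz (v lo hi : ℝ)

namespace Seg

def IsProper : Seg → Prop
  | vert _ lo hi => lo < hi
  | horiz _ lo hi => lo < hi

def toSet : Seg → Set (ℝ × ℝ)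
  | vert u lo hi => {p | p.1 = u ∧ lo ≤ p.2 ∧ p.2 ≤ hi}
  | horiz v lo hi => {p | p.2 = v ∧ lo ≤ p.1 ∧ p.1 ≤ hi}

def IsVert : Seg → Prop
  | vert _ _ _ => True
  | horiz _ _ _ => False

end Seg

namespace Drawing

variable {n : ℕ}

/-- `s` is a nondegenerate segment in the outer rectangle that does not meet the interior of any
tile. -/
def AvoidsTiles (R : Drawing n) (s : Seg) : Prop :=
  s.IsProper ∧ s.toSet ⊆ R.outer.toSet ∧ ∀ i, Disjoint s.toSet (R.tile i).inner

/-- A wall: a segment not contained in an edge of the outer rectangle that is maximal among the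
segments not meeting the interior of any tile. -/
structure IsWall (R : Drawing n) (s : Seg) : Prop where
  avoids : R.AvoidsTiles s
  not_left : ¬ s.toSet ⊆ R.outer.leftEdge
  not_right : ¬ s.toSet ⊆ R.outer.rightEdge
  not_bottom : ¬ s.toSet ⊆ R.outer.bottomEdge
  not_top : ¬ s.toSet ⊆ R.outer.topEdge
  maximal : ∀ s' : Seg, R.AvoidsTiles s' → s.toSet ⊆ s'.toSet → s'.toSet = s.toSet

def Wall (R : Drawing n) : Type := {s : Seg // R.IsWall s}

/-- The tile numbered `i` is adjacent to the segment on its left side (vertical segment) or on its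
upper side (horizontal segment). -/
def OnFirstSide (R : Drawing n) (s : Seg) (i : Fin n) : Prop :=
  match s with
  | Seg.vert _ _ _ => (R.tile i).rightEdge ⊆ s.toSet
  | Seg.horiz _ _ _ => (R.tile i).bottomEdge ⊆ s.toSet

/-- The tile numbered `i` is adjacent to the segment on its right side (vertical segment) or on its
lower side (horizontal segment). -/
def OnSecondSide (R : Drawing n) (s : Seg) (i : Fin n) : Prop :=
  match s with
  | Seg.vert _ _ _ => (R.tile i).leftEdge ⊆ s.toSet
  | Seg.horiz _ _ _ => (R.tile i).topEdge ⊆ s.toSet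

/-- Moving along the wall (upwards on a vertical wall, to the right on a horizontal one), the
number `i` is recorded at coordinate `h`.  On a vertical wall, the tiles on the left are recorded
at the height of their bottom edge, except for the bottommost one, and the tiles on the right at
the height of their top edge, except for the topmost one.  On a horizontal wall, the tiles above
are recorded at the abscissa of their right edge, except for the rightmost one, and the tiles below
at the abscissa of their left edge, except for the leftmost one.  So a tile is recorded precisely
where another wall, containing the edge in question, is incident to the wall from the side of the
tile. -/
def Records (R : Drawing n) (s : Seg) (i : Fin n) (h : ℝ) : Prop :=
  match s with
  | Seg.vert _ lo hi =>
      (R.OnFirstSide s i ∧ lo < (R.tile i).bottom ∧ h = (R.tile i).bottom) ∨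
      (R.OnSecondSide s i ∧ (R.tile i).top < hi ∧ h = (R.tile i).top)
  | Seg.horiz _ lo hi =>
      (R.OnFirstSide s i ∧ (R.tile i).right < hi ∧ h = (R.tile i).right) ∨
      (R.OnSecondSide s i ∧ lo < (R.tile i).left ∧ h = (R.tile i).left)

/-- `i` is one of the numbers that appear in the wall shuffle of the wall. -/
def InShuffle (R : Drawing n) (s : Seg) (i : Fin n) : Prop := ∃ h, R.Records s i h

/-- `l` is the wall shuffle of the wall: the recorded numbers in the order in which they are
encountered. -/
def IsWallShuffle (R : Drawing n) (s : Seg) (l : List (Fin n)) : Prop :=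
  (∀ i, i ∈ l ↔ R.InShuffle s i) ∧
  l.Pairwise (fun i j => ∀ h h', R.Records s i h → R.Records s j h' → h < h')

/-- A bijection between the walls of two numbered tilings witnessing that they are equivalent as
mosaic floorplans by an equivalence respecting the numberings: corresponding walls are parallel and
have the same tiles on each of their two sides (in any order of the incidences from the two sides
relative to each other, so that exactly the sliding of walls past each other is allowed). -/
def IsMosaicEquiv (R R' : Drawing n) (φ : R.Wall ≃ R'.Wall) : Prop :=
  ∀ W : R.Wall, ((φ W).1.IsVert ↔ W.1.IsVert) ∧
    (∀ i, R'.OnFirstSide (φ W).1 i ↔ R.OnFirstSide W.1 i) ∧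
    (∀ i, R'.OnSecondSide (φ W).1 i ↔ R.OnSecondSide W.1 i)

end Drawing

/-! ### The map from permutations to diagonal rectangulations -/

/-- The square `[0, n] × [0, n]` in which the construction takes place. -/
def square (n : ℕ) : Rect := ⟨0, n, 0, n⟩

/-- The diagonal points, numbered `0, …, n` from top-left to bottom-right.  The label `k : Fin n`
is the one between the diagonal points `k` and `k + 1`. -/
def diagPoint (n k : ℕ) : ℝ × ℝ := (k, (n : ℝ) - k)

open Classical in
/-- Top-left corner of a new rectangle, where `p` is the diagonal point immediately above/left of
its label: the rightmost point of `T` directly left of `p` if `p ∉ T`, and the highest point of `T`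
directly above `p` if `p ∈ T`. -/
noncomputable def newTopLeft (T : Set (ℝ × ℝ)) (p : ℝ × ℝ) : ℝ × ℝ :=
  if p ∈ T then (p.1, sSup {v | p.2 ≤ v ∧ (p.1, v) ∈ T})
  else (sSup {u | u ≤ p.1 ∧ (u, p.2) ∈ T}, p.2)

open Classical in
/-- Bottom-right corner of a new rectangle, where `p` is the diagonal point immediately below/right
of its label: the highest point of `T` directly below `p` if `p ∉ T`, and the rightmost point of
`T` directly right of `p` if `p ∈ T`. -/
noncomputable def newBottomRight (T : Set (ℝ × ℝ)) (p : ℝ × ℝ) : ℝ × ℝ :=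
  if p ∈ T then (sSup {u | p.1 ≤ u ∧ (u, p.2) ∈ T}, p.2)
  else (p.1, sSup {v | v ≤ p.2 ∧ (p.1, v) ∈ T})

/-- The new rectangle with label `k`, drawn when `T` has already been drawn. -/
noncomputable def newRect (n : ℕ) (T : Set (ℝ × ℝ)) (k : Fin n) : Rect where
  left := (newTopLeft T (diagPoint n k)).1
  right := (newBottomRight T (diagPoint n (k + 1))).1
  bottom := (newBottomRight T (diagPoint n (k + 1))).2
  top := (newTopLeft T (diagPoint n k)).2

/-- The union `T` of the left and bottom edges of the square and the rectangles drawn in the first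
`t` steps, in which the labels `x 0, x 1, …` are processed in this order. -/
noncomputable def drawn {n : ℕ} (x : Equiv.Perm (Fin n)) : ℕ → Set (ℝ × ℝ)
  | 0 => (square n).leftEdge ∪ (square n).bottomEdge
  | t + 1 =>
      if h : t < n then drawn x t ∪ (newRect n (drawn x t) (x ⟨t, h⟩)).toSet else drawn x t

/-- The diagonal rectangulation `ρ(x)`, its rectangles being numbered along the diagonal: the
rectangle with label `k` is drawn in the step in which the entry `k` of `x` is processed. -/
noncomputable def rho {n : ℕ} (x : Equiv.Perm (Fin n)) : Drawing n where
  outer := square n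
  tile k := newRect n (drawn x (x.symm k)) k

/-! ### The map from permutations to generic rectangulations -/

open Classical in
/-- The wall shuffle that `x` specifies on a wall of `ρ(x)`: the subsequence of `x` that consists
of the numbers that have to appear in a wall shuffle of this wall. -/
noncomputable def specifiedShuffle {n : ℕ} (x : Equiv.Perm (Fin n)) (W : (rho x).Wall) :
    List (Fin n) :=
  (List.ofFn x).filter (fun i => (rho x).InShuffle W.1 i)

/-- The generic rectangulation `Q` is the one defined by the diagonal rectangulation `ρ(x)`
together with the wall shuffles specified by `x`: some representative of `Q`, suitably numbered, is
equivalent to `ρ(x)` as a mosaic floorplan, and its wall shuffles are the specified ones. -/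
def IsGamma {n : ℕ} (x : Equiv.Perm (Fin n)) (Q : GRec n) : Prop :=
  ∃ R : GenericTiling n, GRec.mk R = Q ∧
    ∃ φ : (rho x).Wall ≃ R.1.Wall, (rho x).IsMosaicEquiv R.1 φ ∧
      ∀ W : (rho x).Wall, R.1.IsWallShuffle (φ W).1 (specifiedShuffle x W)

/-- `x ⋖ y` in the weak order on permutations (written in one-line notation `x 0, x 1, …`), where
`e > a` are the adjacent entries of `y` that are swapped to convert `y` to `x`. -/
def WeakCover {n : ℕ} (x y : Equiv.Perm (Fin n)) (e a : Fin n) : Prop :=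
  a < e ∧ ∃ i j : Fin n, (i : ℕ) + 1 = j ∧ y i = e ∧ y j = a ∧ x i = a ∧ x j = e ∧
    ∀ k, k ≠ i → k ≠ j → x k = y k

/-- In the one-line notation of `y`, the entry `b` comes before the entry `c`. -/
def Before {n : ℕ} (y : Equiv.Perm (Fin n)) (b c : Fin n) : Prop := y.symm b < y.symm c

end Rectangulation

open Rectangulation

namespace Rectangulation

/-! ### Transposition -/

/-! Write `τ k` for the position of the label `k` in the permutation. The tile `k` of `rho x` is
bounded on the left by the nearest smaller label that precedes `k`, on the right by the nearest
larger label that follows it, above by the nearest smaller label that follows it, and below by the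
nearest larger label that precedes it. This makes `rho x` explicit (`rho_eq`): the wall between the
labels `w - 1` and `w` is vertical if `w - 1` comes first and horizontal otherwise.

Existence. The incidences of tiles and walls are stored in a `Plan`. The central fact is a bilinear
area identity (`sum_area`), obtained by telescoping along walls. Applied to indicator functions of
cuts, it shows that every choice of wall coordinates that fits the plan draws a generic tiling with
the prescribed walls (`Plan.Fits.isGenericTiling`, `Plan.Fits.isWall_iff`). It remains to choose
coordinates that sort the records on each wall by position. They come from a sweep through the
permutation in which each new wall is placed just before the next open one, at a distance that is a
power of two (`coord`, `ordinate`, `records_vertSeg_lt`, `records_horizSeg_lt`).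

Uniqueness. Whether two tiles on opposite sides of a wall touch is decided by the order of the
records on that wall, so tilings with the same walls and shuffles have the same relations
(`Drawing.WallsMatch.isLeftOf`).

The criterion. Swapping the adjacent entries `e` and `a` affects only the comparison of `a` with
`e`. If `b`, `c`, `d` exist, no wall of `rho` notices the swap (`AdjacentSwap.walls_eq`) and `a`,
`e` never occur in a common shuffle (`AdjacentSwap.not_same_shuffle`), so the same tiling serves
both permutations. If they do not exist, then along the labels between `a` and `e` the side of the
pair changes at most once (`AdjacentSwap.exists_split`), and either "`a` is left of `e`" or "`e` is
below `a`" holds for exactly one of the two tilings. This separates the classes, because the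
numbering can be recovered from the relations: neighbouring labels are joined by a zigzag along the
wall between them, so an equivalence is increasing on labels and hence the identity
(`strictMono_of_relations`). -/

def Rect.transpose (U : Rect) : Rect := ⟨U.bottom, U.top, U.left, U.right⟩

def Seg.transpose : Seg → Seg
  | .vert u lo hi => .horiz u lo hi
  | .horiz v lo hi => .vert v lo hi

/-- Reflection exchanges vertical and horizontal walls and the two sides of a wall, but keeps every
wall shuffle. Geometric statements therefore need to be proved for vertical walls only. -/
def Drawing.transpose {n : ℕ} (R : Drawing n) : Drawing n :=
  ⟨R.outer.transpose, fun i => (R.tile i).transpose⟩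

namespace Rect

theorem toSet_transpose (U : Rect) : U.transpose.toSet = Prod.swap ⁻¹' U.toSet := by
  ext p; simp only [toSet, transpose, Set.mem_ofPred_eq, Set.mem_preimage, Prod.fst_swap,
    Prod.snd_swap]; tauto

theorem inner_transpose (U : Rect) : U.transpose.inner = Prod.swap ⁻¹' U.inner := by
  ext p; simp only [inner, transpose, Set.mem_ofPred_eq, Set.mem_preimage, Prod.fst_swap,
    Prod.snd_swap]; tauto

theorem leftEdge_transpose (U : Rect) : U.transpose.leftEdge = Prod.swap ⁻¹' U.bottomEdge := rfl

theorem rightEdge_transpose (U : Rect) : U.transpose.rightEdge = Prod.swap ⁻¹' U.topEdge := rfl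

theorem mem_corners {U : Rect} {p : ℝ × ℝ} : p ∈ U.corners ↔
    (p.1 = U.left ∨ p.1 = U.right) ∧ (p.2 = U.bottom ∨ p.2 = U.top) := by
  simp only [corners, Set.mem_insert_iff, Set.mem_singleton_iff, Prod.ext_iff]; tauto

theorem corners_transpose (U : Rect) : U.transpose.corners = Prod.swap ⁻¹' U.corners := by
  ext p; simp only [mem_corners, Set.mem_preimage, Prod.fst_swap, Prod.snd_swap, transpose]; tauto

theorem IsProper.transpose {U : Rect} (h : U.IsProper) : U.transpose.IsProper := ⟨h.2, h.1⟩

theorem isLeftOf_transpose (U V : Rect) : U.transpose.IsLeftOf V.transpose ↔ U.IsBelow V := by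
  rw [IsLeftOf, IsBelow, rightEdge_transpose, leftEdge_transpose, ← Set.preimage_inter]
  exact Prod.swap_surjective.nonempty_preimage

end Rect

namespace Seg

theorem toSet_transpose (s : Seg) : s.transpose.toSet = Prod.swap ⁻¹' s.toSet := by cases s <;> rfl

@[simp] theorem transpose_transpose (s : Seg) : s.transpose.transpose = s := by cases s <;> rfl

theorem isProper_transpose (s : Seg) : s.transpose.IsProper ↔ s.IsProper := by cases s <;> rfl

theorem isVert_transpose (s : Seg) : s.transpose.IsVert ↔ ¬ s.IsVert := by
  cases s <;> simp [transpose, IsVert]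

end Seg

theorem preimage_swap_subset {s t : Set (ℝ × ℝ)} :
    Prod.swap ⁻¹' s ⊆ Prod.swap ⁻¹' t ↔ s ⊆ t :=
  Prod.swap_surjective.preimage_subset_preimage_iff

theorem disjoint_preimage_swap {s t : Set (ℝ × ℝ)} :
    Disjoint (Prod.swap ⁻¹' s) (Prod.swap ⁻¹' t) ↔ Disjoint s t :=
  Set.disjoint_preimage_iff Prod.swap_surjective

namespace Drawing

variable {n : ℕ} {R : Drawing n}

theorem avoidsTiles_transpose {s : Seg} :
    R.transpose.AvoidsTiles s.transpose ↔ R.AvoidsTiles s := by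
  simp only [AvoidsTiles, transpose, Seg.isProper_transpose, Seg.toSet_transpose,
    Rect.toSet_transpose, Rect.inner_transpose, preimage_swap_subset, disjoint_preimage_swap]

theorem IsWall.transpose {s : Seg} (h : R.IsWall s) : R.transpose.IsWall s.transpose where
  avoids := avoidsTiles_transpose.2 h.avoids
  not_left := by
    rw [Seg.toSet_transpose]; exact fun h' => h.not_bottom (preimage_swap_subset.1 h')
  not_right := by
    rw [Seg.toSet_transpose]; exact fun h' => h.not_top (preimage_swap_subset.1 h')
  not_bottom := by
    rw [Seg.toSet_transpose]; exact fun h' => h.not_left (preimage_swap_subset.1 h')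
  not_top := by
    rw [Seg.toSet_transpose]; exact fun h' => h.not_right (preimage_swap_subset.1 h')
  maximal s' h' hs := by
    rw [← s'.transpose_transpose] at h' hs ⊢
    rw [avoidsTiles_transpose] at h'
    rw [Seg.toSet_transpose, Seg.toSet_transpose, preimage_swap_subset] at hs
    rw [Seg.toSet_transpose, h.maximal _ h' hs, ← Seg.toSet_transpose]

theorem isWall_transpose {s : Seg} : R.transpose.IsWall s.transpose ↔ R.IsWall s :=
  ⟨fun h => by have := h.transpose; rwa [Seg.transpose_transpose] at this, IsWall.transpose⟩

theorem onFirstSide_transpose {s : Seg} {i : Fin n} :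
    R.transpose.OnFirstSide s.transpose i ↔ R.OnSecondSide s i := by
  cases s
  · exact preimage_swap_subset (s := (R.tile i).leftEdge) (t := Seg.toSet (.vert _ _ _))
  · exact preimage_swap_subset (s := (R.tile i).topEdge) (t := Seg.toSet (.horiz _ _ _))

theorem onSecondSide_transpose {s : Seg} {i : Fin n} :
    R.transpose.OnSecondSide s.transpose i ↔ R.OnFirstSide s i := by
  cases s
  · exact preimage_swap_subset (s := (R.tile i).rightEdge) (t := Seg.toSet (.vert _ _ _))
  · exact preimage_swap_subset (s := (R.tile i).bottomEdge) (t := Seg.toSet (.horiz _ _ _))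

theorem records_transpose {s : Seg} {i : Fin n} {h : ℝ} :
    R.transpose.Records s.transpose i h ↔ R.Records s i h := by
  have h1 := onFirstSide_transpose (R := R) (s := s) (i := i)
  have h2 := onSecondSide_transpose (R := R) (s := s) (i := i)
  cases s <;> simp only [Records, Seg.transpose] at h1 h2 ⊢ <;> rw [h1, h2] <;>
    exact or_comm

theorem inShuffle_transpose {s : Seg} {i : Fin n} :
    R.transpose.InShuffle s.transpose i ↔ R.InShuffle s i := by
  simp only [InShuffle, records_transpose]

theorem IsGenericTiling.transpose (h : R.IsGenericTiling) : R.transpose.IsGenericTiling where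
  outer_proper := h.outer_proper.transpose
  tile_proper i := (h.tile_proper i).transpose
  cover := by
    simp only [Drawing.transpose, Rect.toSet_transpose, ← Set.preimage_iUnion, h.cover]
  disjoint i j hij := by
    simp only [Drawing.transpose, Rect.inner_transpose]
    exact (h.disjoint i j hij).preimage _
  no_cross := by
    rintro ⟨p, f, hf, hp⟩
    refine h.no_cross ⟨p.swap, f, hf, fun k => ?_⟩
    have := hp k
    rw [Drawing.transpose, Rect.corners_transpose] at this
    exact this

/-! ### Vertical walls of generic tilings -/

/-- If the open intervals met in both directions, a point of the overlap would be interior to both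
tiles. -/
theorem IsGenericTiling.separated (h : R.IsGenericTiling) {i j : Fin n} (hij : i ≠ j) :
    (R.tile i).right ≤ (R.tile j).left ∨ (R.tile j).right ≤ (R.tile i).left ∨
      (R.tile i).top ≤ (R.tile j).bottom ∨ (R.tile j).top ≤ (R.tile i).bottom := by
  by_contra! hc
  obtain ⟨h1, h2, h3, h4⟩ := hc
  obtain ⟨a1, a2⟩ := h.tile_proper i
  obtain ⟨b1, b2⟩ := h.tile_proper j
  obtain ⟨u, hu, hu'⟩ := exists_between (max_lt (lt_min a1 h2) (lt_min h1 b1))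
  obtain ⟨v, hv, hv'⟩ := exists_between (max_lt (lt_min a2 h4) (lt_min h3 b2))
  rw [max_lt_iff] at hu hv
  rw [lt_min_iff] at hu' hv'
  exact Set.disjoint_left.1 (h.disjoint i j hij)
    (show (u, v) ∈ _ from ⟨hu.1, hu'.1, hv.1, hv'.1⟩) ⟨hu.2, hu'.2, hv.2, hv'.2⟩

theorem IsGenericTiling.tile_subset (h : R.IsGenericTiling) (i : Fin n) :
    R.outer.left ≤ (R.tile i).left ∧ (R.tile i).right ≤ R.outer.right ∧
      R.outer.bottom ≤ (R.tile i).bottom ∧ (R.tile i).top ≤ R.outer.top := by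
  obtain ⟨a1, a2⟩ := h.tile_proper i
  have hs : (R.tile i).toSet ⊆ R.outer.toSet := h.cover ▸ Set.subset_iUnion (fun i => (R.tile i).toSet) i
  have p1 := hs (a := ((R.tile i).left, (R.tile i).bottom)) ⟨le_rfl, a1.le, le_rfl, a2.le⟩
  have p2 := hs (a := ((R.tile i).right, (R.tile i).top)) ⟨a1.le, le_rfl, a2.le, le_rfl⟩
  exact ⟨p1.1, p2.2.1, p1.2.2.1, p2.2.2.2⟩

theorem avoidsTiles_vert (hp : ∀ i, (R.tile i).IsProper) {u a c : ℝ} :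
    R.AvoidsTiles (.vert u a c) ↔
    a < c ∧ (R.outer.left ≤ u ∧ u ≤ R.outer.right ∧ R.outer.bottom ≤ a ∧ c ≤ R.outer.top) ∧
      ∀ m, (R.tile m).left < u → u < (R.tile m).right →
        (R.tile m).top ≤ a ∨ c ≤ (R.tile m).bottom := by
  refine and_congr_right fun (hac : a < c) => and_congr ?_ ?_
  · constructor
    · intro h
      have h1 := h (a := (u, a)) ⟨rfl, le_rfl, hac.le⟩
      have h2 := h (a := (u, c)) ⟨rfl, hac.le, le_rfl⟩
      exact ⟨h1.1, h1.2.1, h1.2.2.1, h2.2.2.2⟩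
    · rintro ⟨h1, h2, h3, h4⟩ ⟨p, q⟩ ⟨hp1, hp2, hp3⟩
      simp only at hp1 hp2 hp3
      subst hp1
      exact ⟨h1, h2, h3.trans hp2, hp3.trans h4⟩
  · refine forall_congr' fun m => ?_
    constructor
    · intro h h1 h2
      by_contra! hc
      obtain ⟨y, hy, hy'⟩ := exists_between (max_lt (lt_min (hp m).2 hc.2) (lt_min hc.1 hac))
      rw [max_lt_iff] at hy
      rw [lt_min_iff] at hy'
      exact Set.disjoint_left.1 h (show (u, y) ∈ _ from ⟨rfl, hy.2.le, hy'.2.le⟩) ⟨h1, h2, hy.1, hy'.1⟩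
    · intro h
      rw [Set.disjoint_left]
      rintro ⟨p, q⟩ ⟨hp1, hp2, hp3⟩ ⟨h1, h2, h3, h4⟩
      simp only at hp1 hp2 hp3 h1 h2 h3 h4
      subst hp1
      rcases h h1 h2 with h | h <;> linarith

theorem _root_.Rectangulation.Seg.vert_subset_vert {u a c u' a' c' : ℝ} (h : a < c) :
    (Seg.vert u a c).toSet ⊆ (Seg.vert u' a' c').toSet ↔ u = u' ∧ a' ≤ a ∧ c ≤ c' := by
  constructor
  · intro hs
    have h1 := hs (a := (u, a)) ⟨rfl, le_rfl, h.le⟩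
    have h2 := hs (a := (u, c)) ⟨rfl, h.le, le_rfl⟩
    exact ⟨h1.1, h1.2.1, h2.2.2⟩
  · rintro ⟨rfl, h1, h2⟩ p ⟨hp1, hp2, hp3⟩
    exact ⟨hp1, h1.trans hp2, hp3.trans h2⟩

theorem vert_not_subset_horizontal {u a c v : ℝ} (h : a < c) {S : Set (ℝ × ℝ)}
    (hS : ∀ p ∈ S, p.2 = v) : ¬ (Seg.vert u a c).toSet ⊆ S := by
  intro hs
  have h1 := hS _ (hs (a := (u, a)) ⟨rfl, le_rfl, h.le⟩)
  have h2 := hS _ (hs (a := (u, c)) ⟨rfl, h.le, le_rfl⟩)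
  simp only at h1 h2
  linarith

theorem isWall_vert {u a c : ℝ} : R.IsWall (.vert u a c) ↔
    R.AvoidsTiles (.vert u a c) ∧ u ≠ R.outer.left ∧ u ≠ R.outer.right ∧
      ∀ a' c', R.AvoidsTiles (.vert u a' c') → a' ≤ a → c ≤ c' → a' = a ∧ c' = c := by
  constructor
  · intro h
    have hac : a < c := h.avoids.1
    refine ⟨h.avoids, ?_, ?_, ?_⟩
    · rintro rfl
      refine h.not_left fun p hp => ⟨hp.1, ?_⟩
      exact (h.avoids.2.1 hp).2.2
    · rintro rfl
      refine h.not_right fun p hp => ⟨hp.1, ?_⟩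
      exact (h.avoids.2.1 hp).2.2
    · intro a' c' h' ha hc
      have := (Seg.vert_subset_vert h'.1).1
        (h.maximal _ h' ((Seg.vert_subset_vert hac).2 ⟨rfl, ha, hc⟩)).subset
      exact ⟨le_antisymm ha this.2.1, le_antisymm this.2.2 hc⟩
  · rintro ⟨h, h1, h2, h3⟩
    have hac : a < c := h.1
    refine ⟨h, fun hs => h1 ?_, fun hs => h2 ?_, vert_not_subset_horizontal hac fun p hp => hp.1,
      vert_not_subset_horizontal hac fun p hp => hp.1, ?_⟩
    · exact (hs (a := (u, a)) ⟨rfl, le_rfl, hac.le⟩).1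
    · exact (hs (a := (u, a)) ⟨rfl, le_rfl, hac.le⟩).1
    · rintro (⟨u', a', c'⟩ | ⟨v, a', c'⟩) h' hs
      · obtain ⟨rfl, h4, h5⟩ := (Seg.vert_subset_vert hac).1 hs
        obtain ⟨rfl, rfl⟩ := h3 a' c' h' h4 h5
        rfl
      · exact absurd hs (vert_not_subset_horizontal hac fun p hp => hp.1)

theorem onFirstSide_vert {u a c : ℝ} {i : Fin n} (hp : (R.tile i).IsProper) :
    R.OnFirstSide (.vert u a c) i ↔
      (R.tile i).right = u ∧ a ≤ (R.tile i).bottom ∧ (R.tile i).top ≤ c :=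
  Seg.vert_subset_vert hp.2

theorem onSecondSide_vert {u a c : ℝ} {i : Fin n} (hp : (R.tile i).IsProper) :
    R.OnSecondSide (.vert u a c) i ↔
      (R.tile i).left = u ∧ a ≤ (R.tile i).bottom ∧ (R.tile i).top ≤ c :=
  Seg.vert_subset_vert hp.2

theorem _root_.Rectangulation.Rect.isLeftOf_iff {U V : Rect} (hU : U.IsProper) (hV : V.IsProper) :
    U.IsLeftOf V ↔ U.right = V.left ∧ U.bottom ≤ V.top ∧ V.bottom ≤ U.top := by
  constructor
  · rintro ⟨p, ⟨h1, h2, h3⟩, h4, h5, h6⟩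
    exact ⟨h1.symm.trans h4, h2.trans h6, h5.trans h3⟩
  · rintro ⟨h1, h2, h3⟩
    refine ⟨(U.right, max U.bottom V.bottom), ⟨rfl, le_max_left _ _, max_le hU.2.le h3⟩, h1,
      le_max_right _ _, max_le h2 hV.2.le⟩

theorem _root_.Rectangulation.Rect.isBelow_iff {U V : Rect} (hU : U.IsProper) (hV : V.IsProper) :
    U.IsBelow V ↔ U.top = V.bottom ∧ U.left ≤ V.right ∧ V.left ≤ U.right := by
  rw [← Rect.isLeftOf_transpose, Rect.isLeftOf_iff hU.transpose hV.transpose]; rfl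

/-- Every vertical segment that avoids the tiles can be extended to a maximal one. -/
theorem exists_wall (hp : ∀ i, (R.tile i).IsProper) {u a c : ℝ}
    (h : R.AvoidsTiles (.vert u a c)) (h1 : u ≠ R.outer.left) (h2 : u ≠ R.outer.right) :
    ∃ a' c', a' ≤ a ∧ c ≤ c' ∧ R.IsWall (.vert u a' c') := by
  classical
  rw [avoidsTiles_vert hp] at h
  obtain ⟨hac, ⟨o1, o2, o3, o4⟩, hav⟩ := h
  let P (m : Fin n) : Prop := (R.tile m).left < u ∧ u < (R.tile m).right
  -- Going up, the extension is stopped by the lowest bottom edge of a tile that straddles the line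
  -- above the segment, or by the outer rectangle; `G` does the same going down.
  let F := insert R.outer.top
    ((Finset.univ.filter fun m => P m ∧ c ≤ (R.tile m).bottom).image fun m => (R.tile m).bottom)
  let G := insert R.outer.bottom
    ((Finset.univ.filter fun m => P m ∧ (R.tile m).top ≤ a).image fun m => (R.tile m).top)
  have hF : F.Nonempty := Finset.insert_nonempty _ _
  have hG : G.Nonempty := Finset.insert_nonempty _ _
  have hcF : c ≤ F.min' hF := by
    refine Finset.le_min' _ _ _ fun y hy => ?_
    simp only [F, Finset.mem_insert, Finset.mem_image, Finset.mem_filter] at hy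
    rcases hy with rfl | ⟨m, ⟨_, _, hm⟩, rfl⟩ <;> assumption
  have haG : G.max' hG ≤ a := by
    refine Finset.max'_le _ _ _ fun y hy => ?_
    simp only [G, Finset.mem_insert, Finset.mem_image, Finset.mem_filter] at hy
    rcases hy with rfl | ⟨m, ⟨_, _, hm⟩, rfl⟩ <;> assumption
  refine ⟨G.max' hG, F.min' hF, haG, hcF, isWall_vert.2 ⟨?_, h1, h2, ?_⟩⟩
  · rw [avoidsTiles_vert hp]
    refine ⟨haG.trans_lt (hac.trans_le hcF),
      ⟨o1, o2, G.le_max' _ (Finset.mem_insert_self _ _), F.min'_le _ (Finset.mem_insert_self _ _)⟩,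
      fun m hl hr => ?_⟩
    rcases hav m hl hr with h | h
    · exact Or.inl (G.le_max' _ (Finset.mem_insert_of_mem (Finset.mem_image.2
        ⟨m, by simp [P, hl, hr, h], rfl⟩)))
    · exact Or.inr (F.min'_le _ (Finset.mem_insert_of_mem (Finset.mem_image.2
        ⟨m, by simp [P, hl, hr, h], rfl⟩)))
  · intro a' c' h' ha hc
    rw [avoidsTiles_vert hp] at h'
    obtain ⟨hac', ⟨o1', o2', o3', o4'⟩, hav'⟩ := h'
    have hF' := F.min'_mem hF
    have hG' := G.max'_mem hG
    simp only [F, Finset.mem_insert, Finset.mem_image, Finset.mem_filter] at hF'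
    simp only [G, Finset.mem_insert, Finset.mem_image, Finset.mem_filter] at hG'
    refine ⟨le_antisymm ha ?_, le_antisymm ?_ hc⟩
    · rcases hG' with hG' | ⟨m, ⟨_, hm, hma⟩, hme⟩
      · exact hG'.trans_le o3'
      · have := (hp m).2
        rcases hav' m hm.1 hm.2 with h | h
        · exact hme ▸ h
        · linarith
    · rcases hF' with hF' | ⟨m, ⟨_, hm, hma⟩, hme⟩
      · exact o4'.trans_eq hF'.symm
      · have := (hp m).2
        rcases hav' m hm.1 hm.2 with h | h
        · linarith
        · exact hme ▸ h

open Filter Topology in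
/-- Above a tile on the left of a vertical wall, below the end of the wall, there is another tile
on the left of the wall. -/
theorem IsGenericTiling.exists_above (hR : R.IsGenericTiling) {u a c : ℝ}
    (hW : R.IsWall (.vert u a c)) {i : Fin n} (hi : R.OnFirstSide (.vert u a c) i)
    (hc : (R.tile i).top < c) :
    ∃ j, R.OnFirstSide (.vert u a c) j ∧ (R.tile j).bottom = (R.tile i).top := by
  have hp := hR.tile_proper
  rw [isWall_vert, avoidsTiles_vert hp] at hW
  obtain ⟨⟨hac, ⟨o1, o2, o3, o4⟩, hav⟩, n1, n2, hmax⟩ := hW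
  obtain ⟨i1, i2, i3⟩ := (onFirstSide_vert (hp i)).1 hi
  obtain ⟨p1, p2⟩ := hp i
  obtain ⟨s1, s2, s3, s4⟩ := hR.tile_subset i
  -- Approach the upper right corner of the tile `i` from above and from the left. If each of the
  -- finitely many tiles eventually missed the approaching points, these would be uncovered.
  have hex : ∃ j, (R.tile j).left < u ∧ u ≤ (R.tile j).right ∧ (R.tile j).bottom ≤ (R.tile i).top ∧
      (R.tile i).top < (R.tile j).top := by
    by_contra! hno
    have key : ∀ j, ∀ᶠ δ : ℝ in 𝓝[>] 0,
        (u - δ, (R.tile i).top + δ) ∉ (R.tile j).toSet := by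
      intro j
      have tend1 : Tendsto (fun δ : ℝ => u - δ) (𝓝[>] 0) (𝓝 u) :=
        ((continuous_const.sub continuous_id).tendsto' 0 u (by simp)).mono_left
          nhdsWithin_le_nhds
      have tend2 : Tendsto (fun δ : ℝ => (R.tile i).top + δ) (𝓝[>] 0) (𝓝 (R.tile i).top) :=
        ((continuous_const.add continuous_id).tendsto' 0 _ (by simp)).mono_left
          nhdsWithin_le_nhds
      by_cases h1 : (R.tile j).left < u
      · by_cases h2 : u ≤ (R.tile j).right
        · by_cases h3 : (R.tile j).bottom ≤ (R.tile i).top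
          · have h4 := hno j h1 h2 h3
            filter_upwards [self_mem_nhdsWithin] with δ hδ hm
            have : (0 : ℝ) < δ := hδ
            have := hm.2.2.2
            simp only at this
            linarith
          · filter_upwards [tend2.eventually_lt_const (not_le.1 h3)] with δ hδ hm
            exact absurd hm.2.2.1 (not_le.2 hδ)
        · filter_upwards [tend1.eventually_const_lt (not_le.1 h2)] with δ hδ hm
          exact absurd hm.2.1 (not_le.2 hδ)
      · filter_upwards [self_mem_nhdsWithin] with δ hδ hm
        have : (0 : ℝ) < δ := hδ
        have := hm.1
        simp only at this
        linarith
    have hall := eventually_all.2 key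
    have hin : ∀ᶠ δ : ℝ in 𝓝[>] 0, (0 < δ ∧ δ < u - R.outer.left) ∧
        δ < R.outer.top - (R.tile i).top := by
      have e1 : 0 < u - R.outer.left := sub_pos.2 (lt_of_le_of_ne o1 n1.symm)
      have e2 : 0 < R.outer.top - (R.tile i).top := by linarith
      filter_upwards [Ioo_mem_nhdsGT e1, Ioo_mem_nhdsGT e2] with δ h1 h2
      exact ⟨h1, h2.2⟩
    obtain ⟨δ, h1, ⟨h2, h3⟩, h4⟩ := (hall.and hin).exists
    have hmem : (u - δ, (R.tile i).top + δ) ∈ R.outer.toSet :=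
      ⟨by simp only; linarith, by simp only; linarith, by simp only; linarith,
        by simp only; linarith⟩
    rw [← hR.cover, Set.mem_iUnion] at hmem
    obtain ⟨j, hj⟩ := hmem
    exact h1 j hj
  obtain ⟨j, j1, j2, j3, j4⟩ := hex
  obtain ⟨q1, q2⟩ := hp j
  have hr : (R.tile j).right = u := by
    refine le_antisymm ?_ j2
    by_contra! hr
    rcases hav j j1 hr with h | h <;> linarith
  have hb : (R.tile j).bottom = (R.tile i).top := by
    refine le_antisymm j3 ?_
    have hij : i ≠ j := by rintro rfl; exact lt_irrefl _ j4
    rcases hR.separated hij with h | h | h | h <;> linarith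
  refine ⟨j, (onFirstSide_vert (hp j)).2 ⟨hr, by linarith, ?_⟩, hb⟩
  obtain ⟨t1, t2, t3, t4⟩ := hR.tile_subset j
  -- If the tile `j` rose above the end of the wall, the wall could be prolonged along its right
  -- edge, against maximality.
  have hA : R.AvoidsTiles (.vert u a (max c (R.tile j).top)) := by
    rw [avoidsTiles_vert hp]
    refine ⟨hac.trans_le (le_max_left _ _), ⟨o1, o2, o3, max_le o4 t4⟩, fun m hl hr' => ?_⟩
    rcases hav m hl hr' with h | h
    · exact Or.inl h
    · refine Or.inr (max_le h ?_)
      have hjm : j ≠ m := by rintro rfl; linarith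
      rcases hR.separated hjm with h' | h' | h' | h' <;> linarith [(hp m).2]
  rw [← (hmax _ _ hA le_rfl (le_max_left _ _)).2]
  exact le_max_right _ _

open Filter Topology in
/-- Below a tile on the right of a vertical wall, above the start of the wall, there is another
tile on the right of the wall. -/
theorem IsGenericTiling.exists_below (hR : R.IsGenericTiling) {u a c : ℝ}
    (hW : R.IsWall (.vert u a c)) {i : Fin n} (hi : R.OnSecondSide (.vert u a c) i)
    (hc : a < (R.tile i).bottom) :
    ∃ j, R.OnSecondSide (.vert u a c) j ∧ (R.tile j).top = (R.tile i).bottom := by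
  have hp := hR.tile_proper
  rw [isWall_vert, avoidsTiles_vert hp] at hW
  obtain ⟨⟨hac, ⟨o1, o2, o3, o4⟩, hav⟩, n1, n2, hmax⟩ := hW
  obtain ⟨i1, i2, i3⟩ := (onSecondSide_vert (hp i)).1 hi
  obtain ⟨p1, p2⟩ := hp i
  obtain ⟨s1, s2, s3, s4⟩ := hR.tile_subset i
  have hex : ∃ j, u < (R.tile j).right ∧ (R.tile j).left ≤ u ∧ (R.tile i).bottom ≤ (R.tile j).top ∧
      (R.tile j).bottom < (R.tile i).bottom := by
    by_contra! hno
    have key : ∀ j, ∀ᶠ δ : ℝ in 𝓝[>] 0,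
        (u + δ, (R.tile i).bottom - δ) ∉ (R.tile j).toSet := by
      intro j
      have tend1 : Tendsto (fun δ : ℝ => u + δ) (𝓝[>] 0) (𝓝 u) :=
        ((continuous_const.add continuous_id).tendsto' 0 u (by simp)).mono_left
          nhdsWithin_le_nhds
      have tend2 : Tendsto (fun δ : ℝ => (R.tile i).bottom - δ) (𝓝[>] 0)
          (𝓝 (R.tile i).bottom) :=
        ((continuous_const.sub continuous_id).tendsto' 0 _ (by simp)).mono_left
          nhdsWithin_le_nhds
      by_cases h1 : u < (R.tile j).right
      · by_cases h2 : (R.tile j).left ≤ u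
        · by_cases h3 : (R.tile i).bottom ≤ (R.tile j).top
          · have h4 := hno j h1 h2 h3
            filter_upwards [self_mem_nhdsWithin] with δ hδ hm
            have : (0 : ℝ) < δ := hδ
            have := hm.2.2.1
            simp only at this
            linarith
          · filter_upwards [tend2.eventually_const_lt (not_le.1 h3)] with δ hδ hm
            exact absurd hm.2.2.2 (not_le.2 hδ)
        · filter_upwards [tend1.eventually_lt_const (not_le.1 h2)] with δ hδ hm
          exact absurd hm.1 (not_le.2 hδ)
      · filter_upwards [self_mem_nhdsWithin] with δ hδ hm
        have : (0 : ℝ) < δ := hδ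
        have := hm.2.1
        simp only at this
        linarith
    have hall := eventually_all.2 key
    have hin : ∀ᶠ δ : ℝ in 𝓝[>] 0, (0 < δ ∧ δ < R.outer.right - u) ∧
        δ < (R.tile i).bottom - R.outer.bottom := by
      have e1 : 0 < R.outer.right - u := sub_pos.2 (lt_of_le_of_ne o2 n2)
      have e2 : 0 < (R.tile i).bottom - R.outer.bottom := by linarith
      filter_upwards [Ioo_mem_nhdsGT e1, Ioo_mem_nhdsGT e2] with δ h1 h2
      exact ⟨h1, h2.2⟩
    obtain ⟨δ, h1, ⟨h2, h3⟩, h4⟩ := (hall.and hin).exists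
    have hmem : (u + δ, (R.tile i).bottom - δ) ∈ R.outer.toSet :=
      ⟨by simp only; linarith, by simp only; linarith, by simp only; linarith,
        by simp only; linarith⟩
    rw [← hR.cover, Set.mem_iUnion] at hmem
    obtain ⟨j, hj⟩ := hmem
    exact h1 j hj
  obtain ⟨j, j1, j2, j3, j4⟩ := hex
  obtain ⟨q1, q2⟩ := hp j
  have hr : (R.tile j).left = u := by
    refine le_antisymm j2 ?_
    by_contra! hr
    rcases hav j hr j1 with h | h <;> linarith
  have hb : (R.tile j).top = (R.tile i).bottom := by
    refine le_antisymm ?_ j3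
    have hij : i ≠ j := by rintro rfl; exact lt_irrefl _ j4
    rcases hR.separated hij with h | h | h | h <;> linarith
  refine ⟨j, (onSecondSide_vert (hp j)).2 ⟨hr, ?_, by linarith⟩, hb⟩
  obtain ⟨t1, t2, t3, t4⟩ := hR.tile_subset j
  have hA : R.AvoidsTiles (.vert u (min a (R.tile j).bottom) c) := by
    rw [avoidsTiles_vert hp]
    refine ⟨(min_le_left _ _).trans_lt hac, ⟨o1, o2, le_min o3 t3, o4⟩, fun m hl hr' => ?_⟩
    rcases hav m hl hr' with h | h
    · refine Or.inl (le_min h ?_)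
      have hjm : j ≠ m := by rintro rfl; linarith
      rcases hR.separated hjm with h' | h' | h' | h' <;> linarith [(hp m).2]
    · exact Or.inr h
  rw [← (hmax _ _ hA (min_le_left _ _) le_rfl).1]
  exact min_le_right _ _

/-! ### Tilings with the same walls and wall shuffles -/

/-- Two segments with the same adjacent tiles on each side and the same order of the recorded
numbers. -/
structure SegMatch (R R' : Drawing n) (s s' : Seg) : Prop where
  vert : s'.IsVert ↔ s.IsVert
  first : ∀ i, R'.OnFirstSide s' i ↔ R.OnFirstSide s i
  second : ∀ i, R'.OnSecondSide s' i ↔ R.OnSecondSide s i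
  shuffle : ∀ i, R'.InShuffle s' i ↔ R.InShuffle s i
  lt_iff : ∀ i j h₁ h₂ k₁ k₂, i ≠ j → R.Records s i h₁ → R.Records s j h₂ →
    R'.Records s' i k₁ → R'.Records s' j k₂ → (h₁ < h₂ ↔ k₁ < k₂)

theorem SegMatch.transpose {R R' : Drawing n} {s s' : Seg} (h : SegMatch R R' s s') :
    SegMatch R.transpose R'.transpose s.transpose s'.transpose where
  vert := by rw [Seg.isVert_transpose, Seg.isVert_transpose, h.vert]
  first i := by rw [onFirstSide_transpose, onFirstSide_transpose, h.second]
  second i := by rw [onSecondSide_transpose, onSecondSide_transpose, h.first]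
  shuffle i := by rw [inShuffle_transpose, inShuffle_transpose, h.shuffle]
  lt_iff i j h₁ h₂ k₁ k₂ := by simp only [records_transpose]; exact h.lt_iff i j h₁ h₂ k₁ k₂

/-- Every wall of `R` has a matching wall of `R'`. -/
def WallsMatch (R R' : Drawing n) : Prop :=
  ∀ s, R.IsWall s → ∃ s', R'.IsWall s' ∧ SegMatch R R' s s'

theorem WallsMatch.transpose {R R' : Drawing n} (h : WallsMatch R R') :
    WallsMatch R.transpose R'.transpose := by
  intro s hs
  rw [← s.transpose_transpose, isWall_transpose] at hs
  obtain ⟨s', hs', hm⟩ := h _ hs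
  exact ⟨s'.transpose, hs'.transpose, by simpa using hm.transpose⟩

/-- The two touching edges span a single segment that misses all interiors, even if they share only
an endpoint. The wall is its maximal extension. -/
theorem exists_common_wall (hR : R.IsGenericTiling) {i j : Fin n}
    (h : (R.tile i).IsLeftOf (R.tile j)) :
    ∃ u a c, R.IsWall (.vert u a c) ∧ R.OnFirstSide (.vert u a c) i ∧
      R.OnSecondSide (.vert u a c) j := by
  have hp := hR.tile_proper
  rw [Rect.isLeftOf_iff (hp i) (hp j)] at h
  obtain ⟨h1, h2, h3⟩ := h
  obtain ⟨i1, i2⟩ := hp i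
  obtain ⟨j1, j2⟩ := hp j
  obtain ⟨s1, s2, s3, s4⟩ := hR.tile_subset i
  obtain ⟨t1, t2, t3, t4⟩ := hR.tile_subset j
  have hA : R.AvoidsTiles (.vert (R.tile i).right (min (R.tile i).bottom (R.tile j).bottom)
      (max (R.tile i).top (R.tile j).top)) := by
    rw [avoidsTiles_vert hp]
    refine ⟨(min_le_left _ _).trans_lt (i2.trans_le (le_max_left _ _)),
      ⟨by linarith, by linarith, le_min s3 t3, max_le s4 t4⟩, fun m hl hr => ?_⟩
    have hi : i ≠ m := by rintro rfl; exact lt_irrefl _ hr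
    have hj : j ≠ m := by rintro rfl; linarith
    rw [le_min_iff, max_le_iff]
    have hm := (hp m).2
    rcases hR.separated hi with h | h | h | h <;> rcases hR.separated hj with h' | h' | h' | h' <;>
      first
      | (left; constructor <;> linarith)
      | (right; constructor <;> linarith)
  obtain ⟨a, c, ha, hc, hW⟩ := exists_wall hp hA (by linarith) (by linarith)
  rw [le_min_iff] at ha
  rw [max_le_iff] at hc
  exact ⟨_, a, c, hW, (onFirstSide_vert (hp i)).2 ⟨rfl, ha.1, hc.1⟩,
    (onSecondSide_vert (hp j)).2 ⟨h1.symm, ha.2, hc.2⟩⟩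

/-- Tiles `i`, `j` on opposite sides of a wall can fail to touch in two ways, and the shuffle shows
both. If `i` lies above `j`, both are recorded, `j` first. If `i` lies below `j`, then the tile next
above `i` and the tile next below `j` are recorded, in this order. -/
theorem WallsMatch.isLeftOf {R R' : Drawing n} (hR : R.IsGenericTiling) (hR' : R'.IsGenericTiling)
    (hm : WallsMatch R R') {i j : Fin n} (h : (R.tile i).IsLeftOf (R.tile j)) :
    (R'.tile i).IsLeftOf (R'.tile j) := by
  have hp := hR.tile_proper
  have hp' := hR'.tile_proper
  obtain ⟨u, a, c, hW, hi, hj⟩ := exists_common_wall hR h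
  rw [Rect.isLeftOf_iff (hp i) (hp j)] at h
  obtain ⟨h1, h2, h3⟩ := h
  obtain ⟨s', hW', hs⟩ := hm _ hW
  obtain ⟨u', a', c'⟩ | ⟨v, a', c'⟩ := s'
  swap
  · exact absurd (hs.vert.2 trivial) id
  have first_lt {k : Fin n} (hk : R.OnFirstSide (.vert u a c) k) (hk' : a' < (R'.tile k).bottom) :
      a < (R.tile k).bottom := by
    obtain ⟨y, ⟨_, hy, _⟩ | ⟨hy, _⟩⟩ :=
      (hs.shuffle k).1 ⟨_, Or.inl ⟨(hs.first k).2 hk, hk', rfl⟩⟩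
    · exact hy
    · have e1 := ((onFirstSide_vert (hp k)).1 hk).1
      have e2 := ((onSecondSide_vert (hp k)).1 hy).1
      linarith [(hp k).1]
  have second_lt {k : Fin n} (hk : R.OnSecondSide (.vert u a c) k)
      (hk' : (R'.tile k).top < c') : (R.tile k).top < c := by
    obtain ⟨y, ⟨hy, _⟩ | ⟨_, hy, _⟩⟩ :=
      (hs.shuffle k).1 ⟨_, Or.inr ⟨(hs.second k).2 hk, hk', rfl⟩⟩
    · have e1 := ((onFirstSide_vert (hp k)).1 hy).1
      have e2 := ((onSecondSide_vert (hp k)).1 hk).1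
      linarith [(hp k).1]
    · exact hy
  have ne {k m : Fin n} (hk : R.OnFirstSide (.vert u a c) k)
      (hm : R.OnSecondSide (.vert u a c) m) : k ≠ m := by
    rintro rfl
    have e1 := ((onFirstSide_vert (hp k)).1 hk).1
    have e2 := ((onSecondSide_vert (hp k)).1 hm).1
    linarith [(hp k).1]
  have hi' := (hs.first i).2 hi
  have hj' := (hs.second j).2 hj
  obtain ⟨i1, i2, i3⟩ := (onFirstSide_vert (hp' i)).1 hi'
  obtain ⟨j1, j2, j3⟩ := (onSecondSide_vert (hp' j)).1 hj'
  rw [Rect.isLeftOf_iff (hp' i) (hp' j)]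
  refine ⟨i1.trans j1.symm, ?_, ?_⟩
  · by_contra! hlt
    have ri : a' < (R'.tile i).bottom := by linarith [(hp' j).2]
    have rj : (R'.tile j).top < c' := by linarith [(hp' i).2]
    have := (hs.lt_iff j i _ _ _ _ (ne hi hj).symm (Or.inr ⟨hj, second_lt hj rj, rfl⟩)
      (Or.inl ⟨hi, first_lt hi ri, rfl⟩) (Or.inr ⟨hj', rj, rfl⟩) (Or.inl ⟨hi', ri, rfl⟩)).2 hlt
    linarith
  · by_contra! hlt
    have ri : (R'.tile i).top < c' := by linarith [(hp' j).2]
    have rj : a' < (R'.tile j).bottom := by linarith [(hp' i).2]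
    -- The top of `i` and the bottom of `j` are not recorded under their own labels, but they are
    -- the recorded heights of the neighbours `k` and `m`.
    obtain ⟨k, hk', hki⟩ := hR'.exists_above hW' hi' ri
    obtain ⟨m, hm', hmj⟩ := hR'.exists_below hW' hj' rj
    have hk := (hs.first k).1 hk'
    have hm := (hs.second m).1 hm'
    have bk : a' < (R'.tile k).bottom := by linarith [(hp' i).2]
    have tm : (R'.tile m).top < c' := by linarith [(hp' j).2]
    have rk := first_lt hk bk
    have rm := second_lt hm tm
    have hkm := (hs.lt_iff k m _ _ _ _ (ne hk hm) (Or.inl ⟨hk, rk, rfl⟩) (Or.inr ⟨hm, rm, rfl⟩)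
      (Or.inl ⟨hk', bk, rfl⟩) (Or.inr ⟨hm', tm, rfl⟩)).2 (by linarith)
    obtain ⟨i1', i2', i3'⟩ := (onFirstSide_vert (hp i)).1 hi
    obtain ⟨j1', j2', j3'⟩ := (onSecondSide_vert (hp j)).1 hj
    obtain ⟨k1', k2', k3'⟩ := (onFirstSide_vert (hp k)).1 hk
    obtain ⟨m1', m2', m3'⟩ := (onSecondSide_vert (hp m)).1 hm
    have ik : i ≠ k := by rintro rfl; linarith [(hp' i).2]
    have jm : j ≠ m := by rintro rfl; linarith [(hp' j).2]
    -- That `i` is below `k` carries over to `R`: by the order of records if `i` is recorded, and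
    -- otherwise because an unrecorded tile starts at the end of the wall in both tilings.
    have hik : (R.tile i).top ≤ (R.tile k).bottom := by
      have hlt' : (R.tile i).bottom < (R.tile k).bottom := by
        rcases i2.eq_or_lt with e | e
        · rcases i2'.eq_or_lt with e' | e'
          · linarith
          · obtain ⟨y, ⟨_, hy, _⟩ | ⟨hy, _⟩⟩ :=
              (hs.shuffle i).2 ⟨_, Or.inl ⟨hi, e', rfl⟩⟩
            · linarith
            · have := ((onSecondSide_vert (hp' i)).1 hy).1
              linarith [(hp' i).1]
        · exact (hs.lt_iff i k _ _ _ _ ik (Or.inl ⟨hi, first_lt hi e, rfl⟩)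
            (Or.inl ⟨hk, rk, rfl⟩) (Or.inl ⟨hi', e, rfl⟩) (Or.inl ⟨hk', bk, rfl⟩)).2
            (by linarith [(hp' i).2])
      rcases hR.separated ik with h | h | h | h <;>
        linarith [(hp i).1, (hp k).1, (hp i).2, (hp k).2]
    have hmj : (R.tile m).top ≤ (R.tile j).bottom := by
      have hlt' : (R.tile m).top < (R.tile j).top := by
        rcases j3.eq_or_lt with e | e
        · rcases j3'.eq_or_lt with e' | e'
          · linarith
          · obtain ⟨y, ⟨hy, _⟩ | ⟨_, hy, _⟩⟩ :=
              (hs.shuffle j).2 ⟨_, Or.inr ⟨hj, e', rfl⟩⟩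
            · have := ((onFirstSide_vert (hp' j)).1 hy).1
              linarith [(hp' j).1]
            · linarith
        · exact (hs.lt_iff m j _ _ _ _ jm.symm (Or.inr ⟨hm, rm, rfl⟩)
            (Or.inr ⟨hj, second_lt hj e, rfl⟩) (Or.inr ⟨hm', tm, rfl⟩) (Or.inr ⟨hj', e, rfl⟩)).2
            (by linarith [(hp' j).2])
      rcases hR.separated jm with h | h | h | h <;>
        linarith [(hp j).1, (hp m).1, (hp j).2, (hp m).2]
    linarith

theorem WallsMatch.isBelow {R R' : Drawing n} (hR : R.IsGenericTiling) (hR' : R'.IsGenericTiling)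
    (hm : WallsMatch R R') {i j : Fin n} (h : (R.tile i).IsBelow (R.tile j)) :
    (R'.tile i).IsBelow (R'.tile j) := by
  rw [← Rect.isLeftOf_transpose] at h ⊢
  exact hm.transpose.isLeftOf hR.transpose hR'.transpose h

end Drawing
end Rectangulation

namespace Rectangulation

/-! ### The walls around a tile of a diagonal rectangulation

A permutation is encoded by the function `τ` that gives the position of each label; the labels are
`0, …, n - 1`, and the wall with index `w` separates the labels `w - 1` and `w`. -/

/-- The index of the wall on the left of the tile `k`. -/
def leftWall (τ : ℕ → ℤ) (k : ℕ) : ℕ :=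
  Nat.findGreatest (fun w => w = 0 ∨ τ (w - 1) < τ k) k

/-- The index of the wall on the right of the tile `k`. -/
noncomputable def rightWall (n : ℕ) (τ : ℕ → ℤ) (k : ℕ) : ℕ :=
  sInf {w | k < w ∧ (w = n ∨ τ k < τ w)}

/-- The index of the wall above the tile `k`. -/
def topWall (τ : ℕ → ℤ) (k : ℕ) : ℕ := leftWall (-τ) k

/-- The index of the wall below the tile `k`. -/
noncomputable def bottomWall (n : ℕ) (τ : ℕ → ℤ) (k : ℕ) : ℕ := rightWall n (-τ) k

def DistinctBelow (n : ℕ) (τ : ℕ → ℤ) : Prop := ∀ i j, i < n → j < n → τ i = τ j → i = j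

theorem DistinctBelow.neg {n : ℕ} {τ : ℕ → ℤ} (h : DistinctBelow n τ) : DistinctBelow n (-τ) :=
  fun i j hi hj hij => h i j hi hj (neg_injective hij)

theorem DistinctBelow.reflect {n : ℕ} {τ : ℕ → ℤ} (h : DistinctBelow n τ) :
    DistinctBelow n (fun k => τ (n - 1 - k)) := fun i j hi hj hij => by
  have := h _ _ (by omega) (by omega) hij
  omega

/-! ### Characterization of the four walls around a tile. -/

section Specs

variable {n : ℕ} {τ : ℕ → ℤ} (hτ : DistinctBelow n τ) {k : ℕ} (hk : k < n)
include hτ hk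

theorem leftWall_spec : leftWall τ k ≤ k ∧ (leftWall τ k = 0 ∨ τ (leftWall τ k - 1) < τ k) ∧
    ∀ j, leftWall τ k ≤ j → j < k → τ k < τ j := by
  refine ⟨Nat.findGreatest_le _, ?_, fun j h1 h2 => ?_⟩
  · exact Nat.findGreatest_spec (P := fun w => w = 0 ∨ τ (w - 1) < τ k) (Nat.zero_le k)
      (Or.inl rfl)
  · have := Nat.findGreatest_is_greatest (P := fun w => w = 0 ∨ τ (w - 1) < τ k)
      (n := k) (k := j + 1) (Nat.lt_succ_of_le h1) h2
    simp only [Nat.add_sub_cancel, not_or, not_lt] at this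
    refine lt_of_le_of_ne this.2 fun e => ?_
    have := hτ k j hk (by omega) e
    omega

theorem rightWall_spec : k < rightWall n τ k ∧ rightWall n τ k ≤ n ∧
    (rightWall n τ k = n ∨ τ k < τ (rightWall n τ k)) ∧
    ∀ j, k < j → j < rightWall n τ k → τ j < τ k := by
  have hmem : n ∈ {w | k < w ∧ (w = n ∨ τ k < τ w)} := ⟨hk, Or.inl rfl⟩
  have h1 := Nat.sInf_mem ⟨n, hmem⟩
  have h2 : rightWall n τ k ≤ n := Nat.sInf_le hmem
  refine ⟨h1.1, h2, h1.2, fun j h3 h4 => ?_⟩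
  have h5 : j ∉ {w | k < w ∧ (w = n ∨ τ k < τ w)} := Nat.notMem_of_lt_sInf h4
  by_contra! h6
  refine h5 ⟨h3, Or.inr (lt_of_le_of_ne h6 fun e => ?_)⟩
  have := hτ k j hk (by omega) e
  omega

theorem topWall_spec : topWall τ k ≤ k ∧ (topWall τ k = 0 ∨ τ k < τ (topWall τ k - 1)) ∧
    ∀ j, topWall τ k ≤ j → j < k → τ j < τ k := by
  simpa [topWall] using leftWall_spec hτ.neg hk

theorem bottomWall_spec : k < bottomWall n τ k ∧ bottomWall n τ k ≤ n ∧
    (bottomWall n τ k = n ∨ τ (bottomWall n τ k) < τ k) ∧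
    ∀ j, k < j → j < bottomWall n τ k → τ k < τ j := by
  simpa [bottomWall] using rightWall_spec hτ.neg hk

/-- Two different candidates would compare the position of one and the same label with that of `k`
in opposite ways. -/
theorem leftWall_eq_iff {w : ℕ} : leftWall τ k = w ↔ w ≤ k ∧ (w = 0 ∨ τ (w - 1) < τ k) ∧
    ∀ j, w ≤ j → j < k → τ k < τ j := by
  obtain ⟨h1, h2, h3⟩ := leftWall_spec hτ hk
  constructor
  · rintro rfl; exact ⟨h1, h2, h3⟩
  · rintro ⟨h4, h5, h6⟩
    rcases lt_trichotomy (leftWall τ k) w with h | h | h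
    · have := h3 (w - 1) (by omega) (by omega)
      omega
    · exact h
    · have := h6 (leftWall τ k - 1) (by omega) (by omega)
      omega

theorem rightWall_eq_iff {w : ℕ} : rightWall n τ k = w ↔ k < w ∧ w ≤ n ∧ (w = n ∨ τ k < τ w) ∧
    ∀ j, k < j → j < w → τ j < τ k := by
  obtain ⟨h0, h1, h2, h3⟩ := rightWall_spec hτ hk
  constructor
  · rintro rfl; exact ⟨h0, h1, h2, h3⟩
  · rintro ⟨h4, h5, h6, h7⟩
    rcases lt_trichotomy (rightWall n τ k) w with h | h | h
    · have := h7 (rightWall n τ k) (by omega) (by omega)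
      omega
    · exact h
    · have := h3 w (by omega) (by omega)
      omega

theorem topWall_eq_iff {w : ℕ} : topWall τ k = w ↔ w ≤ k ∧ (w = 0 ∨ τ k < τ (w - 1)) ∧
    ∀ j, w ≤ j → j < k → τ j < τ k := by
  simpa [topWall] using leftWall_eq_iff hτ.neg hk

theorem bottomWall_eq_iff {w : ℕ} : bottomWall n τ k = w ↔
    k < w ∧ w ≤ n ∧ (w = n ∨ τ w < τ k) ∧ ∀ j, k < j → j < w → τ k < τ j := by
  simpa [bottomWall] using rightWall_eq_iff hτ.neg hk

end Specs

/-! ### Telescoping along walls and the area identity. -/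

/-- Think of `K` as the tiles on one side of a wall. Each tile ends either at the end `e` of the
wall or where another tile starts, and no two end at the same place. By counting, these places are
`e` and all the starts except that of `w`, so the sum telescopes. -/
theorem sum_image_shift {K : Finset ℕ} {w e : ℕ} {N s : ℕ → ℕ} (hs : s.Injective) (hw : w ∈ K)
    (he : ∀ k ∈ K, s k ≠ e) (hN : ∀ k ∈ K, N k = e ∨ ∃ m ∈ K, m ≠ w ∧ s m = N k)
    (hinj : ∀ k ∈ K, ∀ m ∈ K, N k = N m → k = m) (g : ℕ → ℤ) :
    ∑ k ∈ K, g (N k) = g e - g (s w) + ∑ k ∈ K, g (s k) := by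
  have hi : Set.InjOn N K := fun k hk m hm h => hinj k hk m hm h
  have he' : e ∉ (K.erase w).image s := by
    simp only [Finset.mem_image, Finset.mem_erase, not_exists, not_and]
    exact fun k hk => he k hk.2
  have himg : K.image N = insert e ((K.erase w).image s) := by
    refine Finset.eq_of_subset_of_card_le ?_ ?_
    · intro m hm
      obtain ⟨k, hk, rfl⟩ := Finset.mem_image.1 hm
      rcases hN k hk with h | ⟨m, hm, hmw, h⟩
      · simp [h]
      · rw [← h]
        exact Finset.mem_insert_of_mem
          (Finset.mem_image_of_mem _ (Finset.mem_erase.2 ⟨hmw, hm⟩))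
    · rw [Finset.card_insert_of_notMem he', Finset.card_image_of_injective _ hs,
        Finset.card_image_of_injOn hi, Finset.card_erase_of_mem hw]
      have := Finset.card_pos.2 ⟨w, hw⟩
      omega
  rw [← Finset.sum_image (f := g) hi, himg, Finset.sum_insert he', Finset.sum_image hs.injOn,
    ← Finset.add_sum_erase K _ hw]
  ring

section Telescoping

variable {n : ℕ} {τ : ℕ → ℤ}

/-- The index of the wall in which the lower end of the vertical wall `w` lies. -/
noncomputable def lowerEnd (n : ℕ) (τ : ℕ → ℤ) (w : ℕ) : ℕ :=
  if w = 0 then n else bottomWall n τ (w - 1)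

/-- The index of the wall in which the upper end of the vertical wall `w` lies. -/
def upperEnd (n : ℕ) (τ : ℕ → ℤ) (w : ℕ) : ℕ := if w = n then 0 else topWall τ w

/-- The tiles to the right of the wall `w` are stacked downwards from the tile `w`. Every other such
tile `k` starts at the wall `k`, and its lower end is the lower end of the wall or the index of the
next tile. -/
theorem sum_leftWall_eq (hτ : DistinctBelow n τ) {w : ℕ} (hw : w < n)
    (hv : w = 0 ∨ τ (w - 1) < τ w) (g : ℕ → ℤ) :
    ∑ k ∈ Finset.range n with leftWall τ k = w, (g (bottomWall n τ k) - g (topWall τ k)) =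
      g (lowerEnd n τ w) - g (upperEnd n τ w) := by
  have hwK : w ∈ (Finset.range n).filter fun k => leftWall τ k = w := by
    simp only [Finset.mem_filter, Finset.mem_range, hw, true_and]
    rw [leftWall_eq_iff hτ hw]
    exact ⟨le_rfl, hv, by omega⟩
  have hsum := sum_image_shift (K := (Finset.range n).filter fun k => leftWall τ k = w) (w := w)
    (e := lowerEnd n τ w) (N := bottomWall n τ) (s := id) Function.injective_id hwK ?_ ?_ ?_ g
  · have htop : ∑ k ∈ Finset.range n with leftWall τ k = w, g (topWall τ k) =
        g (upperEnd n τ w) - g w + ∑ k ∈ Finset.range n with leftWall τ k = w, g k := by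
      rw [← Finset.add_sum_erase _ _ hwK, ← Finset.add_sum_erase _ g hwK, upperEnd,
        if_neg hw.ne, Finset.sum_congr rfl (g := g)]
      · ring
      · intro k hk
        simp only [Finset.mem_erase, Finset.mem_filter, Finset.mem_range] at hk
        obtain ⟨hkw, hkn, hk⟩ := hk
        rw [leftWall_eq_iff hτ hkn] at hk
        congr 1
        rw [topWall_eq_iff hτ hkn]
        exact ⟨le_rfl, Or.inr (hk.2.2 _ (by omega) (by omega)), by omega⟩
    rw [Finset.sum_sub_distrib, hsum, htop]
    simp
  · intro k hk
    simp only [Finset.mem_filter, Finset.mem_range] at hk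
    obtain ⟨hkn, hk⟩ := hk
    rw [leftWall_eq_iff hτ hkn] at hk
    intro (e : k = _)
    unfold lowerEnd at e
    split_ifs at e with h0
    · omega
    · have := bottomWall_spec hτ (k := w - 1) (by omega)
      rw [← e] at this
      omega
  · intro k hk
    simp only [Finset.mem_filter, Finset.mem_range] at hk
    obtain ⟨hkn, hk⟩ := hk
    rw [leftWall_eq_iff hτ hkn] at hk
    obtain ⟨h1, h2, h3, h4⟩ := bottomWall_spec hτ hkn
    rw [or_iff_not_imp_left]
    intro hne
    -- A tile that does not end at the lower end of the wall ends at a label that again has `w` as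
    -- its left wall.
    have key : bottomWall n τ k < n ∧ (w = 0 ∨ τ (w - 1) < τ (bottomWall n τ k)) := by
      by_cases h0 : w = 0
      · simp only [lowerEnd, h0, if_true] at hne
        exact ⟨by omega, Or.inl h0⟩
      · simp only [lowerEnd, h0, if_false] at hne
        by_contra hcon
        refine hne ?_
        symm
        rw [bottomWall_eq_iff hτ (by omega)]
        refine ⟨by omega, h2, ?_, fun j hj hj' => ?_⟩
        · by_contra! hc
          refine hcon ⟨by omega, Or.inr (lt_of_le_of_ne hc.2 fun e => ?_)⟩
          have := hτ (w - 1) (bottomWall n τ k) (by omega) (by omega) e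
          omega
        · rcases lt_trichotomy j k with h | h | h
          · have := hk.2.2 j (by omega) h
            omega
          · subst h; omega
          · have := h4 j h hj'
            omega
    refine ⟨bottomWall n τ k, ?_, by omega, rfl⟩
    simp only [Finset.mem_filter, Finset.mem_range, key.1, true_and]
    rw [leftWall_eq_iff hτ key.1]
    refine ⟨by omega, key.2, fun j hj hj' => ?_⟩
    have h3' : τ (bottomWall n τ k) < τ k := by omega
    rcases lt_trichotomy j k with h | h | h
    · have := hk.2.2 j (by omega) h
      omega
    · subst h; omega
    · have := h4 j h hj'
      omega
  · intro k hk m hm hkm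
    simp only [Finset.mem_filter, Finset.mem_range] at hk hm
    obtain ⟨hkn, hk⟩ := hk
    obtain ⟨hmn, hm⟩ := hm
    rw [leftWall_eq_iff hτ hkn] at hk
    rw [leftWall_eq_iff hτ hmn] at hm
    have h1 := bottomWall_spec hτ hkn
    have h2 := bottomWall_spec hτ hmn
    rcases lt_trichotomy k m with h | h | h
    · have := hm.2.2 k hk.1 h
      have := h1.2.2.2 m h (by omega)
      omega
    · exact h
    · have := hk.2.2 m hm.1 h
      have := h2.2.2.2 k h (by omega)
      omega

/-- Now the stack is read upwards from the tile `w - 1`. Every other tile `k` in it has `k + 1` as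
its bottom wall, which is why the shift is the successor. -/
theorem sum_rightWall_eq (hτ : DistinctBelow n τ) {w : ℕ} (h0 : 0 < w) (hw : w ≤ n)
    (hv : w = n ∨ τ (w - 1) < τ w) (g : ℕ → ℤ) :
    ∑ k ∈ Finset.range n with rightWall n τ k = w, (g (bottomWall n τ k) - g (topWall τ k)) =
      g (lowerEnd n τ w) - g (upperEnd n τ w) := by
  have hwK : w - 1 ∈ (Finset.range n).filter fun k => rightWall n τ k = w := by
    simp only [Finset.mem_filter, Finset.mem_range]
    refine ⟨by omega, ?_⟩
    rw [rightWall_eq_iff hτ (by omega)]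
    exact ⟨by omega, hw, hv, by omega⟩
  have hsum := sum_image_shift (K := (Finset.range n).filter fun k => rightWall n τ k = w)
    (w := w - 1) (e := upperEnd n τ w) (N := topWall τ) (s := Nat.succ) Nat.succ_injective
    hwK ?_ ?_ ?_ g
  · have hbot : ∑ k ∈ Finset.range n with rightWall n τ k = w, g (bottomWall n τ k) =
        g (lowerEnd n τ w) - g w +
          ∑ k ∈ Finset.range n with rightWall n τ k = w, g (k.succ) := by
      rw [← Finset.add_sum_erase _ _ hwK, ← Finset.add_sum_erase _ (fun k => g (k.succ)) hwK,
        lowerEnd, if_neg h0.ne', Finset.sum_congr rfl (g := fun k => g k.succ)]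
      · rw [show (w - 1).succ = w by omega]; ring
      · intro k hk
        simp only [Finset.mem_erase, Finset.mem_filter, Finset.mem_range] at hk
        obtain ⟨hkw, hkn, hk⟩ := hk
        rw [rightWall_eq_iff hτ hkn] at hk
        congr 1
        rw [bottomWall_eq_iff hτ hkn]
        exact ⟨by omega, by omega, Or.inr (hk.2.2.2 _ (by omega) (by omega)), by omega⟩
    rw [Finset.sum_sub_distrib, hsum, hbot, show (w - 1).succ = w by omega]
    ring
  · intro k hk
    simp only [Finset.mem_filter, Finset.mem_range] at hk
    obtain ⟨hkn, hk⟩ := hk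
    rw [rightWall_eq_iff hτ hkn] at hk
    intro (e : k + 1 = _)
    unfold upperEnd at e
    split_ifs at e with h0
    have := topWall_spec hτ (k := w) (by omega)
    rw [← e, Nat.add_sub_cancel] at this
    omega
  · intro k hk
    simp only [Finset.mem_filter, Finset.mem_range] at hk
    obtain ⟨hkn, hk⟩ := hk
    rw [rightWall_eq_iff hτ hkn] at hk
    obtain ⟨h1, h2, h3⟩ := topWall_spec hτ hkn
    rw [or_iff_not_imp_left]
    intro hne
    have key : topWall τ k ≠ 0 ∧ (w = n ∨ τ (topWall τ k - 1) < τ w) := by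
      by_cases h0 : w = n
      · simp only [upperEnd, h0, if_true] at hne
        exact ⟨by omega, Or.inl h0⟩
      · simp only [upperEnd, h0, if_false] at hne
        by_contra hcon
        refine hne ?_
        symm
        rw [topWall_eq_iff hτ (by omega)]
        refine ⟨by omega, ?_, fun j hj hj' => ?_⟩
        · by_contra! hc
          refine hcon ⟨by omega, Or.inr (lt_of_le_of_ne hc.2 fun e => ?_)⟩
          have := hτ _ _ (by omega) (by omega) e
          omega
        · rcases lt_trichotomy j k with h | h | h
          · have := h3 j (by omega) h
            omega
          · subst h; omega
          · have := hk.2.2.2 j h hj'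
            omega
    refine ⟨topWall τ k - 1, ?_, by omega, by omega⟩
    simp only [Finset.mem_filter, Finset.mem_range]
    refine ⟨by omega, ?_⟩
    rw [rightWall_eq_iff hτ (by omega)]
    refine ⟨by omega, hw, key.2, fun j hj hj' => ?_⟩
    have h3' : τ k < τ (topWall τ k - 1) := by omega
    rcases lt_trichotomy j k with h | h | h
    · have := h3 j (by omega) h
      omega
    · subst h; omega
    · have := hk.2.2.2 j h hj'
      omega
  · intro k hk m hm hkm
    simp only [Finset.mem_filter, Finset.mem_range] at hk hm
    obtain ⟨hkn, hk⟩ := hk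
    obtain ⟨hmn, hm⟩ := hm
    rw [rightWall_eq_iff hτ hkn] at hk
    rw [rightWall_eq_iff hτ hmn] at hm
    have h1 := topWall_spec hτ hkn
    have h2 := topWall_spec hτ hmn
    rcases lt_trichotomy k m with h | h | h
    · have := hk.2.2.2 m h hm.1
      have := h2.2.2 k (by omega) h
      omega
    · exact h
    · have := hm.2.2.2 k h hk.1
      have := h1.2.2 m (by omega) h
      omega

/-- The bilinear form of the fact that the areas of the tiles add up to that of the square. -/
theorem sum_area (hτ : DistinctBelow n τ) (hn : 0 < n) (f g : ℕ → ℤ) :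
    ∑ k ∈ Finset.range n, (f (leftWall τ k) - f (rightWall n τ k)) *
      (g (bottomWall n τ k) - g (topWall τ k)) = (f 0 - f n) * (g n - g 0) := by
  have hl : ∀ k ∈ Finset.range n, leftWall τ k ∈ Finset.range (n + 1) := fun k hk => by
    have := (leftWall_spec hτ (Finset.mem_range.1 hk)).1
    simp only [Finset.mem_range] at hk ⊢; omega
  have hr : ∀ k ∈ Finset.range n, rightWall n τ k ∈ Finset.range (n + 1) := fun k hk => by
    have := (rightWall_spec hτ (Finset.mem_range.1 hk)).2.1
    simp only [Finset.mem_range]; omega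
  simp only [sub_mul, Finset.sum_sub_distrib (f := fun k => f (leftWall τ k) * _)]
  rw [← Finset.sum_fiberwise_of_maps_to hl, ← Finset.sum_fiberwise_of_maps_to hr,
    ← Finset.sum_sub_distrib]
  -- Group the tiles by left wall and by right wall. At an interior vertical wall both groups
  -- telescope to the same value and cancel; the index of a horizontal wall occurs in neither group;
  -- only the outer sides `0` and `n` contribute.
  have hterm : ∀ w ∈ Finset.range (n + 1),
      (∑ k ∈ Finset.range n with leftWall τ k = w,
        f (leftWall τ k) * (g (bottomWall n τ k) - g (topWall τ k))) -
      (∑ k ∈ Finset.range n with rightWall n τ k = w,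
        f (rightWall n τ k) * (g (bottomWall n τ k) - g (topWall τ k))) =
      (if w = 0 then f 0 * (g n - g 0) else 0) - (if w = n then f n * (g n - g 0) else 0) := by
    intro w hw
    have e1 : ∑ k ∈ Finset.range n with leftWall τ k = w,
        f (leftWall τ k) * (g (bottomWall n τ k) - g (topWall τ k)) =
        f w * ∑ k ∈ Finset.range n with leftWall τ k = w,
          (g (bottomWall n τ k) - g (topWall τ k)) := by
      rw [Finset.mul_sum]
      exact Finset.sum_congr rfl fun k hk => by rw [(Finset.mem_filter.1 hk).2]
    have e2 : ∑ k ∈ Finset.range n with rightWall n τ k = w,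
        f (rightWall n τ k) * (g (bottomWall n τ k) - g (topWall τ k)) =
        f w * ∑ k ∈ Finset.range n with rightWall n τ k = w,
          (g (bottomWall n τ k) - g (topWall τ k)) := by
      rw [Finset.mul_sum]
      exact Finset.sum_congr rfl fun k hk => by rw [(Finset.mem_filter.1 hk).2]
    rw [e1, e2]
    rw [Finset.mem_range] at hw
    have emptyL (h : ∀ k, k < n → leftWall τ k ≠ w) :
        (Finset.range n).filter (fun k => leftWall τ k = w) = ∅ :=
      Finset.filter_eq_empty_iff.2 fun k hk => h k (Finset.mem_range.1 hk)
    have emptyR (h : ∀ k, k < n → rightWall n τ k ≠ w) :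
        (Finset.range n).filter (fun k => rightWall n τ k = w) = ∅ :=
      Finset.filter_eq_empty_iff.2 fun k hk => h k (Finset.mem_range.1 hk)
    by_cases h0 : w = 0
    · subst h0
      rw [sum_leftWall_eq hτ hn (Or.inl rfl), emptyR fun k hk => by
        have := (rightWall_spec hτ hk).1; omega]
      have : topWall τ 0 = 0 := Nat.le_zero.1 (topWall_spec hτ hn).1
      simp [lowerEnd, upperEnd, hn.ne, this]
    · by_cases hn' : w = n
      · subst hn'
        rw [sum_rightWall_eq hτ hn le_rfl (Or.inl rfl), emptyL fun k hk => by
          have := (leftWall_spec hτ hk).1; omega]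
        have : bottomWall w τ (w - 1) = w := by
          have := bottomWall_spec hτ (k := w - 1) (by omega); omega
        simp [lowerEnd, upperEnd, h0, this]
      · by_cases hv : τ (w - 1) < τ w
        · rw [sum_leftWall_eq hτ (by omega) (Or.inr hv),
            sum_rightWall_eq hτ (by omega) (by omega) (Or.inr hv)]
          simp [h0, hn']
        · rw [emptyL, emptyR]
          · simp [h0, hn']
          · intro k hk e
            rw [rightWall_eq_iff hτ hk] at e
            rcases (show k ≤ w - 1 by omega).eq_or_lt with h | h
            · rw [← h] at hv; omega
            · have := e.2.2.2 (w - 1) h (by omega); omega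
          · intro k hk e
            rw [leftWall_eq_iff hτ hk] at e
            rcases e.1.eq_or_lt with h | h
            · rw [h] at hv e; omega
            · have := e.2.2 w le_rfl h; omega
  rw [Finset.sum_congr rfl hterm, Finset.sum_sub_distrib, Finset.sum_ite_eq',
    Finset.sum_ite_eq', if_pos (by simp), if_pos (by simp)]

end Telescoping

end Rectangulation

/-! ### Plans of tilings and their drawings. -/

namespace Rectangulation

/-- The combinatorial data of a tiling: the indices of the walls on the four sides of each tile, of
the four sides of the outer rectangle, of the interior vertical walls `V` and horizontal walls `H`,
and of the walls in which the ends of the walls lie.  The sums say that the tiles on either side of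
a wall fill the wall, and that the tiles fill the outer rectangle. -/
structure Plan (n : ℕ) where
  (l r b t : Fin n → ℕ)
  (L R B T : ℕ)
  (V H : Set ℕ)
  (lo hi lf rt : ℕ → ℕ)
  l_mem : ∀ k, l k = L ∨ l k ∈ V
  r_mem : ∀ k, r k = R ∨ r k ∈ V
  b_mem : ∀ k, b k = B ∨ b k ∈ H
  t_mem : ∀ k, t k = T ∨ t k ∈ H
  L_notMem : L ∉ V
  R_notMem : R ∉ V
  B_notMem : B ∉ H
  T_notMem : T ∉ H
  area : ∀ f g : ℕ → ℤ, ∑ k, (f (l k) - f (r k)) * (g (b k) - g (t k)) =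
    (f L - f R) * (g B - g T)
  sum_l : ∀ w ∈ V, ∀ g : ℕ → ℤ, ∑ k with l k = w, (g (b k) - g (t k)) = g (lo w) - g (hi w)
  sum_r : ∀ w ∈ V, ∀ g : ℕ → ℤ, ∑ k with r k = w, (g (b k) - g (t k)) = g (lo w) - g (hi w)
  sum_b : ∀ w ∈ H, ∀ f : ℕ → ℤ, ∑ k with b k = w, (f (l k) - f (r k)) = f (lf w) - f (rt w)
  sum_t : ∀ w ∈ H, ∀ f : ℕ → ℤ, ∑ k with t k = w, (f (l k) - f (r k)) = f (lf w) - f (rt w)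
  exists_l : ∀ w ∈ V, ∃ k, l k = w
  exists_b : ∀ w ∈ H, ∃ k, b k = w
  no_cross : ∀ k m, l k = r m → b k ≠ t m

namespace Plan

variable {n : ℕ} (P : Plan n) {X Y : ℕ → ℝ}

def transpose : Plan n where
  l := P.b
  r := P.t
  b := P.l
  t := P.r
  L := P.B
  R := P.T
  B := P.L
  T := P.R
  V := P.H
  H := P.V
  lo := P.lf
  hi := P.rt
  lf := P.lo
  rt := P.hi
  l_mem := P.b_mem
  r_mem := P.t_mem
  b_mem := P.l_mem
  t_mem := P.r_mem
  L_notMem := P.B_notMem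
  R_notMem := P.T_notMem
  B_notMem := P.L_notMem
  T_notMem := P.R_notMem
  area f g := by simpa only [mul_comm] using P.area g f
  sum_l := P.sum_b
  sum_r := P.sum_t
  sum_b := P.sum_l
  sum_t := P.sum_r
  exists_l := P.exists_b
  exists_b := P.exists_l
  no_cross k m h h' := P.no_cross k m h' h

/-- The drawing with the combinatorial data `P` and given coordinates of the walls. -/
def draw (X Y : ℕ → ℝ) : Drawing n where
  outer := ⟨X P.L, X P.R, Y P.B, Y P.T⟩
  tile k := ⟨X (P.l k), X (P.r k), Y (P.b k), Y (P.t k)⟩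

/-- Injectivity allows a wall to be recovered from its line. Otherwise only the two sides of one
rectangle are compared, which leaves walls free to slide past each other. -/
structure Fits (X Y : ℕ → ℝ) : Prop where
  inj_X : X.Injective
  inj_Y : Y.Injective
  outer_X : X P.L < X P.R
  outer_Y : Y P.B < Y P.T
  tile_X : ∀ k, X (P.l k) < X (P.r k)
  tile_Y : ∀ k, Y (P.b k) < Y (P.t k)

variable {P}

theorem Fits.transpose (h : P.Fits X Y) : P.transpose.Fits Y X :=
  ⟨h.inj_Y, h.inj_X, h.outer_Y, h.outer_X, h.tile_Y, h.tile_X⟩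

theorem draw_transpose : P.transpose.draw Y X = (P.draw X Y).transpose := rfl

/-- For lower sets `p`, `q` of coordinates, the pair is a point of the outer rectangle if and only
if it is a point of some tile. -/
theorem Fits.exists_tile_iff (h : P.Fits X Y) {p q : ℝ → Prop} (hp : ∀ a b, a < b → p b → p a)
    (hq : ∀ a b, a < b → q b → q a) :
    ((p (X P.L) ∧ ¬ p (X P.R)) ∧ q (Y P.B) ∧ ¬ q (Y P.T)) ↔
    ∃ k, (p (X (P.l k)) ∧ ¬ p (X (P.r k))) ∧ q (Y (P.b k)) ∧ ¬ q (Y (P.t k)) := by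
  classical
  -- For indicators of lower sets, each summand is `1` if the tile contains the cut and `0`
  -- otherwise, so the area identity counts tiles.
  have harea := P.area (fun w => if p (X w) then 1 else 0) (fun w => if q (Y w) then 1 else 0)
  have hterm : ∀ {x x' y y' : ℝ}, x < x' → y < y' →
      ((if p x then (1 : ℤ) else 0) - if p x' then 1 else 0) *
      ((if q y then (1 : ℤ) else 0) - if q y' then 1 else 0) =
      if (p x ∧ ¬ p x') ∧ q y ∧ ¬ q y' then 1 else 0 := by
    intro x x' y y' hx hy
    have h1 := hp _ _ hx
    have h2 := hq _ _ hy
    by_cases a1 : p x <;> by_cases a2 : p x' <;> by_cases a3 : q y <;>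
      by_cases a4 : q y' <;> simp_all
  rw [hterm h.outer_X h.outer_Y, Finset.sum_congr rfl fun k _ => hterm (h.tile_X k) (h.tile_Y k),
    Finset.sum_boole] at harea
  constructor
  · intro ho
    rw [if_pos ho] at harea
    have : 0 < (Finset.univ.filter fun k => (p (X (P.l k)) ∧ ¬ p (X (P.r k))) ∧
      q (Y (P.b k)) ∧ ¬ q (Y (P.t k))).card := by
      rw [← Nat.cast_pos (α := ℤ), harea]; norm_num
    obtain ⟨k, hk⟩ := Finset.card_pos.1 this
    exact ⟨k, (Finset.mem_filter.1 hk).2⟩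
  · rintro ⟨k, hk⟩
    by_contra ho
    rw [if_neg ho] at harea
    have := Finset.card_eq_zero.1 (Nat.cast_eq_zero.1 harea)
    exact Finset.eq_empty_iff_forall_notMem.1 this k (Finset.mem_filter.2 ⟨Finset.mem_univ _, hk⟩)

/-- The same count equals one, so there is no room for a second tile. -/
theorem Fits.tile_unique (h : P.Fits X Y) {p q : ℝ → Prop} (hp : ∀ a b, a < b → p b → p a)
    (hq : ∀ a b, a < b → q b → q a) {k m : Fin n}
    (hk : (p (X (P.l k)) ∧ ¬ p (X (P.r k))) ∧ q (Y (P.b k)) ∧ ¬ q (Y (P.t k)))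
    (hm : (p (X (P.l m)) ∧ ¬ p (X (P.r m))) ∧ q (Y (P.b m)) ∧ ¬ q (Y (P.t m))) : k = m := by
  classical
  have harea := P.area (fun w => if p (X w) then 1 else 0) (fun w => if q (Y w) then 1 else 0)
  have hterm : ∀ {x x' y y' : ℝ}, x < x' → y < y' →
      ((if p x then (1 : ℤ) else 0) - if p x' then 1 else 0) *
      ((if q y then (1 : ℤ) else 0) - if q y' then 1 else 0) =
      if (p x ∧ ¬ p x') ∧ q y ∧ ¬ q y' then 1 else 0 := by
    intro x x' y y' hx hy
    have h1 := hp _ _ hx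
    have h2 := hq _ _ hy
    by_cases a1 : p x <;> by_cases a2 : p x' <;> by_cases a3 : q y <;>
      by_cases a4 : q y' <;> simp_all
  rw [hterm h.outer_X h.outer_Y, Finset.sum_congr rfl fun k _ => hterm (h.tile_X k) (h.tile_Y k),
    Finset.sum_boole, if_pos ((h.exists_tile_iff hp hq).2 ⟨k, hk⟩)] at harea
  exact Finset.card_le_one.1 (Nat.cast_le_one (α := ℤ).1 harea.le)
    _ (Finset.mem_filter.2 ⟨Finset.mem_univ _, hk⟩) _ (Finset.mem_filter.2 ⟨Finset.mem_univ _, hm⟩)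

/-- A lower set of coordinates that cuts the interval `[a, c]` at the point `u`. -/
theorem exists_cut {a c u : ℝ} (hac : a < c) (h1 : a ≤ u) (h2 : u ≤ c) :
    ∃ p : ℝ → Prop, (∀ x y, x < y → p y → p x) ∧ p a ∧ ¬ p c ∧
      (∀ x, p x → x ≤ u) ∧ ∀ x, ¬ p x → u ≤ x := by
  -- At the right end of the interval the cut has to be made just before the point; elsewhere it is
  -- made just after it.
  rcases h2.eq_or_lt with rfl | h2
  · exact ⟨fun x => x < u, fun _ _ h h' => h.trans h', hac, lt_irrefl _, fun _ h => le_of_lt h,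
      fun _ h => not_lt.1 h⟩
  · exact ⟨fun x => x ≤ u, fun x y h h' => h.le.trans h', h1, not_le.2 h2, fun x h => h,
      fun x h => (not_le.1 h).le⟩

/-- The cuts just after the lower left corner and just before the upper right corner belong to the
tile, hence to the outer rectangle. -/
theorem Fits.tile_subset (h : P.Fits X Y) (k : Fin n) : X P.L ≤ X (P.l k) ∧
    X (P.r k) ≤ X P.R ∧ Y P.B ≤ Y (P.b k) ∧ Y (P.t k) ≤ Y P.T := by
  have h1 := (h.exists_tile_iff (p := (· ≤ X (P.l k))) (q := (· ≤ Y (P.b k)))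
    (fun x y h h' => h.le.trans h') (fun x y h h' => h.le.trans h')).2
    ⟨k, ⟨le_rfl, not_le.2 (h.tile_X k)⟩, le_rfl, not_le.2 (h.tile_Y k)⟩
  have h2 := (h.exists_tile_iff (p := (· < X (P.r k))) (q := (· < Y (P.t k)))
    (fun x y h h' => h.trans h') (fun x y h h' => h.trans h')).2
    ⟨k, ⟨h.tile_X k, lt_irrefl _⟩, h.tile_Y k, lt_irrefl _⟩
  exact ⟨h1.1.1, not_lt.1 h2.1.2, h1.2.1, not_lt.1 h2.2.2⟩

theorem Fits.tile_eq (h : P.Fits X Y) {u v : ℝ} {k m : Fin n}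
    (k1 : X (P.l k) ≤ u) (k2 : u < X (P.r k)) (k3 : Y (P.b k) ≤ v) (k4 : v < Y (P.t k))
    (m1 : X (P.l m) ≤ u) (m2 : u < X (P.r m)) (m3 : Y (P.b m) ≤ v) (m4 : v < Y (P.t m)) : k = m :=
  h.tile_unique (p := (· ≤ u)) (q := (· ≤ v)) (fun _ _ h h' => h.le.trans h')
    (fun _ _ h h' => h.le.trans h') ⟨⟨k1, not_le.2 k2⟩, k3, not_le.2 k4⟩
    ⟨⟨m1, not_le.2 m2⟩, m3, not_le.2 m4⟩

/-- A cut at a corner of a tile. -/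
theorem exists_cut_of_corner (c : Bool) (u : ℝ) : ∃ p : ℝ → Prop, (∀ x y, x < y → p y → p x) ∧
    ∀ x y, x < y → u = (if c then x else y) → p x ∧ ¬ p y := by
  cases c
  · exact ⟨fun x => x < u, fun _ _ h h' => h.trans h', fun _ _ hxy h => by simp_all⟩
  · exact ⟨fun x => x ≤ u, fun _ _ h h' => h.le.trans h', fun _ _ hxy h => by simp_all⟩

theorem Fits.isGenericTiling (h : P.Fits X Y) : (P.draw X Y).IsGenericTiling where
  outer_proper := ⟨h.outer_X, h.outer_Y⟩
  tile_proper k := ⟨h.tile_X k, h.tile_Y k⟩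
  cover := by
    ext ⟨u, v⟩
    rw [Set.mem_iUnion]
    constructor
    · rintro ⟨k, h1, h2, h3, h4⟩
      obtain ⟨s1, s2, s3, s4⟩ := h.tile_subset k
      exact ⟨s1.trans h1, h2.trans s2, s3.trans h3, h4.trans s4⟩
    · rintro ⟨h1, h2, h3, h4⟩
      obtain ⟨p, hp, pL, pR, p1, p2⟩ := exists_cut h.outer_X h1 h2
      obtain ⟨q, hq, qB, qT, q1, q2⟩ := exists_cut h.outer_Y h3 h4
      obtain ⟨k, hk⟩ := (h.exists_tile_iff hp hq).1 ⟨⟨pL, pR⟩, qB, qT⟩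
      exact ⟨k, p1 _ hk.1.1, p2 _ hk.1.2, q1 _ hk.2.1, q2 _ hk.2.2⟩
  disjoint i j hij := by
    rw [Set.disjoint_left]
    rintro ⟨u, v⟩ ⟨h1, h2, h3, h4⟩ ⟨h1', h2', h3', h4'⟩
    exact hij (h.tile_eq h1.le h2 h3.le h4 h1'.le h2' h3'.le h4')
  no_cross := by
    rintro ⟨⟨u, v⟩, f, hf, hc⟩
    have hc' : ∀ k, ∃ c : Bool × Bool,
        u = (if c.1 then X (P.l (f k)) else X (P.r (f k))) ∧
        v = (if c.2 then Y (P.b (f k)) else Y (P.t (f k))) := by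
      intro k
      obtain ⟨h1, h2⟩ := Rect.mem_corners.1 (hc k)
      rcases h1 with h1 | h1 <;> rcases h2 with h2 | h2
      · exact ⟨(true, true), h1, h2⟩
      · exact ⟨(true, false), h1, h2⟩
      · exact ⟨(false, true), h1, h2⟩
      · exact ⟨(false, false), h1, h2⟩
    choose c hc1 hc2 using hc'
    -- Two tiles with the same kind of corner at the point would overlap near it. So four tiles
    -- realize all four kinds, in particular a lower left and an upper right corner, which the plan
    -- excludes.
    have hinj : c.Injective := by
      intro k m hkm
      obtain ⟨p, hp, hp'⟩ := exists_cut_of_corner (c k).1 u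
      obtain ⟨q, hq, hq'⟩ := exists_cut_of_corner (c k).2 v
      exact hf (h.tile_unique hp hq
        ⟨hp' _ _ (h.tile_X _) (hc1 k), hq' _ _ (h.tile_Y _) (hc2 k)⟩
        ⟨hp' _ _ (h.tile_X _) (hkm ▸ hc1 m), hq' _ _ (h.tile_Y _) (hkm ▸ hc2 m)⟩)
    have hsurj : c.Surjective :=
      (hinj.bijective_of_nat_card_le (by simp)).surjective
    obtain ⟨k, hk⟩ := hsurj (true, true)
    obtain ⟨m, hm⟩ := hsurj (false, false)
    have k1 := hc1 k
    have k2 := hc2 k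
    have m1 := hc1 m
    have m2 := hc2 m
    rw [hk] at k1 k2
    rw [hm] at m1 m2
    exact P.no_cross (f k) (f m) (h.inj_X (k1.symm.trans m1)) (h.inj_Y (k2.symm.trans m2))

/-! ### The walls of a drawn plan -/

/-- The tiles on one side of a vertical wall fill the wall. -/
theorem Fits.exists_side_cut_iff (h : P.Fits X Y) {lr : Fin n → ℕ} {w : ℕ}
    (hsum : ∀ g : ℕ → ℤ, ∑ k with lr k = w, (g (P.b k) - g (P.t k)) = g (P.lo w) - g (P.hi w))
    {q : ℝ → Prop} (hq : ∀ a b, a < b → q b → q a) :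
    (∃ k, lr k = w ∧ q (Y (P.b k)) ∧ ¬ q (Y (P.t k))) ↔ q (Y (P.lo w)) ∧ ¬ q (Y (P.hi w)) := by
  classical
  -- All summands are nonnegative, and their sum tells whether the wall itself crosses the cut.
  have hs := hsum fun m => if q (Y m) then 1 else 0
  have hnn : ∀ k, 0 ≤ (if q (Y (P.b k)) then (1 : ℤ) else 0) - (if q (Y (P.t k)) then 1 else 0) := by
    intro k
    have := hq _ _ (h.tile_Y k)
    by_cases h1 : q (Y (P.b k)) <;> by_cases h2 : q (Y (P.t k)) <;> simp_all
  constructor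
  · rintro ⟨k, hk, h1, h2⟩
    have := Finset.single_le_sum (f := fun k => (if q (Y (P.b k)) then (1 : ℤ) else 0) -
      (if q (Y (P.t k)) then 1 else 0)) (fun k _ => hnn k)
      (Finset.mem_filter (p := fun k => lr k = w).2 ⟨Finset.mem_univ k, hk⟩)
    rw [hs] at this
    simp only [if_pos h1, if_neg h2] at this
    split_ifs at this with a1 a2 <;> first | exact ⟨a1, ‹_›⟩ | omega
  · rintro ⟨h1, h2⟩
    rw [if_pos h1, if_neg h2] at hs
    obtain ⟨k, hk, hk'⟩ := Finset.exists_ne_zero_of_sum_ne_zero (hs.trans_ne (by norm_num))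
    have := hnn k
    refine ⟨k, (Finset.mem_filter.1 hk).2, ?_⟩
    split_ifs at hk' this with a1 a2
    · exact absurd rfl hk'
    · exact ⟨a1, a2⟩
    · omega
    · exact absurd rfl hk'

theorem Fits.exists_side_iff (h : P.Fits X Y) {lr : Fin n → ℕ} {w : ℕ}
    (hsum : ∀ g : ℕ → ℤ, ∑ k with lr k = w, (g (P.b k) - g (P.t k)) = g (P.lo w) - g (P.hi w))
    (y : ℝ) : (∃ k, lr k = w ∧ Y (P.b k) ≤ y ∧ y < Y (P.t k)) ↔
      Y (P.lo w) ≤ y ∧ y < Y (P.hi w) := by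
  simpa only [not_le] using h.exists_side_cut_iff hsum (q := (· ≤ y)) fun _ _ h h' => h.le.trans h'

theorem Fits.side_bounds (h : P.Fits X Y) {lr : Fin n → ℕ} {w : ℕ}
    (hsum : ∀ g : ℕ → ℤ, ∑ k with lr k = w, (g (P.b k) - g (P.t k)) = g (P.lo w) - g (P.hi w))
    {k : Fin n} (hk : lr k = w) : Y (P.lo w) ≤ Y (P.b k) ∧ Y (P.t k) ≤ Y (P.hi w) := by
  have h1 := h.tile_Y k
  have h2 := (h.exists_side_iff hsum _).1 ⟨k, hk, le_rfl, h1⟩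
  refine ⟨h2.1, ?_⟩
  by_contra! h3
  have h4 := (h.exists_side_iff hsum _).1 ⟨k, hk, le_max_left _ (Y (P.hi w)), max_lt h1 h3⟩
  exact absurd h4.2 (not_lt.2 (le_max_right _ _))

theorem Fits.lo_lt_hi (h : P.Fits X Y) {w : ℕ} (hw : w ∈ P.V) : Y (P.lo w) < Y (P.hi w) := by
  obtain ⟨k, hk⟩ := P.exists_l w hw
  have := h.side_bounds (P.sum_l w hw) hk
  linarith [h.tile_Y k]

theorem Fits.ne_outer (h : P.Fits X Y) {w : ℕ} (hw : w ∈ P.V) : X w ≠ X P.L ∧ X w ≠ X P.R :=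
  ⟨fun e => P.L_notMem (h.inj_X e ▸ hw), fun e => P.R_notMem (h.inj_X e ▸ hw)⟩

theorem Fits.avoidsTiles_wall (h : P.Fits X Y) {w : ℕ} (hw : w ∈ P.V) :
    (P.draw X Y).AvoidsTiles (.vert (X w) (Y (P.lo w)) (Y (P.hi w))) := by
  have hlt := h.lo_lt_hi hw
  rw [Drawing.avoidsTiles_vert h.isGenericTiling.tile_proper]
  obtain ⟨k, hk⟩ := P.exists_l w hw
  have hsub := h.tile_subset k
  have hb := h.side_bounds (P.sum_l w hw) hk
  have hX := h.tile_X k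
  rw [hk] at hX hsub
  refine ⟨hlt, ⟨hsub.1, hX.le.trans hsub.2.1, ?_, ?_⟩, ?_⟩
  · obtain ⟨m, hm, hm'⟩ := (h.exists_side_iff (P.sum_l w hw) (Y (P.lo w))).2 ⟨le_rfl, hlt⟩
    exact (h.tile_subset m).2.2.1.trans hm'.1
  · by_contra! hc
    obtain ⟨m, hm, hm'⟩ := (h.exists_side_iff (P.sum_l w hw)
      (max (Y (P.lo w)) (Y P.T))).2 ⟨le_max_left _ _, max_lt hlt hc⟩
    have := (h.tile_subset m).2.2.2
    exact absurd (hm'.2.trans_le this) (not_lt.2 (le_max_right _ _))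
  · intro m (hl : X (P.l m) < X w) (hr : X w < X (P.r m))
    change Y (P.t m) ≤ _ ∨ _ ≤ Y (P.b m)
    by_contra! hc
    -- At a height common to the wall and a straddling tile, some tile has its left edge on the
    -- wall; by uniqueness this would be the straddling tile.
    obtain ⟨k, hk, k1, k2⟩ := (h.exists_side_iff (P.sum_l w hw) (max (Y (P.lo w)) (Y (P.b m)))).2
      ⟨le_max_left _ _, max_lt hlt hc.2⟩
    have hkm : k = m := h.tile_eq (u := X w) (v := max (Y (P.lo w)) (Y (P.b m)))
      (by rw [hk]) (hk ▸ h.tile_X k) k1 k2 hl.le hr (le_max_right _ _)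
      (max_lt hc.1 (h.tile_Y m))
    rw [← hkm, hk] at hl
    exact lt_irrefl _ hl

/-- The tile found just to the right of a point of the segment cannot have that point in its
interior, so its left edge lies on the line. This puts almost every point of the segment on one
wall, and the segment cannot leave that wall. -/
theorem Fits.exists_wall_of_avoidsTiles (h : P.Fits X Y) {u a c : ℝ}
    (hA : (P.draw X Y).AvoidsTiles (.vert u a c)) (hL : u ≠ X P.L) (hR : u ≠ X P.R) :
    ∃ w ∈ P.V, u = X w ∧ Y (P.lo w) ≤ a ∧ c ≤ Y (P.hi w) := by
  rw [Drawing.avoidsTiles_vert h.isGenericTiling.tile_proper] at hA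
  obtain ⟨hac, ⟨o1, o2, o3, o4⟩, hav⟩ := hA
  have o1' : X P.L < u := lt_of_le_of_ne o1 hL.symm
  have o2' : u < X P.R := lt_of_le_of_ne o2 hR
  have o3' : Y P.B ≤ a := o3
  have o4' : c ≤ Y P.T := o4
  have key : ∀ a' c', a ≤ a' → c' ≤ c → a' < c' → ∃ y, a' < y ∧ y < c' ∧ ∃ w ∈ P.V, u = X w ∧
      Y (P.lo w) ≤ y ∧ y < Y (P.hi w) := by
    intro a' c' ha hc hac'
    -- Avoiding the finitely many heights of bottom edges puts `y` strictly inside the vertical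
    -- range of its tile.
    obtain ⟨y, ⟨hy1, hy2⟩, hy3⟩ := ((Set.Ioo_infinite hac').sdiff
      (Set.finite_range fun k => Y (P.b k))).nonempty
    refine ⟨y, hy1, hy2, ?_⟩
    obtain ⟨k, ⟨k1, k2⟩, k3, k4⟩ := (h.exists_tile_iff (p := (· ≤ u)) (q := (· ≤ y))
      (fun x y h h' => h.le.trans h') (fun x y h h' => h.le.trans h')).1
      ⟨⟨o1'.le, not_le.2 o2'⟩, by linarith, not_le.2 (by linarith)⟩
    have k3' : Y (P.b k) < y := lt_of_le_of_ne k3 fun e => hy3 ⟨k, e⟩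
    rw [not_le] at k2 k4
    have hu : X (P.l k) = u := by
      refine le_antisymm k1 (not_lt.1 fun hlt => ?_)
      rcases hav k hlt k2 with h' | h'
      · have : Y (P.t k) ≤ a := h'
        linarith
      · have : c ≤ Y (P.b k) := h'
        linarith
    rcases P.l_mem k with e | e
    · exact absurd (by rw [← hu, e]) hL
    · exact ⟨_, e, hu.symm, (h.exists_side_iff (P.sum_l _ e) y).1 ⟨k, rfl, k3, k4⟩⟩
  obtain ⟨-, -, -, w, hw, rfl, -⟩ := key a c le_rfl le_rfl hac
  refine ⟨w, hw, rfl, ?_, ?_⟩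
  · by_contra! hc
    obtain ⟨y, -, hy, w', -, e, hy', -⟩ := key a (min c (Y (P.lo w))) le_rfl (min_le_left _ _)
      (lt_min hac hc)
    rw [← h.inj_X e] at hy'
    exact absurd (hy'.trans_lt hy) (not_lt.2 (min_le_right _ _))
  · by_contra! hc
    obtain ⟨y, hy, -, w', -, e, -, hy'⟩ := key (max a (Y (P.hi w))) c (le_max_left _ _) le_rfl
      (max_lt hac hc)
    rw [← h.inj_X e] at hy'
    exact absurd (hy.trans hy') (not_lt.2 (le_max_right _ _))

theorem Fits.isWall_vert_iff (h : P.Fits X Y) {u a c : ℝ} :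
    (P.draw X Y).IsWall (.vert u a c) ↔
      ∃ w ∈ P.V, Seg.vert u a c = .vert (X w) (Y (P.lo w)) (Y (P.hi w)) := by
  rw [Drawing.isWall_vert]
  constructor
  · rintro ⟨hA, h1, h2, h3⟩
    obtain ⟨w, hw, rfl, h4, h5⟩ := h.exists_wall_of_avoidsTiles hA h1 h2
    obtain ⟨rfl, rfl⟩ := h3 _ _ (h.avoidsTiles_wall hw) h4 h5
    exact ⟨w, hw, rfl⟩
  · rintro ⟨w, hw, e⟩
    obtain ⟨rfl, rfl, rfl⟩ := Seg.vert.inj e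
    refine ⟨h.avoidsTiles_wall hw, (h.ne_outer hw).1, (h.ne_outer hw).2, fun a' c' h' ha hc => ?_⟩
    obtain ⟨w', -, e, h4, h5⟩ := h.exists_wall_of_avoidsTiles h' (h.ne_outer hw).1
      (h.ne_outer hw).2
    rw [← h.inj_X e] at h4 h5
    exact ⟨le_antisymm ha h4, le_antisymm h5 hc⟩

variable (P X Y) in
/-- The segment of the interior vertical wall `w`. -/
def vertSeg (w : ℕ) : Seg := .vert (X w) (Y (P.lo w)) (Y (P.hi w))

variable (P X Y) in
/-- The segment of the interior horizontal wall `w`. -/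
def horizSeg (w : ℕ) : Seg := .horiz (Y w) (X (P.lf w)) (X (P.rt w))

theorem Fits.isWall_iff (h : P.Fits X Y) {s : Seg} : (P.draw X Y).IsWall s ↔
    (∃ w ∈ P.V, s = P.vertSeg X Y w) ∨ ∃ w ∈ P.H, s = P.horizSeg X Y w := by
  obtain ⟨u, a, c⟩ | ⟨u, a, c⟩ := s
  · rw [h.isWall_vert_iff]
    simp [vertSeg, horizSeg]
  · rw [← Drawing.isWall_transpose, ← draw_transpose]
    change (P.transpose.draw Y X).IsWall (.vert u a c) ↔ _
    rw [h.transpose.isWall_vert_iff]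
    simp only [vertSeg, horizSeg, reduceCtorEq, and_false, exists_false, false_or,
      Seg.vert.injEq, Seg.horiz.injEq]
    rfl

theorem Fits.onFirstSide_vertSeg (h : P.Fits X Y) {w : ℕ} (hw : w ∈ P.V) {k : Fin n} :
    (P.draw X Y).OnFirstSide (P.vertSeg X Y w) k ↔ P.r k = w := by
  rw [vertSeg, Drawing.onFirstSide_vert (h.isGenericTiling.tile_proper k)]
  exact ⟨fun h' => h.inj_X h'.1, fun e => ⟨congrArg X e, h.side_bounds (P.sum_r w hw) e⟩⟩

theorem Fits.onSecondSide_vertSeg (h : P.Fits X Y) {w : ℕ} (hw : w ∈ P.V) {k : Fin n} :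
    (P.draw X Y).OnSecondSide (P.vertSeg X Y w) k ↔ P.l k = w := by
  rw [vertSeg, Drawing.onSecondSide_vert (h.isGenericTiling.tile_proper k)]
  exact ⟨fun h' => h.inj_X h'.1, fun e => ⟨congrArg X e, h.side_bounds (P.sum_l w hw) e⟩⟩

theorem Fits.onFirstSide_horizSeg (h : P.Fits X Y) {w : ℕ} (hw : w ∈ P.H) {k : Fin n} :
    (P.draw X Y).OnFirstSide (P.horizSeg X Y w) k ↔ P.b k = w := by
  rw [← Drawing.onSecondSide_transpose]
  exact h.transpose.onSecondSide_vertSeg hw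

theorem Fits.onSecondSide_horizSeg (h : P.Fits X Y) {w : ℕ} (hw : w ∈ P.H) {k : Fin n} :
    (P.draw X Y).OnSecondSide (P.horizSeg X Y w) k ↔ P.t k = w := by
  rw [← Drawing.onFirstSide_transpose]
  exact h.transpose.onFirstSide_vertSeg hw

theorem Fits.records_vertSeg (h : P.Fits X Y) {w : ℕ} (hw : w ∈ P.V) {k : Fin n} {y : ℝ} :
    (P.draw X Y).Records (P.vertSeg X Y w) k y ↔
      (P.r k = w ∧ P.b k ≠ P.lo w ∧ y = Y (P.b k)) ∨
      (P.l k = w ∧ P.t k ≠ P.hi w ∧ y = Y (P.t k)) := by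
  have h1 := h.onFirstSide_vertSeg hw (k := k)
  have h2 := h.onSecondSide_vertSeg hw (k := k)
  rw [vertSeg] at h1 h2
  simp only [vertSeg, Drawing.Records, h1, h2]
  refine or_congr (and_congr_right fun e => and_congr_left' ?_)
    (and_congr_right fun e => and_congr_left' ?_)
  · have := (h.side_bounds (P.sum_r w hw) e).1
    exact ⟨fun hlt e => hlt.ne (congrArg Y e.symm), fun hne => lt_of_le_of_ne this
      fun e => hne (h.inj_Y e.symm)⟩
  · have := (h.side_bounds (P.sum_l w hw) e).2
    exact ⟨fun hlt e => hlt.ne (congrArg Y e), fun hne => lt_of_le_of_ne this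
      fun e => hne (h.inj_Y e)⟩

theorem Fits.records_horizSeg (h : P.Fits X Y) {w : ℕ} (hw : w ∈ P.H) {k : Fin n} {y : ℝ} :
    (P.draw X Y).Records (P.horizSeg X Y w) k y ↔
      (P.b k = w ∧ P.r k ≠ P.rt w ∧ y = X (P.r k)) ∨
      (P.t k = w ∧ P.l k ≠ P.lf w ∧ y = X (P.l k)) := by
  rw [← Drawing.records_transpose, or_comm]
  exact h.transpose.records_vertSeg hw

theorem Fits.isLeftOf_iff (h : P.Fits X Y) {i j : Fin n} :
    ((P.draw X Y).tile i).IsLeftOf ((P.draw X Y).tile j) ↔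
      P.r i = P.l j ∧ Y (P.b i) ≤ Y (P.t j) ∧ Y (P.b j) ≤ Y (P.t i) := by
  rw [Rect.isLeftOf_iff (h.isGenericTiling.tile_proper i) (h.isGenericTiling.tile_proper j)]
  exact and_congr_left' h.inj_X.eq_iff

theorem Fits.isBelow_iff (h : P.Fits X Y) {i j : Fin n} :
    ((P.draw X Y).tile i).IsBelow ((P.draw X Y).tile j) ↔
      P.t i = P.b j ∧ X (P.l i) ≤ X (P.r j) ∧ X (P.l j) ≤ X (P.r i) := by
  rw [Rect.isBelow_iff (h.isGenericTiling.tile_proper i) (h.isGenericTiling.tile_proper j)]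
  exact and_congr_left' h.inj_Y.eq_iff

/-! ### Zigzags along a wall -/

end Plan

/-- `j` can be reached from `i` by alternately following a relation forwards and backwards. -/
inductive ZigZag {α : Type*} (r : α → α → Prop) : α → α → Prop
  | base {i j : α} : r i j → ZigZag r i j
  | step {i j k m : α} : ZigZag r i j → r k j → r k m → ZigZag r i m

theorem ZigZag.map {α β : Type*} {r : α → α → Prop} {s : β → β → Prop} {f : α → β}
    (hf : ∀ i j, r i j → s (f i) (f j)) {i j : α} (h : ZigZag r i j) : ZigZag s (f i) (f j) := by
  induction h with
  | base h => exact .base (hf _ _ h)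
  | step _ h1 h2 ih => exact .step ih (hf _ _ h1) (hf _ _ h2)

def Drawing.LeftOf {n : ℕ} (R : Drawing n) (i j : Fin n) : Prop := (R.tile i).IsLeftOf (R.tile j)

def Drawing.Below {n : ℕ} (R : Drawing n) (i j : Fin n) : Prop := (R.tile i).IsBelow (R.tile j)

namespace Plan

variable {n : ℕ} {P : Plan n} {X Y : ℕ → ℝ}

/-- Along a vertical wall, every tile on the right is connected with the bottommost tile on the
left. -/
theorem Fits.zigzag_left (h : P.Fits X Y) {w : ℕ} (hw : w ∈ P.V) {i j : Fin n} (hi : P.r i = w)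
    (hib : P.b i = P.lo w) (hj : P.l j = w) : ZigZag (P.draw X Y).LeftOf i j := by
  have : IsTrans (Fin n) fun i j => Y (P.b i) < Y (P.b j) := ⟨fun _ _ _ h h' => h.trans h'⟩
  have : Std.Irrefl fun i j : Fin n => Y (P.b i) < Y (P.b j) := ⟨fun _ => lt_irrefl _⟩
  induction j using (Finite.wellFounded_of_trans_of_irrefl
    fun i j : Fin n => Y (P.b i) < Y (P.b j)).induction with
  | _ j ih =>
    obtain ⟨b1, b2⟩ := h.side_bounds (P.sum_l w hw) hj
    have hjt := h.tile_Y j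
    rcases b1.eq_or_lt with e | e
    · refine .base (h.isLeftOf_iff.2 ⟨hi.trans hj.symm, ?_, ?_⟩)
      · rw [hib]; linarith
      · rw [← e, ← hib]; exact (h.tile_Y i).le
    · have hq : ∀ a b : ℝ, a < b → b < Y (P.b j) → a < Y (P.b j) := fun _ _ h h' => h.trans h'
      have hc : Y (P.lo w) < Y (P.b j) ∧ ¬ Y (P.hi w) < Y (P.b j) := ⟨e, not_lt.2 (by linarith)⟩
      obtain ⟨k, hk, k1, k2⟩ := (h.exists_side_cut_iff (P.sum_r w hw) hq).2 hc
      obtain ⟨m, hm, m1, m2⟩ := (h.exists_side_cut_iff (P.sum_l w hw) hq).2 hc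
      rw [not_lt] at k2 m2
      exact .step (ih m m1 hm) (h.isLeftOf_iff.2 ⟨hk.trans hm.symm, by linarith, by linarith⟩)
        (h.isLeftOf_iff.2 ⟨hk.trans hj.symm, by linarith, by linarith⟩)

theorem Fits.zigzag_below (h : P.Fits X Y) {w : ℕ} (hw : w ∈ P.H) {i j : Fin n} (hi : P.t i = w)
    (hil : P.l i = P.lf w) (hj : P.b j = w) : ZigZag (P.draw X Y).Below i j := by
  refine (h.transpose.zigzag_left hw (i := i) (j := j) hi hil hj).map (f := id) fun i j h' => ?_
  exact (Rect.isLeftOf_transpose _ _).1 h'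

theorem Fits.eq_of_zigzag_left (h : P.Fits X Y) {i j : Fin n}
    (hz : ZigZag (P.draw X Y).LeftOf i j) : P.r i = P.l j := by
  induction hz with
  | base h' => exact (h.isLeftOf_iff.1 h').1
  | step _ h1 h2 ih =>
    exact ih.trans ((h.isLeftOf_iff.1 h1).1.symm.trans (h.isLeftOf_iff.1 h2).1)

theorem Fits.eq_of_zigzag_below (h : P.Fits X Y) {i j : Fin n}
    (hz : ZigZag (P.draw X Y).Below i j) : P.t i = P.b j := by
  induction hz with
  | base h' => exact (h.isBelow_iff.1 h').1
  | step _ h1 h2 ih =>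
    exact ih.trans ((h.isBelow_iff.1 h1).1.symm.trans (h.isBelow_iff.1 h2).1)

/-! ### Drawings with the same combinatorial data -/

theorem Fits.wall_vert (h : P.Fits X Y) {w : ℕ} (hw : w ∈ P.V) :
    (P.draw X Y).IsWall (P.vertSeg X Y w) := h.isWall_iff.2 (Or.inl ⟨w, hw, rfl⟩)

theorem Fits.wall_horiz (h : P.Fits X Y) {w : ℕ} (hw : w ∈ P.H) :
    (P.draw X Y).IsWall (P.horizSeg X Y w) := h.isWall_iff.2 (Or.inr ⟨w, hw, rfl⟩)

noncomputable def Fits.wallEquiv (h : P.Fits X Y) : P.V ⊕ P.H ≃ (P.draw X Y).Wall :=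
  Equiv.ofBijective
    (Sum.elim (fun w => ⟨P.vertSeg X Y w, h.wall_vert w.2⟩)
      (fun w => ⟨P.horizSeg X Y w, h.wall_horiz w.2⟩)) <| by
    constructor
    · rintro (v | v) (w | w) e
      · exact congrArg Sum.inl (Subtype.ext (h.inj_X (Seg.vert.inj (congrArg Subtype.val e)).1))
      · exact absurd (congrArg Subtype.val e) Seg.noConfusion
      · exact absurd (congrArg Subtype.val e) Seg.noConfusion
      · exact congrArg Sum.inr (Subtype.ext (h.inj_Y (Seg.horiz.inj (congrArg Subtype.val e)).1))
    · rintro ⟨s, hs⟩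
      rcases h.isWall_iff.1 hs with ⟨w, hw, rfl⟩ | ⟨w, hw, rfl⟩
      · exact ⟨Sum.inl ⟨w, hw⟩, rfl⟩
      · exact ⟨Sum.inr ⟨w, hw⟩, rfl⟩

/-- The tiles on each side of a wall are read off the plan and do not depend on the coordinates. -/
theorem Fits.isMosaicEquiv (h : P.Fits X Y) {X' Y' : ℕ → ℝ} (h' : P.Fits X' Y') :
    (P.draw X Y).IsMosaicEquiv (P.draw X' Y') (h.wallEquiv.symm.trans h'.wallEquiv) := by
  intro W
  obtain ⟨z, rfl⟩ := h.wallEquiv.surjective W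
  rw [Equiv.trans_apply, Equiv.symm_apply_apply]
  rcases z with ⟨w, hw⟩ | ⟨w, hw⟩
  · exact ⟨Iff.rfl, fun i => (h'.onFirstSide_vertSeg hw).trans (h.onFirstSide_vertSeg hw).symm,
      fun i => (h'.onSecondSide_vertSeg hw).trans (h.onSecondSide_vertSeg hw).symm⟩
  · exact ⟨Iff.rfl, fun i => (h'.onFirstSide_horizSeg hw).trans (h.onFirstSide_horizSeg hw).symm,
      fun i => (h'.onSecondSide_horizSeg hw).trans (h.onSecondSide_horizSeg hw).symm⟩

end Plan
end Rectangulation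

namespace Rectangulation

/-! ### The union of the tiles of earlier labels. -/

section Staircase

variable {n : ℕ} {τ : ℕ → ℤ} (hτ : DistinctBelow n τ) {j k : ℕ} (hj : j < n) (hk : k < n)
include hτ hj hk

/-- If `j + 1 < k`, the label `j + 1` would come both before and after `j`; if `k < j`, the top wall
of `j` would put `k` before `j`. Hence only the tile `k - 1` can bring the diagonal point `k` into
the staircase. -/
theorem succ_eq_of_topLeft (h : τ j < τ k) (hr : k ≤ rightWall n τ j) (ht : topWall τ j ≤ k)
    (hb : k ≤ bottomWall n τ j) : j + 1 = k := by
  obtain ⟨r1, r2, r3, r4⟩ := rightWall_spec hτ hj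
  obtain ⟨b1, b2, b3, b4⟩ := bottomWall_spec hτ hj
  obtain ⟨t1, t2, t3⟩ := topWall_spec hτ hj
  have := r4 (j + 1)
  have := b4 (j + 1)
  have := t3 k ht
  rcases lt_trichotomy j k with h' | rfl | h' <;> omega

/-- This bounds the supremum in the case of `newTopLeft` in which the diagonal point is covered;
`rightWall_le_leftWall`, `rightWall_le_rightWall` and `bottomWall_le_topWall` play this role in the
other three cases. -/
theorem topWall_le_topWall (h : τ j < τ k) (hr : k ≤ rightWall n τ j) :
    topWall τ k ≤ topWall τ j := by
  obtain ⟨r1, r2, r3, r4⟩ := rightWall_spec hτ hj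
  obtain ⟨s1, s2, s3⟩ := topWall_spec hτ hj
  obtain ⟨t1, t2, t3⟩ := topWall_spec hτ hk
  by_contra! hlt
  have := s3 (topWall τ k - 1) (by omega)
  have := s3 k
  have := r4 (topWall τ k - 1)
  have h0 : topWall τ k - 1 ≠ j := by intro e; rw [e] at t2; omega
  rcases lt_trichotomy j k with h' | rfl | h' <;> omega

theorem rightWall_le_leftWall (h : τ j < τ k) (ht : topWall τ j ≤ k) :
    rightWall n τ j ≤ leftWall τ k := by
  obtain ⟨r1, r2, r3, r4⟩ := rightWall_spec hτ hj
  obtain ⟨s1, s2, s3⟩ := topWall_spec hτ hj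
  obtain ⟨l1, l2, l3⟩ := leftWall_spec hτ hk
  by_contra! hlt
  have := s3 k ht
  have := l3 j
  have := r4 (leftWall τ k)
  have := l3 (leftWall τ k)
  rcases l1.eq_or_lt with e | e
  · rw [e] at this
    rw [e] at hlt
    have := r4 k
    rcases lt_trichotomy j k with h' | rfl | h' <;> omega
  · rcases lt_trichotomy j k with h' | rfl | h' <;> omega

theorem eq_succ_of_bottomRight (h : τ j < τ k) (hl : leftWall τ j ≤ k + 1)
    (hr : k + 1 ≤ rightWall n τ j) (ht : topWall τ j ≤ k + 1) : j = k + 1 := by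
  obtain ⟨r1, r2, r3, r4⟩ := rightWall_spec hτ hj
  obtain ⟨l1, l2, l3⟩ := leftWall_spec hτ hj
  obtain ⟨t1, t2, t3⟩ := topWall_spec hτ hj
  have := r4 k
  have := l3 (j - 1)
  have := t3 (j - 1)
  rcases lt_trichotomy j k with h' | rfl | h' <;> omega

theorem rightWall_le_rightWall (h : τ j < τ k) (ht : topWall τ j ≤ k + 1) :
    rightWall n τ j ≤ rightWall n τ k := by
  obtain ⟨r1, r2, r3, r4⟩ := rightWall_spec hτ hj
  obtain ⟨s1, s2, s3, s4⟩ := rightWall_spec hτ hk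
  obtain ⟨t1, t2, t3⟩ := topWall_spec hτ hj
  by_contra! hlt
  have := r4 k
  have := r4 (rightWall n τ k)
  have := t3 (rightWall n τ k)
  have h0 : rightWall n τ k ≠ j := by intro e; rw [e] at s3; omega
  rcases lt_trichotomy j k with h' | rfl | h' <;> omega

theorem bottomWall_le_topWall (h : τ j < τ k) (hl : leftWall τ j ≤ k + 1)
    (hr : k + 1 ≤ rightWall n τ j) (hk' : k + 1 < n → τ k < τ (k + 1)) :
    bottomWall n τ k ≤ topWall τ j := by
  obtain ⟨r1, r2, r3, r4⟩ := rightWall_spec hτ hj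
  obtain ⟨b1, b2, b3, b4⟩ := bottomWall_spec hτ hk
  obtain ⟨l1, l2, l3⟩ := leftWall_spec hτ hj
  obtain ⟨t1, t2, t3⟩ := topWall_spec hτ hj
  by_contra! hlt
  have := r4 k
  have := l3 (bottomWall n τ k)
  have := t3 (bottomWall n τ k)
  have := l3 (j - 1)
  have := t3 (j - 1)
  have := b4 j
  have h0 : j ≠ k + 1 := by rintro rfl; omega
  rcases lt_trichotomy j k with h' | rfl | h' <;> omega

omit hj in
-- The witness is the latest label from the top wall of `k` up to `k - 1`: since it is the latest,
-- no label in this range cuts its tile off on the right or above.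
theorem exists_tile_topLeft (h0 : 0 < k) (h : τ (k - 1) < τ k) : ∃ j < n, τ j < τ k ∧
    leftWall τ j ≤ k ∧ k ≤ rightWall n τ j ∧ topWall τ j ≤ topWall τ k ∧
    topWall τ k ≤ bottomWall n τ j := by
  obtain ⟨t1, t2, t3⟩ := topWall_spec hτ hk
  have htk : topWall τ k < k := by
    refine lt_of_le_of_ne t1 fun e => ?_
    rw [e] at t2; omega
  obtain ⟨j, hj, hmax⟩ := Finset.exists_max_image (Finset.Ico (topWall τ k) k) τ
    ⟨_, Finset.mem_Ico.2 ⟨le_rfl, htk⟩⟩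
  rw [Finset.mem_Ico] at hj
  have hjk := t3 j hj.1 hj.2
  have hjn : j < n := by omega
  obtain ⟨r1, r2, r3, r4⟩ := rightWall_spec hτ hjn
  obtain ⟨l1, l2, l3⟩ := leftWall_spec hτ hjn
  obtain ⟨s1, s2, s3⟩ := topWall_spec hτ hjn
  obtain ⟨b1, b2, b3, b4⟩ := bottomWall_spec hτ hjn
  refine ⟨j, hjn, hjk, by omega, ?_, ?_, by omega⟩
  · by_contra! hc
    have := hmax (rightWall n τ j) (Finset.mem_Ico.2 (by omega))
    omega
  · by_contra! hc
    have := hmax (topWall τ j - 1) (Finset.mem_Ico.2 (by omega))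
    omega

omit hj in
-- The witness is the nearest smaller label that precedes `k`.
theorem exists_tile_left (h0 : leftWall τ k ≠ 0) : ∃ j < n, τ j < τ k ∧
    leftWall τ j ≤ leftWall τ k ∧ leftWall τ k ≤ rightWall n τ j ∧ topWall τ j ≤ k ∧
    k ≤ bottomWall n τ j := by
  obtain ⟨l1, l2, l3⟩ := leftWall_spec hτ hk
  have hjn : leftWall τ k - 1 < n := by omega
  obtain ⟨r1, r2, r3, r4⟩ := rightWall_spec hτ hjn
  obtain ⟨m1, m2, m3⟩ := leftWall_spec hτ hjn
  obtain ⟨s1, s2, s3⟩ := topWall_spec hτ hjn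
  obtain ⟨b1, b2, b3, b4⟩ := bottomWall_spec hτ hjn
  refine ⟨leftWall τ k - 1, hjn, by omega, by omega, by omega, by omega, ?_⟩
  by_contra! hc
  have := l3 (bottomWall n τ (leftWall τ k - 1)) (by omega) hc
  omega

omit hj in
-- The witness is the latest label from `k + 1` up to the right wall of `k`, that wall excluded.
theorem exists_tile_bottomRight (h0 : k + 1 < n) (h : τ (k + 1) < τ k) : ∃ j < n, τ j < τ k ∧
    leftWall τ j ≤ rightWall n τ k ∧ rightWall n τ k ≤ rightWall n τ j ∧
    topWall τ j ≤ k + 1 ∧ k + 1 ≤ bottomWall n τ j := by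
  obtain ⟨t0, t1, t2, t3⟩ := rightWall_spec hτ hk
  have htk : k + 1 < rightWall n τ k := by
    refine lt_of_le_of_ne t0 fun e => ?_
    rw [← e] at t2; omega
  obtain ⟨j, hj, hmax⟩ := Finset.exists_max_image (Finset.Ico (k + 1) (rightWall n τ k)) τ
    ⟨_, Finset.mem_Ico.2 ⟨le_rfl, htk⟩⟩
  rw [Finset.mem_Ico] at hj
  have hjk := t3 j hj.1 hj.2
  have hjn : j < n := by omega
  obtain ⟨r1, r2, r3, r4⟩ := rightWall_spec hτ hjn
  obtain ⟨l1, l2, l3⟩ := leftWall_spec hτ hjn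
  obtain ⟨s1, s2, s3⟩ := topWall_spec hτ hjn
  obtain ⟨b1, b2, b3, b4⟩ := bottomWall_spec hτ hjn
  refine ⟨j, hjn, hjk, by omega, ?_, ?_, by omega⟩
  · by_contra! hc
    have := hmax (rightWall n τ j) (Finset.mem_Ico.2 (by omega))
    omega
  · by_contra! hc
    have := hmax (topWall τ j - 1) (Finset.mem_Ico.2 (by omega))
    omega

omit hj in
-- The witness is the nearest larger label that precedes `k`.
theorem exists_tile_bottom (h0 : bottomWall n τ k ≠ n) : ∃ j < n, τ j < τ k ∧
    leftWall τ j ≤ k + 1 ∧ k + 1 ≤ rightWall n τ j ∧ topWall τ j ≤ bottomWall n τ k ∧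
    bottomWall n τ k ≤ bottomWall n τ j := by
  obtain ⟨l0, l1, l2, l3⟩ := bottomWall_spec hτ hk
  have hjn : bottomWall n τ k < n := by omega
  obtain ⟨r1, r2, r3, r4⟩ := rightWall_spec hτ hjn
  obtain ⟨m1, m2, m3⟩ := leftWall_spec hτ hjn
  obtain ⟨s1, s2, s3⟩ := topWall_spec hτ hjn
  obtain ⟨b1, b2, b3, b4⟩ := bottomWall_spec hτ hjn
  refine ⟨bottomWall n τ k, hjn, by omega, ?_, by omega, by omega, by omega⟩
  by_contra! hc
  have := l3 (leftWall τ (bottomWall n τ k) - 1) (by omega) (by omega)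
  omega

end Staircase

/-! ### The combinatorial data of the diagonal rectangulation -/

theorem sum_fin_filter {n : ℕ} (p : ℕ → ℕ) (w : ℕ) (F : ℕ → ℤ) :
    ∑ k ∈ Finset.univ.filter (fun k : Fin n => p k = w), F k = ∑ k ∈ Finset.range n with p k = w, F k := by
  rw [Finset.sum_filter, Finset.sum_filter, ← Fin.sum_univ_eq_sum_range]

/-- On a vertical wall `w`, the tile `w - 1` is the bottommost on the left and the tile `w` the
topmost on the right, which gives the ends of the wall. On a horizontal wall they are the rightmost
tile above and the leftmost tile below. -/
noncomputable def diagonalPlan {n : ℕ} {τ : ℕ → ℤ} (hτ : DistinctBelow n τ) (hn : 0 < n) :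
    Plan n where
  l k := leftWall τ k
  r k := rightWall n τ k
  b k := bottomWall n τ k
  t k := topWall τ k
  L := 0
  R := n
  B := n
  T := 0
  V := {w | (0 < w ∧ w < n) ∧ τ (w - 1) < τ w}
  H := {w | (0 < w ∧ w < n) ∧ τ w < τ (w - 1)}
  lo w := bottomWall n τ (w - 1)
  hi w := topWall τ w
  lf w := leftWall τ w
  rt w := rightWall n τ (w - 1)
  l_mem k := by
    obtain ⟨h1, h2, h3⟩ := leftWall_spec hτ k.2
    refine or_iff_not_imp_left.2 fun h0 => ⟨⟨by omega, by omega⟩, ?_⟩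
    rcases h1.eq_or_lt with e | e
    · rw [e] at h2 h0 ⊢; omega
    · have := h3 _ le_rfl e; omega
  r_mem k := by
    obtain ⟨h0, h1, h2, h3⟩ := rightWall_spec hτ k.2
    refine or_iff_not_imp_left.2 fun h0 => ⟨⟨by omega, by omega⟩, ?_⟩
    rcases (show (k : ℕ) ≤ rightWall n τ k - 1 by omega).eq_or_lt with e | e
    · rw [← e]; omega
    · have := h3 _ e (by omega); omega
  b_mem k := by
    obtain ⟨h0, h1, h2, h3⟩ := bottomWall_spec hτ k.2
    refine or_iff_not_imp_left.2 fun h0 => ⟨⟨by omega, by omega⟩, ?_⟩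
    rcases (show (k : ℕ) ≤ bottomWall n τ k - 1 by omega).eq_or_lt with e | e
    · rw [← e]; omega
    · have := h3 _ e (by omega); omega
  t_mem k := by
    obtain ⟨h1, h2, h3⟩ := topWall_spec hτ k.2
    refine or_iff_not_imp_left.2 fun h0 => ⟨⟨by omega, by omega⟩, ?_⟩
    rcases h1.eq_or_lt with e | e
    · rw [e] at h2 h0 ⊢; omega
    · have := h3 _ le_rfl e; omega
  L_notMem h := absurd h.1.1 (lt_irrefl _)
  R_notMem h := absurd h.1.2 (lt_irrefl _)
  B_notMem h := absurd h.1.2 (lt_irrefl _)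
  T_notMem h := absurd h.1.1 (lt_irrefl _)
  area f g := by
    rw [← sum_area hτ hn f g, ← Fin.sum_univ_eq_sum_range]
  sum_l w hw g := by
    rw [sum_fin_filter (leftWall τ) w fun k => g (bottomWall n τ k) - g (topWall τ k),
      sum_leftWall_eq hτ hw.1.2 (Or.inr hw.2), lowerEnd, upperEnd, if_neg hw.1.1.ne',
      if_neg hw.1.2.ne]
  sum_r w hw g := by
    rw [sum_fin_filter (rightWall n τ) w fun k => g (bottomWall n τ k) - g (topWall τ k),
      sum_rightWall_eq hτ hw.1.1 hw.1.2.le (Or.inr hw.2), lowerEnd, upperEnd, if_neg hw.1.1.ne',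
      if_neg hw.1.2.ne]
  sum_b w hw g := by
    -- Negating the positions exchanges right with bottom and left with top, at the price of a sign
    -- in the differences.
    have := sum_rightWall_eq hτ.neg hw.1.1 hw.1.2.le
      (Or.inr (by simpa using hw.2)) g
    rw [lowerEnd, upperEnd, if_neg hw.1.1.ne', if_neg hw.1.2.ne] at this
    simp only [bottomWall, topWall, neg_neg] at this
    rw [sum_fin_filter (bottomWall n τ) w fun k => g (leftWall τ k) - g (rightWall n τ k)]
    refine Eq.trans ?_ ((congrArg Neg.neg this).trans (neg_sub _ _))
    rw [← Finset.sum_neg_distrib]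
    exact Finset.sum_congr rfl fun k _ => (neg_sub _ _).symm
  sum_t w hw g := by
    have := sum_leftWall_eq hτ.neg hw.1.2
      (Or.inr (by simpa using hw.2)) g
    rw [lowerEnd, upperEnd, if_neg hw.1.1.ne', if_neg hw.1.2.ne] at this
    simp only [bottomWall, topWall, neg_neg] at this
    rw [sum_fin_filter (topWall τ) w fun k => g (leftWall τ k) - g (rightWall n τ k)]
    refine Eq.trans ?_ ((congrArg Neg.neg this).trans (neg_sub _ _))
    rw [← Finset.sum_neg_distrib]
    exact Finset.sum_congr rfl fun k _ => (neg_sub _ _).symm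
  exists_l w hw := ⟨⟨w, hw.1.2⟩, (leftWall_eq_iff hτ hw.1.2).2
    ⟨le_rfl, Or.inr hw.2, fun j h1 h2 => absurd h2 (not_lt.2 h1)⟩⟩
  exists_b w hw := by
    have h1 := hw.1
    have : bottomWall n τ (w - 1) = w := (bottomWall_eq_iff hτ (by omega)).2
      ⟨by omega, by omega, Or.inr hw.2, by omega⟩
    exact ⟨⟨w - 1, by omega⟩, this⟩
  no_cross k m h h' := by
    -- A cross would give `l k ≤ k < b k = t m ≤ m < r m = l k`.
    have := leftWall_spec hτ k.2
    have := bottomWall_spec hτ k.2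
    have := rightWall_spec hτ m.2
    have := topWall_spec hτ m.2
    omega

/-- The drawing of a diagonal rectangulation in which the wall `w` passes through the diagonal point
`w`. -/
noncomputable def diagonalDrawing {n : ℕ} {τ : ℕ → ℤ} (hτ : DistinctBelow n τ) (hn : 0 < n) :
    Drawing n := (diagonalPlan hτ hn).draw (fun w => (w : ℝ)) (fun w => (n : ℝ) - w)

theorem diagonalPlan_fits {n : ℕ} {τ : ℕ → ℤ} (hτ : DistinctBelow n τ) (hn : 0 < n) :
    (diagonalPlan hτ hn).Fits (fun w => (w : ℝ)) (fun w => (n : ℝ) - w) where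
  inj_X := Nat.cast_injective
  inj_Y a b h := by simpa using h
  outer_X := by simpa [diagonalPlan] using hn
  outer_Y := by simpa [diagonalPlan] using hn
  tile_X k := by
    have h1 := (leftWall_spec hτ k.2).1
    have h2 := (rightWall_spec hτ k.2).1
    exact Nat.cast_lt.2 (h1.trans_lt h2)
  tile_Y k := by
    have h1 := (topWall_spec hτ k.2).1
    have h2 := (bottomWall_spec hτ k.2).1
    exact sub_lt_sub_left (Nat.cast_lt.2 (h1.trans_lt h2)) _

/-- The left and bottom edges of the square together with the tiles at positions before `t`. -/
def stair {n : ℕ} {τ : ℕ → ℤ} (hτ : DistinctBelow n τ) (hn : 0 < n) (t : ℤ) : Set (ℝ × ℝ) :=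
  {p | p ∈ (square n).leftEdge ∪ (square n).bottomEdge ∨
    ∃ j : Fin n, τ j < t ∧ p ∈ ((diagonalDrawing hτ hn).tile j).toSet}

/-! ### The corners of the next rectangle. -/

section Stair

variable {n : ℕ} {τ : ℕ → ℤ} (hτ : DistinctBelow n τ) (hn : 0 < n)

theorem mem_stair {t : ℤ} {u v : ℝ} : (u, v) ∈ stair hτ hn t ↔
    (u = 0 ∧ 0 ≤ v ∧ v ≤ n) ∨ (v = 0 ∧ 0 ≤ u ∧ u ≤ n) ∨ ∃ j < n, τ j < t ∧
      (leftWall τ j : ℝ) ≤ u ∧ u ≤ (rightWall n τ j : ℝ) ∧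
      (n : ℝ) - bottomWall n τ j ≤ v ∧ v ≤ (n : ℝ) - topWall τ j := by
  rw [← or_assoc]
  exact or_congr Iff.rfl ⟨fun ⟨j, h1, h2⟩ => ⟨j, j.2, h1, h2⟩,
    fun ⟨j, hj, h1, h2⟩ => ⟨⟨j, hj⟩, h1, h2⟩⟩

theorem mem_stair_nat {t : ℤ} {u v : ℕ} (hu : u ≤ n) (hv : v ≤ n) :
    ((u : ℝ), (n : ℝ) - v) ∈ stair hτ hn t ↔
    u = 0 ∨ v = n ∨ ∃ j < n, τ j < t ∧
      leftWall τ j ≤ u ∧ u ≤ rightWall n τ j ∧ v ≤ bottomWall n τ j ∧ topWall τ j ≤ v := by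
  rw [mem_stair]
  have hu' : (u : ℝ) ≤ n := Nat.cast_le.2 hu
  have hv' : (v : ℝ) ≤ n := Nat.cast_le.2 hv
  refine or_congr ?_ (or_congr ?_ ?_)
  · rw [Nat.cast_eq_zero]
    exact and_iff_left ⟨by linarith, by linarith [Nat.cast_nonneg (α := ℝ) v]⟩
  · rw [sub_eq_zero, Nat.cast_inj, eq_comm]
    exact and_iff_left ⟨by positivity, by linarith⟩
  · simp only [Nat.cast_le, sub_le_sub_iff_left]

variable {k : ℕ} (hk : k < n)
include hk

/-- The diagonal point is already covered exactly if `k = 0` or `k - 1` precedes `k`. In that case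
the left wall of `k` passes through the point and the supremum climbs to the top wall; otherwise the
top wall passes through it and the supremum is found at the left wall. -/
theorem newTopLeft_stair : newTopLeft (stair hτ hn (τ k)) (diagPoint n k) =
    ((leftWall τ k : ℝ), (n : ℝ) - topWall τ k) := by
  obtain ⟨l1, l2, l3⟩ := leftWall_spec hτ hk
  obtain ⟨t1, t2, t3⟩ := topWall_spec hτ hk
  have hkn : (k : ℝ) < n := Nat.cast_lt.2 hk
  have hp : diagPoint n k ∈ stair hτ hn (τ k) ↔ k = 0 ∨ τ (k - 1) < τ k := by
    rw [diagPoint, mem_stair_nat hτ hn hk.le hk.le]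
    constructor
    · rintro (h | h | ⟨j, hj, h1, h2, h3, h4, h5⟩)
      · exact Or.inl h
      · omega
      · have := succ_eq_of_topLeft hτ hj hk h1 h3 h5 h4
        right; rwa [show k - 1 = j by omega]
    · rintro (h | h)
      · exact Or.inl h
      · by_cases h0 : k = 0
        · exact Or.inl h0
        · have a1 := leftWall_spec hτ (show k - 1 < n by omega)
          have a2 := rightWall_spec hτ (show k - 1 < n by omega)
          have a3 := topWall_spec hτ (show k - 1 < n by omega)
          have a4 := bottomWall_spec hτ (show k - 1 < n by omega)
          exact Or.inr (Or.inr ⟨k - 1, by omega, h, by omega, by omega, by omega, by omega⟩)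
  unfold newTopLeft
  split_ifs with h
  · have h' := hp.1 h
    have hl : leftWall τ k = k := (leftWall_eq_iff hτ hk).2 ⟨le_rfl, h', by omega⟩
    have hg : IsGreatest {v : ℝ | (diagPoint n k).2 ≤ v ∧
        ((diagPoint n k).1, v) ∈ stair hτ hn (τ k)} ((n : ℝ) - topWall τ k) := by
      constructor
      · refine ⟨sub_le_sub_left (Nat.cast_le.2 t1) _, ?_⟩
        rw [diagPoint, mem_stair_nat hτ hn hk.le (by omega)]
        by_cases h0 : k = 0
        · exact Or.inl h0
        · obtain ⟨j, hj, b1, b2, b3, b4, b5⟩ := exists_tile_topLeft hτ hk (by omega) (by omega)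
          exact Or.inr (Or.inr ⟨j, hj, b1, b2, b3, b5, b4⟩)
      · rintro v ⟨h1, h2⟩
        simp only [diagPoint] at h1 h2
        rw [mem_stair] at h2
        rcases h2 with ⟨h2, -, h3⟩ | ⟨h2, h3, h4⟩ | ⟨j, hj, h2, h3, h4, h5, h6⟩
        · have : topWall τ k = 0 := by have := Nat.cast_eq_zero.1 h2; omega
          rw [this]; simpa using h3
        · linarith
        · refine h6.trans (sub_le_sub_left (Nat.cast_le.2 ?_) _)
          exact topWall_le_topWall hτ hj hk h2 (Nat.cast_le.1 h4)
    rw [hg.csSup_eq, hl]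
    rfl
  · have h' : k ≠ 0 ∧ ¬ τ (k - 1) < τ k := by rwa [hp, not_or] at h
    have ht : topWall τ k = k := by
      rw [topWall_eq_iff hτ hk]
      refine ⟨le_rfl, Or.inr (lt_of_le_of_ne (not_lt.1 h'.2) fun e => ?_), by omega⟩
      have := hτ _ _ hk (by omega) e
      omega
    have hg : IsGreatest {u : ℝ | u ≤ (diagPoint n k).1 ∧
        (u, (diagPoint n k).2) ∈ stair hτ hn (τ k)} (leftWall τ k : ℝ) := by
      constructor
      · refine ⟨Nat.cast_le.2 l1, ?_⟩
        rw [diagPoint, mem_stair_nat hτ hn (by omega) hk.le]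
        by_cases h0 : leftWall τ k = 0
        · exact Or.inl h0
        · obtain ⟨j, hj, b1, b2, b3, b4, b5⟩ := exists_tile_left hτ hk h0
          exact Or.inr (Or.inr ⟨j, hj, b1, b2, b3, b5, b4⟩)
      · rintro v ⟨h1, h2⟩
        simp only [diagPoint] at h1 h2
        rw [mem_stair] at h2
        rcases h2 with ⟨h2, -, h3⟩ | ⟨h2, h3, h4⟩ | ⟨j, hj, h2, h3, h4, h5, h6⟩
        · rw [h2]; positivity
        · linarith
        · refine h4.trans (Nat.cast_le.2 ?_)
          exact rightWall_le_leftWall hτ hj hk h2 ((Nat.cast_le (α := ℝ)).1 (by linarith))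
    rw [hg.csSup_eq, ht]
    rfl

/-- Here coverage means that `k + 1 = n` or that `k + 1` precedes `k`; the bottom wall passes
through the diagonal point if it is covered, the right wall if it is not. -/
theorem newBottomRight_stair : newBottomRight (stair hτ hn (τ k)) (diagPoint n (k + 1)) =
    ((rightWall n τ k : ℝ), (n : ℝ) - bottomWall n τ k) := by
  obtain ⟨r0, r1, r2, r3⟩ := rightWall_spec hτ hk
  obtain ⟨b0, b1, b2, b3⟩ := bottomWall_spec hτ hk
  have hkn : ((k + 1 : ℕ) : ℝ) ≤ n := Nat.cast_le.2 hk
  have hk0 : (0 : ℝ) < (k + 1 : ℕ) := by positivity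
  have hp : diagPoint n (k + 1) ∈ stair hτ hn (τ k) ↔ k + 1 = n ∨ τ (k + 1) < τ k := by
    rw [diagPoint, mem_stair_nat hτ hn hk hk]
    constructor
    · rintro (h | h | ⟨j, hj, h1, h2, h3, h4, h5⟩)
      · omega
      · exact Or.inl h
      · have := eq_succ_of_bottomRight hτ hj hk h1 h2 h3 h5
        right; rwa [← this]
    · rintro (h | h)
      · exact Or.inr (Or.inl h)
      · by_cases h0 : k + 1 = n
        · exact Or.inr (Or.inl h0)
        · have a1 := leftWall_spec hτ (show k + 1 < n by omega)
          have a2 := rightWall_spec hτ (show k + 1 < n by omega)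
          have a3 := topWall_spec hτ (show k + 1 < n by omega)
          have a4 := bottomWall_spec hτ (show k + 1 < n by omega)
          exact Or.inr (Or.inr ⟨k + 1, by omega, h, by omega, by omega, by omega, by omega⟩)
  unfold newBottomRight
  split_ifs with h
  · have h' := hp.1 h
    have hb : bottomWall n τ k = k + 1 := (bottomWall_eq_iff hτ hk).2
      ⟨by omega, by omega, h', by omega⟩
    have hg : IsGreatest {u : ℝ | (diagPoint n (k + 1)).1 ≤ u ∧
        (u, (diagPoint n (k + 1)).2) ∈ stair hτ hn (τ k)} (rightWall n τ k : ℝ) := by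
      constructor
      · refine ⟨Nat.cast_le.2 r0, ?_⟩
        rw [diagPoint, mem_stair_nat hτ hn r1 hk]
        by_cases h0 : k + 1 = n
        · exact Or.inr (Or.inl h0)
        · obtain ⟨j, hj, b1, b2, b3, b4, b5⟩ :=
            exists_tile_bottomRight hτ hk (by omega) (by omega)
          exact Or.inr (Or.inr ⟨j, hj, b1, b2, b3, b5, b4⟩)
      · rintro v ⟨h1, h2⟩
        simp only [diagPoint] at h1 h2
        rw [mem_stair] at h2
        rcases h2 with ⟨h2, -, h3⟩ | ⟨h2, h3, h4⟩ | ⟨j, hj, h2, h3, h4, h5, h6⟩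
        · linarith
        · have : rightWall n τ k = n := by
            have : n = k + 1 := Nat.cast_inj.1 (sub_eq_zero.1 h2)
            omega
          rwa [this]
        · refine h4.trans (Nat.cast_le.2 ?_)
          exact rightWall_le_rightWall hτ hj hk h2 ((Nat.cast_le (α := ℝ)).1 (by linarith))
    rw [hg.csSup_eq, hb]
    rfl
  · have h' : k + 1 ≠ n ∧ ¬ τ (k + 1) < τ k := by rwa [hp, not_or] at h
    have hlt : τ k < τ (k + 1) := by
      refine lt_of_le_of_ne (not_lt.1 h'.2) fun e => ?_
      have := hτ _ _ hk (by omega) e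
      omega
    have hr : rightWall n τ k = k + 1 := by
      rw [rightWall_eq_iff hτ hk]
      exact ⟨by omega, by omega, Or.inr hlt, by omega⟩
    have hg : IsGreatest {v : ℝ | v ≤ (diagPoint n (k + 1)).2 ∧
        ((diagPoint n (k + 1)).1, v) ∈ stair hτ hn (τ k)} ((n : ℝ) - bottomWall n τ k) := by
      constructor
      · refine ⟨sub_le_sub_left (Nat.cast_le.2 b0) _, ?_⟩
        rw [diagPoint, mem_stair_nat hτ hn hk b1]
        by_cases h0 : bottomWall n τ k = n
        · exact Or.inr (Or.inl h0)
        · obtain ⟨j, hj, b1, b2, b3, b4, b5⟩ := exists_tile_bottom hτ hk h0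
          exact Or.inr (Or.inr ⟨j, hj, b1, b2, b3, b5, b4⟩)
      · rintro v ⟨h1, h2⟩
        simp only [diagPoint] at h1 h2
        rw [mem_stair] at h2
        rcases h2 with ⟨h2, -, h3⟩ | ⟨h2, h3, h4⟩ | ⟨j, hj, h2, h3, h4, h5, h6⟩
        · linarith
        · have : (bottomWall n τ k : ℝ) ≤ n := Nat.cast_le.2 b1
          linarith
        · refine h6.trans (sub_le_sub_left (Nat.cast_le.2 ?_) _)
          exact bottomWall_le_topWall hτ hj hk h2 (Nat.cast_le.1 h3) (Nat.cast_le.1 h4)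
            fun _ => hlt
    rw [hg.csSup_eq, hr]
    rfl

end Stair

/-- The position of the label `k` in `x`. -/
def position {n : ℕ} (x : Equiv.Perm (Fin n)) (k : ℕ) : ℤ :=
  if h : k < n then ((x.symm ⟨k, h⟩ : ℕ) : ℤ) else 0

/-! ### Permutations as position functions and the explicit form of `rho`. -/

section Position

variable {n : ℕ} (x : Equiv.Perm (Fin n))

theorem position_fin (k : Fin n) : position x k = (x.symm k : ℕ) := by simp [position]

theorem position_nonneg (k : ℕ) : 0 ≤ position x k := by
  unfold position; split_ifs <;> omega

theorem position_lt {k : ℕ} (hk : k < n) : position x k < n := by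
  unfold position; split_ifs; omega

theorem distinctBelow_position : DistinctBelow n (position x) := by
  intro i j hi hj h
  unfold position at h
  rw [dif_pos hi, dif_pos hj, Nat.cast_inj, Fin.val_inj, x.symm.injective.eq_iff] at h
  exact congrArg Fin.val h

theorem drawn_eq (hn : 0 < n) {t : ℕ} (ht : t ≤ n) :
    drawn x t = stair (distinctBelow_position x) hn t := by
  induction t with
  | zero =>
    ext p
    refine ⟨Or.inl, ?_⟩
    rintro (h | ⟨j, hj, -⟩)
    · exact h
    · exact absurd hj (not_lt.2 (position_nonneg x j))
  | succ t ih =>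
    have ht' : t < n := ht
    rw [drawn, dif_pos ht', ih ht'.le]
    have hpos : position x (x ⟨t, ht'⟩) = t := by rw [position_fin]; simp
    have hnew : newRect n (stair (distinctBelow_position x) hn t) (x ⟨t, ht'⟩) =
        (diagonalDrawing (distinctBelow_position x) hn).tile (x ⟨t, ht'⟩) := by
      rw [newRect, ← hpos, newTopLeft_stair _ hn (x ⟨t, ht'⟩).2,
        newBottomRight_stair _ hn (x ⟨t, ht'⟩).2]
      rfl
    rw [hnew]
    ext p
    constructor
    · rintro ((h | ⟨j, hj, h⟩) | h)
      · exact Or.inl h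
      · exact Or.inr ⟨j, by push_cast; omega, h⟩
      · exact Or.inr ⟨x ⟨t, ht'⟩, by push_cast; omega, h⟩
    · rintro (h | ⟨j, hj, h⟩)
      · exact Or.inl (Or.inl h)
      · push_cast at hj
        rcases (Int.lt_add_one_iff.1 hj).lt_or_eq with h' | h'
        · exact Or.inl (Or.inr ⟨j, h', h⟩)
        · have : j = x ⟨t, ht'⟩ := Fin.ext (distinctBelow_position x _ _ j.2 (x ⟨t, ht'⟩).2
            (h'.trans hpos.symm))
          exact Or.inr (this ▸ h)

theorem rho_eq (hn : 0 < n) : rho x = diagonalDrawing (distinctBelow_position x) hn := by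
  have houter : (rho x).outer = (diagonalDrawing (distinctBelow_position x) hn).outer := by
    simp [rho, square, diagonalDrawing, Plan.draw, diagonalPlan]
  have htile : (rho x).tile = (diagonalDrawing (distinctBelow_position x) hn).tile := by
    ext1 k
    change newRect n (drawn x (x.symm k)) k = _
    rw [drawn_eq x hn (x.symm k).2.le, newRect, ← position_fin, newTopLeft_stair _ hn k.2,
      newBottomRight_stair _ hn k.2]
    rfl
  calc rho x = ⟨(rho x).outer, (rho x).tile⟩ := rfl
    _ = _ := by rw [houter, htile]

end Position

end Rectangulation

namespace Rectangulation

/-! ### Coordinates that realize the wall shuffles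

Think of the wall `v` as being open from the position of the label `v - 1` to that of `v`.  When it
is created, it is placed immediately to the left of the next open wall `nextOpen n τ v`. -/

noncomputable def nextOpen (n : ℕ) (τ : ℕ → ℤ) (v : ℕ) : ℕ :=
  sInf {u | v < u ∧ (u = n ∨ u < n ∧ τ (u - 1) < τ (v - 1) ∧ τ (v - 1) < τ u)}

theorem nextOpen_spec {n : ℕ} (τ : ℕ → ℤ) {v : ℕ} (hv : v < n) :
    v < nextOpen n τ v ∧ nextOpen n τ v ≤ n ∧ (nextOpen n τ v = n ∨ nextOpen n τ v < n ∧
      τ (nextOpen n τ v - 1) < τ (v - 1) ∧ τ (v - 1) < τ (nextOpen n τ v)) := by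
  have hmem : n ∈ {u | v < u ∧ (u = n ∨ u < n ∧ τ (u - 1) < τ (v - 1) ∧ τ (v - 1) < τ u)} :=
    ⟨hv, Or.inl rfl⟩
  have h := Nat.sInf_mem ⟨n, hmem⟩
  exact ⟨h.1, Nat.sInf_le hmem, h.2⟩

theorem nextOpen_le {n : ℕ} {τ : ℕ → ℤ} {v u : ℕ} (h : v < u)
    (h' : u = n ∨ u < n ∧ τ (u - 1) < τ (v - 1) ∧ τ (v - 1) < τ u) : nextOpen n τ v ≤ u :=
  Nat.sInf_le ⟨h, h'⟩

/-- The abscissa of the wall `v`. -/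
noncomputable def coord (n : ℕ) (τ : ℕ → ℤ) (v : ℕ) : ℤ :=
  -- Indices beyond `n` are no walls; they get distinct positive values only to make the function
  -- injective on all of `ℕ`.
  if n ≤ v then (v : ℤ) - n
  else if v = 0 then -2 ^ (n + 1)
  -- This always holds here (`nextOpen_spec`) and serves the termination of the recursion.
  else if _h : v < nextOpen n τ v ∧ nextOpen n τ v ≤ n then
    coord n τ (nextOpen n τ v) - 2 ^ (n - (τ (v - 1)).toNat)
  else 0
termination_by n - v

theorem coord_self (n : ℕ) (τ : ℕ → ℤ) : coord n τ n = 0 := by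
  rw [coord, if_pos le_rfl, sub_self]

theorem coord_zero {n : ℕ} (τ : ℕ → ℤ) (hn : 0 < n) : coord n τ 0 = -2 ^ (n + 1) := by
  rw [coord, if_neg (not_le.2 hn), if_pos rfl]

theorem coord_eq {n : ℕ} {τ : ℕ → ℤ} {v : ℕ} (h0 : 0 < v) (hv : v < n) :
    coord n τ v = coord n τ (nextOpen n τ v) - 2 ^ (n - (τ (v - 1)).toNat) := by
  have h := nextOpen_spec τ hv
  rw [coord, if_neg (not_le.2 hv), if_neg h0.ne', dif_pos ⟨h.1, h.2.1⟩]

section Coord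

variable {n : ℕ} {τ : ℕ → ℤ} (hτ : DistinctBelow n τ) (hpos : ∀ k < n, 0 ≤ τ k ∧ τ k < n)

include hpos in
-- The distance used at time `t` is `2 ^ (n - t)`, halving at each step, so all walls created before
-- `t` lie on a lattice with twice that mesh.
theorem dvd_coord {v t : ℕ} (h0 : 0 < v) (hv : v ≤ n) (h : v = n ∨ τ (v - 1) < t) (ht : t ≤ n) :
    (2 : ℤ) ^ (n - t + 1) ∣ coord n τ v := by
  induction hm : n - v using Nat.strong_induction_on generalizing v with
  | _ m ih =>
    rcases hv.eq_or_lt with rfl | hv'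
    · rw [coord_self]; exact dvd_zero _
    · obtain ⟨h1, h2, h3⟩ := nextOpen_spec τ hv'
      rw [coord_eq h0 hv']
      have h4 : τ (v - 1) < t := by omega
      have h5 := hpos (v - 1) (by omega)
      refine dvd_sub (ih _ ?_ (by omega) h2 (by omega) rfl) (pow_dvd_pow _ (by omega))
      omega

include hpos in
/-- A wall is placed to the right of all earlier walls that are to the left of the next open
wall. -/
theorem coord_lt_of_lt_nextOpen {v v' : ℕ} (h0 : 0 < v) (hv : v ≤ n) (h0' : 0 < v') (hv' : v' < n)
    (h : v = n ∨ τ (v - 1) < τ (v' - 1)) (hlt : coord n τ v < coord n τ (nextOpen n τ v')) :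
    coord n τ v < coord n τ v' := by
  obtain ⟨h1, h2, h3⟩ := nextOpen_spec τ hv'
  have hp := hpos (v' - 1) (by omega)
  have d1 := dvd_coord hpos (t := (τ (v' - 1)).toNat) h0 hv (by omega) (by omega)
  have d2 := dvd_coord hpos (t := (τ (v' - 1)).toNat) (v := nextOpen n τ v') (by omega) h2
    (by omega) (by omega)
  -- Different earlier walls are at least two current step lengths apart, so the new wall fits
  -- between them.
  have d3 := Int.le_of_dvd (sub_pos.2 hlt) (dvd_sub d2 d1)
  rw [coord_eq h0' hv']
  have : (0 : ℤ) < 2 ^ (n - (τ (v' - 1)).toNat) := by positivity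
  rw [pow_succ] at d3
  linarith

include hτ hpos

/-- If `v'` is open when `v` is created, then `v` is placed left of `nextOpen n τ v`, which is `v'`
or, by induction, left of `v'`. Otherwise `v'` is created later; then `v` is left of `nextOpen n τ
v'` by induction, and `v'` is inserted to the right of `v`. -/
theorem coord_lt_coord_of_pos {v v' : ℕ} (h0 : 0 < v) (hvv : v < v') (hv' : v' ≤ n)
    (h : v' = n ∨ τ (v - 1) < τ v') : coord n τ v < coord n τ v' := by
  induction hm : (n - v) + (n - v') using Nat.strong_induction_on generalizing v v' with
  | _ m ih =>
    obtain ⟨h1, h2, h3⟩ := nextOpen_spec τ (show v < n by omega)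
    by_cases hc : v' = n ∨ τ (v' - 1) < τ (v - 1)
    · have hle : nextOpen n τ v ≤ v' := nextOpen_le hvv (by omega)
      have hlt : coord n τ v < coord n τ (nextOpen n τ v) := by
        rw [coord_eq h0 (by omega)]
        have : (0 : ℤ) < 2 ^ (n - (τ (v - 1)).toNat) := by positivity
        linarith
      rcases hle.eq_or_lt with e | e
      · rwa [e] at hlt
      · exact hlt.trans (ih _ (by omega) (by omega) e hv' (by omega) rfl)
    · rw [not_or, not_lt] at hc
      have hv'' : v' < n := by omega
      have hne : τ (v - 1) < τ (v' - 1) := by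
        refine lt_of_le_of_ne hc.2 fun e => ?_
        have := hτ _ _ (by omega) (by omega) e
        omega
      obtain ⟨k1, k2, k3⟩ := nextOpen_spec τ hv''
      exact coord_lt_of_lt_nextOpen hpos h0 (by omega) (by omega) hv'' (Or.inr hne)
        (ih _ (by omega) h0 (by omega) k2 (by omega) rfl)

theorem coord_le_zero {v : ℕ} (hv : v ≤ n) : coord n τ v ≤ 0 := by
  rcases Nat.eq_zero_or_pos n with rfl | hn
  · obtain rfl : v = 0 := by omega
    rw [coord_self]
  rcases Nat.eq_zero_or_pos v with rfl | h0
  · rw [coord_zero τ hn]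
    have : (0 : ℤ) < 2 ^ (n + 1) := by positivity
    linarith
  · rcases hv.eq_or_lt with rfl | hv'
    · exact (coord_self _ _).le
    · have := coord_lt_coord_of_pos hτ hpos h0 hv' le_rfl (Or.inl rfl)
      rw [coord_self] at this
      exact this.le

omit hτ in
-- Following `nextOpen` goes back in time, so the distances on the way to the wall `n` are distinct
-- powers of two. Their sum stays below `2 ^ (n + 1)`, the value chosen for the wall `0`.
theorem coord_lower_bound {v : ℕ} (h0 : 0 < v) (hv : v < n) :
    -2 ^ (n + 1) + 2 ^ (n - (τ (v - 1)).toNat) ≤ coord n τ v := by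
  induction hm : n - v using Nat.strong_induction_on generalizing v with
  | _ m ih =>
    obtain ⟨h1, h2, h3⟩ := nextOpen_spec τ hv
    have hp := hpos (v - 1) (by omega)
    rw [coord_eq h0 hv]
    by_cases hn : nextOpen n τ v = n
    · rw [hn, coord_self]
      have : (2 : ℤ) ^ (n - (τ (v - 1)).toNat) ≤ 2 ^ n :=
        pow_le_pow_right₀ (by norm_num) (by omega)
      rw [pow_succ]
      linarith
    · have h4 := ih _ (by omega) (v := nextOpen n τ v) (by omega) (by omega) rfl
      have hp' := hpos (nextOpen n τ v - 1) (by omega)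
      have : (2 : ℤ) ^ (n - (τ (v - 1)).toNat + 1) ≤
          2 ^ (n - (τ (nextOpen n τ v - 1)).toNat) :=
        pow_le_pow_right₀ (by norm_num) (by omega)
      rw [pow_succ] at this
      linarith

theorem coord_zero_lt {v : ℕ} (h0 : 0 < v) (hv : v ≤ n) : coord n τ 0 < coord n τ v := by
  rw [coord_zero τ (by omega)]
  rcases hv.eq_or_lt with rfl | hv'
  · rw [coord_self]
    have : (0 : ℤ) < 2 ^ (v + 1) := by positivity
    linarith
  · have := coord_lower_bound hpos h0 hv'
    have : (0 : ℤ) < 2 ^ (n - (τ (v - 1)).toNat) := by positivity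
    linarith

/-- The wall `v` is to the left of the later wall `v'` unless `v'` is closed before `v` is
created. -/
theorem coord_lt_coord {v v' : ℕ} (hvv : v < v') (hv' : v' ≤ n)
    (h : v = 0 ∨ v' = n ∨ τ (v - 1) < τ v') : coord n τ v < coord n τ v' := by
  rcases Nat.eq_zero_or_pos v with rfl | h0
  · exact coord_zero_lt hτ hpos hvv hv'
  · exact coord_lt_coord_of_pos hτ hpos h0 hvv hv' (by omega)

/-- If the wall `j` ends from below on the horizontal wall `w` before the wall `i + 1` starts on
its upper side, then `j` is to the left of `i + 1`. -/
theorem coord_lt_coord_succ {i w j : ℕ} (hi : i + 1 < w) (hj : w < j) (hjn : j < n)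
    (h1 : ∀ k, i < k → k < w → τ i < τ k) (h2 : ∀ k, w ≤ k → k < j → τ k < τ j)
    (h : τ j < τ i) : coord n τ j < coord n τ (i + 1) := by
  obtain ⟨k1, k2, k3⟩ := nextOpen_spec τ (show i + 1 < n by omega)
  simp only [Nat.add_sub_cancel] at k3
  have hlt := h2 (j - 1) (by omega) (by omega)
  -- When `i + 1` is created, the walls after it up to `w` do not exist yet, and those after `w` up
  -- to `j` are already closed.
  have hgt : j < nextOpen n τ (i + 1) := by
    by_contra! hc
    rcases k3 with k3 | ⟨k3, k4, k5⟩
    · omega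
    · by_cases hw : w < nextOpen n τ (i + 1)
      · have := h2 (nextOpen n τ (i + 1)) hw.le
        rcases hc.eq_or_lt with e | e
        · rw [e] at k5; omega
        · omega
      · have := h1 (nextOpen n τ (i + 1) - 1) (by omega) (by omega)
        omega
  refine coord_lt_of_lt_nextOpen hpos (by omega) hjn.le (by omega) (by omega) ?_ ?_
  · right; simp only [Nat.add_sub_cancel]; omega
  · exact coord_lt_coord hτ hpos hgt k2 (by omega)

/-- Of two interior walls, the later one is an odd multiple of its own step length, while the
earlier one is an even multiple of it. -/
theorem coord_injective (hn : 0 < n) : (coord n τ).Injective := by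
  have key : ∀ u v, 0 < u → u < n → 0 < v → v < n → τ (u - 1) < τ (v - 1) →
      coord n τ u ≠ coord n τ v := by
    intro u v hu hun hv hvn h e
    obtain ⟨h1, h2, h3⟩ := nextOpen_spec τ hvn
    have hp := hpos (v - 1) (by omega)
    have d1 := dvd_coord hpos (t := (τ (v - 1)).toNat) hu hun.le (by omega) (by omega)
    have d2 := dvd_coord hpos (t := (τ (v - 1)).toNat) (v := nextOpen n τ v) (by omega) h2
      (by omega) (by omega)
    rw [e, coord_eq hv hvn] at d1
    have d3 := Int.le_of_dvd (by positivity) ((dvd_sub_right d2).1 d1)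
    have : (0 : ℤ) < 2 ^ (n - (τ (v - 1)).toNat) := by positivity
    rw [pow_succ] at d3
    linarith
  have big : ∀ v, n < v → 0 < coord n τ v := by
    intro v hv
    rw [coord, if_pos hv.le]
    omega
  have aux : ∀ u v, u < v → coord n τ u ≠ coord n τ v := by
    intro u v huv
    rcases lt_trichotomy v n with hv | rfl | hv
    · rcases Nat.eq_zero_or_pos u with rfl | hu
      · exact (coord_zero_lt hτ hpos huv hv.le).ne
      · rcases lt_trichotomy (τ (u - 1)) (τ (v - 1)) with h | h | h
        · exact key u v hu (by omega) (by omega) hv h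
        · have := hτ _ _ (by omega) (by omega) h
          omega
        · exact (key v u (by omega) hv hu (by omega) h).symm
    · exact (coord_lt_coord hτ hpos huv le_rfl (Or.inr (Or.inl rfl))).ne
    · rcases Nat.lt_or_ge n u with hu | hu
      · rw [coord, if_pos hu.le, coord, if_pos hv.le]
        omega
      · exact ((coord_le_zero hτ hpos hu).trans_lt (big v hv)).ne
  intro u v e
  rcases lt_trichotomy u v with h | h | h
  · exact absurd e (aux u v h)
  · exact h
  · exact absurd e.symm (aux v u h)

end Coord

/-- The ordinate of the wall `w`. -/
noncomputable def ordinate (n : ℕ) (τ : ℕ → ℤ) (w : ℕ) : ℤ :=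
  -- Reversing the labels exchanges vertical with horizontal walls and keeps the positions. Beyond
  -- `n` the values again only secure injectivity.
  if w ≤ n then coord n (fun k => τ (n - 1 - k)) (n - w) else w

section Ordinate

variable {n : ℕ} {τ : ℕ → ℤ} (hτ : DistinctBelow n τ) (hpos : ∀ k < n, 0 ≤ τ k ∧ τ k < n)
include hτ hpos

theorem ordinate_lt_ordinate {w w' : ℕ} (hww : w < w') (hw' : w' ≤ n)
    (h : w = 0 ∨ w' = n ∨ τ w' < τ (w - 1)) : ordinate n τ w' < ordinate n τ w := by
  rw [ordinate, ordinate, if_pos hw', if_pos (by omega)]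
  refine coord_lt_coord hτ.reflect (fun k hk => hpos _ (by omega)) (by omega) (by omega) ?_
  rcases h with h | h | h
  · omega
  · omega
  · by_cases h0 : w = 0
    · omega
    · by_cases hn : w' = n
      · omega
      · right; right
        rwa [show n - 1 - (n - w' - 1) = w' by omega, show n - 1 - (n - w) = w - 1 by omega]

theorem ordinate_succ_lt_ordinate {i w j : ℕ} (hi : i + 1 < w) (hj : w < j) (hjn : j < n)
    (h1 : ∀ k, i < k → k < w → τ k < τ i) (h2 : ∀ k, w ≤ k → k < j → τ j < τ k)
    (h : τ i < τ j) : ordinate n τ (i + 1) < ordinate n τ j := by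
  rw [ordinate, ordinate, if_pos (by omega), if_pos (by omega)]
  have := coord_lt_coord_succ hτ.reflect (fun k hk => hpos _ (by omega)) (i := n - 1 - j)
    (w := n - w) (j := n - (i + 1)) (by omega) (by omega) (by omega) ?_ ?_ ?_
  · rwa [show n - 1 - j + 1 = n - j by omega] at this
  · intro k hk hk'
    rw [show n - 1 - (n - 1 - j) = j by omega]
    exact h2 _ (by omega) (by omega)
  · intro k hk hk'
    rw [show n - 1 - (n - (i + 1)) = i by omega]
    exact h1 _ (by omega) (by omega)
  · rwa [show n - 1 - (n - (i + 1)) = i by omega, show n - 1 - (n - 1 - j) = j by omega]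

theorem ordinate_injective (hn : 0 < n) : (ordinate n τ).Injective := by
  have hpos' : ∀ k < n, 0 ≤ τ (n - 1 - k) ∧ τ (n - 1 - k) < n := fun k hk => hpos _ (by omega)
  intro u v e
  unfold ordinate at e
  have hle (w : ℕ) := coord_le_zero hτ.reflect hpos' (show n - w ≤ n by omega)
  have hu := hle u
  have hv := hle v
  split_ifs at e with a1 a2 a3
  · have := coord_injective hτ.reflect hpos' hn e
    omega
  · omega
  · omega
  · omega

/-- For interior walls `l`, `r` beside the tile `k` one has `τ (l - 1) < τ k < τ r`, so `l` is
created before `r` is closed; this is the criterion of `coord_lt_coord`. -/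
theorem generic_fits (hn : 0 < n) : (diagonalPlan hτ hn).Fits (fun w => (coord n τ w : ℝ))
    (fun w => (ordinate n τ w : ℝ)) where
  inj_X := Int.cast_injective.comp (coord_injective hτ hpos hn)
  inj_Y := Int.cast_injective.comp (ordinate_injective hτ hpos hn)
  outer_X := Int.cast_lt.2 (coord_lt_coord hτ hpos hn le_rfl (Or.inl rfl))
  outer_Y := Int.cast_lt.2 (ordinate_lt_ordinate hτ hpos hn le_rfl (Or.inl rfl))
  tile_X k := by
    obtain ⟨l1, l2, l3⟩ := leftWall_spec hτ k.2
    obtain ⟨r0, r1, r2, r3⟩ := rightWall_spec hτ k.2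
    exact Int.cast_lt.2 (coord_lt_coord hτ hpos (v := leftWall τ k)
      (v' := rightWall n τ k) (by omega) r1 (by omega))
  tile_Y k := by
    obtain ⟨l1, l2, l3⟩ := topWall_spec hτ k.2
    obtain ⟨r0, r1, r2, r3⟩ := bottomWall_spec hτ k.2
    exact Int.cast_lt.2 (ordinate_lt_ordinate hτ hpos (w := topWall τ k)
      (w' := bottomWall n τ k) (by omega) r1 (by omega))

end Ordinate

end Rectangulation

namespace Rectangulation

/-! ### Wall shuffles of the drawings of a diagonal plan -/

section Records

variable {n : ℕ} {τ : ℕ → ℤ} (hτ : DistinctBelow n τ) (hn : 0 < n) {X Y : ℕ → ℝ}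

/-- On the left only the bottommost tile `w - 1` is omitted, and any other tile `k` has the bottom
wall `k + 1` because `k + 1` precedes `k`. On the right, likewise, only `w` is omitted and the top
wall of `k` is `k`. -/
theorem records_vertSeg_iff (h : (diagonalPlan hτ hn).Fits X Y) {w : ℕ}
    (hw : w ∈ (diagonalPlan hτ hn).V) {k : Fin n} {y : ℝ} :
    ((diagonalPlan hτ hn).draw X Y).Records ((diagonalPlan hτ hn).vertSeg X Y w) k y ↔
      ((k : ℕ) + 1 < w ∧ rightWall n τ k = w ∧ y = Y (k + 1)) ∨
      (w < (k : ℕ) ∧ leftWall τ k = w ∧ y = Y k) := by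
  rw [h.records_vertSeg hw]
  change (rightWall n τ k = w ∧ bottomWall n τ k ≠ bottomWall n τ (w - 1) ∧
    y = Y (bottomWall n τ k)) ∨ (leftWall τ k = w ∧ topWall τ k ≠ topWall τ w ∧
    y = Y (topWall τ k)) ↔ _
  obtain ⟨⟨w0, wn⟩, hv⟩ := hw
  refine or_congr ?_ ?_
  · by_cases hr : rightWall n τ k = w
    · have hr' := (rightWall_eq_iff hτ k.2).1 hr
      by_cases e : (k : ℕ) + 1 < w
      · have hb : bottomWall n τ k = k + 1 := (bottomWall_eq_iff hτ k.2).2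
          ⟨by omega, by omega, Or.inr (hr'.2.2.2 _ (by omega) e), by omega⟩
        have := bottomWall_spec hτ (k := w - 1) (by omega)
        simp only [hr, e, hb, true_and, and_iff_right_iff_imp]
        omega
      · have : (k : ℕ) = w - 1 := by omega
        have h' : ¬ (w - 1 + 1 < w) := by omega
        simp [this, h']
    · simp [hr]
  · by_cases hl : leftWall τ k = w
    · have hl' := (leftWall_eq_iff hτ k.2).1 hl
      by_cases e : w < (k : ℕ)
      · have ht : topWall τ k = k := (topWall_eq_iff hτ k.2).2
          ⟨le_rfl, Or.inr (hl'.2.2 _ (by omega) (by omega)), by omega⟩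
        have := topWall_spec hτ wn
        simp only [hl, e, ht, true_and, and_iff_right_iff_imp]
        omega
      · have : (k : ℕ) = w := by omega
        simp [this]
    · simp [hl]

theorem records_horizSeg_iff (h : (diagonalPlan hτ hn).Fits X Y) {w : ℕ}
    (hw : w ∈ (diagonalPlan hτ hn).H) {k : Fin n} {y : ℝ} :
    ((diagonalPlan hτ hn).draw X Y).Records ((diagonalPlan hτ hn).horizSeg X Y w) k y ↔
      ((k : ℕ) + 1 < w ∧ bottomWall n τ k = w ∧ y = X (k + 1)) ∨
      (w < (k : ℕ) ∧ topWall τ k = w ∧ y = X k) := by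
  rw [h.records_horizSeg hw]
  change (bottomWall n τ k = w ∧ rightWall n τ k ≠ rightWall n τ (w - 1) ∧
    y = X (rightWall n τ k)) ∨ (topWall τ k = w ∧ leftWall τ k ≠ leftWall τ w ∧
    y = X (leftWall τ k)) ↔ _
  obtain ⟨⟨w0, wn⟩, hv⟩ := hw
  refine or_congr ?_ ?_
  · by_cases hr : bottomWall n τ k = w
    · have hr' := (bottomWall_eq_iff hτ k.2).1 hr
      by_cases e : (k : ℕ) + 1 < w
      · have hb : rightWall n τ k = k + 1 := (rightWall_eq_iff hτ k.2).2
          ⟨by omega, by omega, Or.inr (hr'.2.2.2 _ (by omega) e), by omega⟩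
        have := rightWall_spec hτ (k := w - 1) (by omega)
        simp only [hr, e, hb, true_and, and_iff_right_iff_imp]
        omega
      · have : (k : ℕ) = w - 1 := by omega
        have h' : ¬ (w - 1 + 1 < w) := by omega
        simp [this, h']
    · simp [hr]
  · by_cases hl : topWall τ k = w
    · have hl' := (topWall_eq_iff hτ k.2).1 hl
      by_cases e : w < (k : ℕ)
      · have ht : leftWall τ k = k := (leftWall_eq_iff hτ k.2).2
          ⟨le_rfl, Or.inr (hl'.2.2 _ (by omega) (by omega)), by omega⟩
        have := leftWall_spec hτ wn
        simp only [hl, e, ht, true_and, and_iff_right_iff_imp]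
        omega
      · have : (k : ℕ) = w := by omega
        simp [this]
    · simp [hl]

/-- The labels in the wall shuffle of the wall `w`. -/
theorem inShuffle_vertSeg_iff (h : (diagonalPlan hτ hn).Fits X Y) {w : ℕ}
    (hw : w ∈ (diagonalPlan hτ hn).V) {k : Fin n} :
    ((diagonalPlan hτ hn).draw X Y).InShuffle ((diagonalPlan hτ hn).vertSeg X Y w) k ↔
      ((k : ℕ) + 1 < w ∧ rightWall n τ k = w) ∨ (w < (k : ℕ) ∧ leftWall τ k = w) := by
  simp only [Drawing.InShuffle, records_vertSeg_iff hτ hn h hw, exists_or, exists_and_left,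
    exists_eq, and_true]

theorem inShuffle_horizSeg_iff (h : (diagonalPlan hτ hn).Fits X Y) {w : ℕ}
    (hw : w ∈ (diagonalPlan hτ hn).H) {k : Fin n} :
    ((diagonalPlan hτ hn).draw X Y).InShuffle ((diagonalPlan hτ hn).horizSeg X Y w) k ↔
      ((k : ℕ) + 1 < w ∧ bottomWall n τ k = w) ∨ (w < (k : ℕ) ∧ topWall τ k = w) := by
  simp only [Drawing.InShuffle, records_horizSeg_iff hτ hn h hw, exists_or, exists_and_left,
    exists_eq, and_true]

variable (hpos : ∀ k < n, 0 ≤ τ k ∧ τ k < n)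
include hpos

/-- In the diagonal drawing all records from the right lie below all those from the left. The
essential case is therefore a left label that precedes a right label: there the walls must slide,
and `ordinate_succ_lt_ordinate` shows that they do. The other cases follow from
`ordinate_lt_ordinate`. -/
theorem records_vertSeg_lt {w : ℕ} (hw : w ∈ (diagonalPlan hτ hn).V) {i j : Fin n}
    (hij : τ i < τ j) {y y' : ℝ}
    (hi : ((diagonalPlan hτ hn).draw (fun w => (coord n τ w : ℝ))
      (fun w => (ordinate n τ w : ℝ))).Records ((diagonalPlan hτ hn).vertSeg
      (fun w => (coord n τ w : ℝ))
      (fun w => (ordinate n τ w : ℝ)) w) i y)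
    (hj : ((diagonalPlan hτ hn).draw (fun w => (coord n τ w : ℝ))
      (fun w => (ordinate n τ w : ℝ))).Records ((diagonalPlan hτ hn).vertSeg
      (fun w => (coord n τ w : ℝ))
      (fun w => (ordinate n τ w : ℝ)) w) j y') :
    y < y' := by
  rw [records_vertSeg_iff hτ hn (generic_fits hτ hpos hn) hw] at hi hj
  obtain ⟨⟨w0, wn⟩, hv⟩ := hw
  rcases hi with ⟨i1, i2, rfl⟩ | ⟨i1, i2, rfl⟩ <;> rcases hj with ⟨j1, j2, rfl⟩ | ⟨j1, j2, rfl⟩ <;>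
    rw [Int.cast_lt] <;> have hi' := i.2 <;> have hj' := j.2
  · rw [rightWall_eq_iff hτ i.2] at i2
    rw [rightWall_eq_iff hτ j.2] at j2
    have := i2.2.2.2 j
    have := i2.2.2.2 (i + 1) (by omega) i1
    have hne : (i : ℕ) ≠ j := by intro e; rw [e] at hij; omega
    refine ordinate_lt_ordinate hτ hpos (by omega) (by omega) (Or.inr (Or.inr ?_))
    rw [Nat.add_sub_cancel]
    have := j2.2.2.2 i
    omega
  · rw [rightWall_eq_iff hτ i.2] at i2
    rw [leftWall_eq_iff hτ j.2] at j2
    exact ordinate_succ_lt_ordinate hτ hpos i1 j1 hj' i2.2.2.2 j2.2.2 hij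
  · refine ordinate_lt_ordinate hτ hpos (by omega) (by omega) (Or.inr (Or.inr ?_))
    rwa [Nat.add_sub_cancel]
  · rw [leftWall_eq_iff hτ i.2] at i2
    rw [leftWall_eq_iff hτ j.2] at j2
    have hne : (i : ℕ) ≠ j := by intro e; rw [e] at hij; omega
    have := j2.2.2 i
    have := j2.2.2 (j - 1)
    exact ordinate_lt_ordinate hτ hpos (by omega) (by omega) (Or.inr (Or.inr (by omega)))

theorem records_horizSeg_lt {w : ℕ} (hw : w ∈ (diagonalPlan hτ hn).H) {i j : Fin n}
    (hij : τ i < τ j) {y y' : ℝ}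
    (hi : ((diagonalPlan hτ hn).draw (fun w => (coord n τ w : ℝ))
      (fun w => (ordinate n τ w : ℝ))).Records ((diagonalPlan hτ hn).horizSeg
      (fun w => (coord n τ w : ℝ))
      (fun w => (ordinate n τ w : ℝ)) w) i y)
    (hj : ((diagonalPlan hτ hn).draw (fun w => (coord n τ w : ℝ))
      (fun w => (ordinate n τ w : ℝ))).Records ((diagonalPlan hτ hn).horizSeg
      (fun w => (coord n τ w : ℝ))
      (fun w => (ordinate n τ w : ℝ)) w) j y') :
    y < y' := by
  rw [records_horizSeg_iff hτ hn (generic_fits hτ hpos hn) hw] at hi hj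
  obtain ⟨⟨w0, wn⟩, hv⟩ := hw
  rcases hi with ⟨i1, i2, rfl⟩ | ⟨i1, i2, rfl⟩ <;> rcases hj with ⟨j1, j2, rfl⟩ | ⟨j1, j2, rfl⟩ <;>
    rw [Int.cast_lt] <;> have hi' := i.2 <;> have hj' := j.2
  · rw [bottomWall_eq_iff hτ i.2] at i2
    rw [bottomWall_eq_iff hτ j.2] at j2
    have := j2.2.2.2 i
    have := j2.2.2.2 (j + 1) (by omega) j1
    have hne : (i : ℕ) ≠ j := by intro e; rw [e] at hij; omega
    refine coord_lt_coord hτ hpos (by omega) (by omega) (Or.inr (Or.inr ?_))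
    rw [Nat.add_sub_cancel]
    omega
  · refine coord_lt_coord hτ hpos (by omega) (by omega) (Or.inr (Or.inr ?_))
    rwa [Nat.add_sub_cancel]
  · rw [topWall_eq_iff hτ i.2] at i2
    rw [bottomWall_eq_iff hτ j.2] at j2
    exact coord_lt_coord_succ hτ hpos j1 i1 hi' j2.2.2.2 i2.2.2 hij
  · rw [topWall_eq_iff hτ i.2] at i2
    rw [topWall_eq_iff hτ j.2] at j2
    have hne : (i : ℕ) ≠ j := by intro e; rw [e] at hij; omega
    have := i2.2.2 j
    have := i2.2.2 (i - 1)
    exact coord_lt_coord hτ hpos (by omega) (by omega) (Or.inr (Or.inr (by omega)))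

end Records

/-! ### Existence and uniqueness of the generic rectangulation -/

section Gamma

variable {n : ℕ}

theorem position_bounds (x : Equiv.Perm (Fin n)) : ∀ k < n, 0 ≤ position x k ∧ position x k < n :=
  fun k hk => ⟨position_nonneg x k, position_lt x hk⟩

/-- A representative of `γ(x)`. -/
noncomputable def genericTiling (x : Equiv.Perm (Fin n)) (hn : 0 < n) : GenericTiling n :=
  ⟨(diagonalPlan (distinctBelow_position x) hn).draw (fun w => (coord n (position x) w : ℝ))
    (fun w => (ordinate n (position x) w : ℝ)),
    (generic_fits (distinctBelow_position x) (position_bounds x) hn).isGenericTiling⟩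

theorem pairwise_filter_ofFn (x : Equiv.Perm (Fin n)) (p : Fin n → Bool)
    (r : Fin n → Fin n → Prop) : ((List.ofFn x).filter p).Pairwise r ↔
      ∀ i j, p i → p j → position x i < position x j → r i j := by
  rw [List.pairwise_filter, List.pairwise_ofFn]
  simp only [position_fin, Nat.cast_lt, Fin.val_fin_lt]
  constructor
  · intro h i j hi hj hij
    have := h hij
    simp only [Equiv.apply_symm_apply] at this
    exact this hi hj
  · intro h i j hij hi hj
    exact h _ _ hi hj (by simpa using hij)

open Classical in
/-- The condition that defines `γ`, for an arbitrary drawing in place of `ρ(x)` and a list of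
numbers in place of `x`. -/
def Realizes (D : Drawing n) (l : List (Fin n)) (R : Drawing n) : Prop :=
  ∃ φ : D.Wall ≃ R.Wall, D.IsMosaicEquiv R φ ∧
    ∀ W : D.Wall, R.IsWallShuffle (φ W).1 (l.filter fun i => D.InShuffle W.1 i)

theorem isGamma_iff {x : Equiv.Perm (Fin n)} {Q : GRec n} : IsGamma x Q ↔
    ∃ R : GenericTiling n, GRec.mk R = Q ∧ Realizes (rho x) (List.ofFn x) R.1 := Iff.rfl

open Classical in
theorem isWallShuffle_filter_iff (x : Equiv.Perm (Fin n)) {R : Drawing n} {s : Seg}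
    {p : Fin n → Prop} : R.IsWallShuffle s ((List.ofFn x).filter fun i => p i) ↔
      (∀ i, p i ↔ R.InShuffle s i) ∧ ∀ i j, p i → p j → position x i < position x j →
        ∀ h h', R.Records s i h → R.Records s j h' → h < h' := by
  rw [Drawing.IsWallShuffle, pairwise_filter_ofFn]
  refine and_congr (forall_congr' fun i => ?_) (by simp)
  rw [List.mem_filter, List.mem_ofFn, decide_eq_true_eq, and_iff_right (x.surjective i)]

theorem isGamma_genericTiling (x : Equiv.Perm (Fin n)) (hn : 0 < n) :
    IsGamma x (GRec.mk (genericTiling x hn)) := by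
  rw [isGamma_iff]
  refine ⟨_, rfl, ?_⟩
  rw [rho_eq x hn]
  rw [diagonalDrawing, genericTiling]
  have h := diagonalPlan_fits (distinctBelow_position x) hn
  have h' := generic_fits (distinctBelow_position x) (position_bounds x) hn
  refine ⟨h.wallEquiv.symm.trans h'.wallEquiv, h.isMosaicEquiv h', fun W => ?_⟩
  rw [isWallShuffle_filter_iff]
  obtain ⟨z, rfl⟩ := h.wallEquiv.surjective W
  have hz : (h.wallEquiv.symm.trans h'.wallEquiv) (h.wallEquiv z) = h'.wallEquiv z := by simp
  simp only [hz]
  rcases z with ⟨w, hw⟩ | ⟨w, hw⟩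
  · refine ⟨fun i => ?_, fun i j _ _ hij y y' hi hj => ?_⟩
    · exact (inShuffle_vertSeg_iff _ hn h hw).trans (inShuffle_vertSeg_iff _ hn h' hw).symm
    · exact records_vertSeg_lt _ hn (position_bounds x) hw hij hi hj
  · refine ⟨fun i => ?_, fun i j _ _ hij y y' hi hj => ?_⟩
    · exact (inShuffle_horizSeg_iff _ hn h hw).trans (inShuffle_horizSeg_iff _ hn h' hw).symm
    · exact records_horizSeg_lt _ hn (position_bounds x) hw hij hi hj

/-- In both tilings the records on corresponding walls are sorted by position in `x`, hence in the
same way. -/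
theorem Realizes.wallsMatch {D R R' : Drawing n} {x : Equiv.Perm (Fin n)}
    (h : Realizes D (List.ofFn x) R) (h' : Realizes D (List.ofFn x) R') : Drawing.WallsMatch R R' := by
  obtain ⟨φ, hφ, hs⟩ := h
  obtain ⟨φ', hφ', hs'⟩ := h'
  intro s hW
  obtain ⟨W, hW'⟩ := φ.surjective ⟨s, hW⟩
  obtain ⟨a1, a2, a3⟩ := hφ W
  obtain ⟨b1, b2, b3⟩ := hφ' W
  have c := (isWallShuffle_filter_iff x).1 (hs W)
  have d := (isWallShuffle_filter_iff x).1 (hs' W)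
  rw [hW'] at a1 a2 a3 c
  refine ⟨(φ' W).1, (φ' W).2, b1.trans a1.symm, fun i => (b2 i).trans (a2 i).symm,
    fun i => (b3 i).trans (a3 i).symm, fun i => (d.1 i).symm.trans (c.1 i), ?_⟩
  intro i j h₁ h₂ k₁ k₂ hij r1 r2 r3 r4
  have hi := (c.1 i).2 ⟨_, r1⟩
  have hj := (c.1 j).2 ⟨_, r2⟩
  rcases lt_trichotomy (position x i) (position x j) with hlt | heq | hlt
  · exact iff_of_true (c.2 i j hi hj hlt _ _ r1 r2) (d.2 i j hi hj hlt _ _ r3 r4)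
  · exact absurd (Fin.ext (distinctBelow_position x _ _ i.2 j.2 heq)) hij
  · exact iff_of_false (c.2 j i hj hi hlt _ _ r2 r1).not_gt (d.2 j i hj hi hlt _ _ r4 r3).not_gt

theorem IsGamma.unique {x : Equiv.Perm (Fin n)} {Q Q' : GRec n} (h : IsGamma x Q)
    (h' : IsGamma x Q') : Q = Q' := by
  obtain ⟨R, rfl, hR⟩ := isGamma_iff.1 h
  obtain ⟨R', rfl, hR'⟩ := isGamma_iff.1 h'
  refine Quotient.sound ⟨Equiv.refl _, fun i j => ⟨⟨?_, ?_⟩, ?_, ?_⟩⟩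
  · exact (hR.wallsMatch hR').isBelow R.2 R'.2
  · exact (hR'.wallsMatch hR).isBelow R'.2 R.2
  · exact (hR.wallsMatch hR').isLeftOf R.2 R'.2
  · exact (hR'.wallsMatch hR).isLeftOf R'.2 R.2

/-! ### Equivalences of generic tilings preserve the labels -/

/-- The labels `k` and `k + 1` lie on opposite sides of the wall `k + 1` and are joined by a zigzag
of adjacencies along it. The image of the zigzag runs along a single wall of the other tiling, whose
index then lies above the image of `k` and not above that of `k + 1`. -/
theorem strictMono_of_relations {x y : Equiv.Perm (Fin n)} (hn : 0 < n) {σ : Equiv.Perm (Fin n)}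
    (hσ : ∀ i j, ((genericTiling x hn).1.Below i j ↔ (genericTiling y hn).1.Below (σ i) (σ j)) ∧
      ((genericTiling x hn).1.LeftOf i j ↔ (genericTiling y hn).1.LeftOf (σ i) (σ j))) :
    StrictMono σ := by
  have hx := generic_fits (distinctBelow_position x) (position_bounds x) hn
  have hy := generic_fits (distinctBelow_position y) (position_bounds y) hn
  have hsucc : ∀ k (hk : k + 1 < n), σ ⟨k, by omega⟩ < σ ⟨k + 1, hk⟩ := by
    intro k hk
    have hτ := distinctBelow_position x
    have hτ' := distinctBelow_position y
    rcases lt_trichotomy (position x k) (position x (k + 1)) with h | h | h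
    · have hw : k + 1 ∈ (diagonalPlan hτ hn).V := ⟨⟨by omega, hk⟩, h⟩
      have hr : rightWall n (position x) k = k + 1 :=
        (rightWall_eq_iff hτ (by omega)).2 ⟨by omega, hk.le, Or.inr h, by omega⟩
      have hz := hx.zigzag_left hw (i := ⟨k, by omega⟩) (j := ⟨k + 1, hk⟩) hr rfl
        ((leftWall_eq_iff hτ hk).2 ⟨le_rfl, Or.inr h, by omega⟩)
      have := hy.eq_of_zigzag_left (hz.map fun i j => (hσ i j).2.1)
      have h1 := (rightWall_spec hτ' (σ ⟨k, by omega⟩).2).1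
      have h2 := (leftWall_spec hτ' (σ ⟨k + 1, hk⟩).2).1
      exact Fin.lt_def.2 (h1.trans_le (this.le.trans h2))
    · have := hτ _ _ (by omega) hk h
      omega
    · have hw : k + 1 ∈ (diagonalPlan hτ hn).H := ⟨⟨by omega, hk⟩, h⟩
      have hb : bottomWall n (position x) k = k + 1 :=
        (bottomWall_eq_iff hτ (by omega)).2 ⟨by omega, hk.le, Or.inr h, by omega⟩
      have hz := hx.zigzag_below hw (i := ⟨k + 1, hk⟩) (j := ⟨k, by omega⟩)
        ((topWall_eq_iff hτ hk).2 ⟨le_rfl, Or.inr h, by omega⟩) rfl hb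
      have := hy.eq_of_zigzag_below (hz.map fun i j => (hσ i j).1.1)
      have h1 := (bottomWall_spec hτ' (σ ⟨k, by omega⟩).2).1
      have h2 := (topWall_spec hτ' (σ ⟨k + 1, hk⟩).2).1
      exact Fin.lt_def.2 (h1.trans_le (this.ge.trans h2))
  have key : ∀ d i (h : i + d + 1 < n), σ ⟨i, by omega⟩ < σ ⟨i + d + 1, h⟩ := by
    intro d
    induction d with
    | zero => exact fun i h => hsucc i h
    | succ d ih => exact fun i h => (ih i (by omega)).trans (hsucc (i + d + 1) h)
  intro i j hij
  obtain ⟨d, hd⟩ := Nat.exists_eq_add_of_lt (Fin.lt_def.1 hij)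
  have := key d i (by omega)
  rwa [show (⟨(i : ℕ) + d + 1, by omega⟩ : Fin n) = j from Fin.ext hd.symm] at this

theorem relations_of_mk_eq {x y : Equiv.Perm (Fin n)} (hn : 0 < n)
    (h : GRec.mk (genericTiling x hn) = GRec.mk (genericTiling y hn)) (i j : Fin n) :
    ((genericTiling x hn).1.Below i j ↔ (genericTiling y hn).1.Below i j) ∧
    ((genericTiling x hn).1.LeftOf i j ↔ (genericTiling y hn).1.LeftOf i j) := by
  obtain ⟨σ, hσ⟩ : CombEquiv _ _ := Quotient.exact h
  have hmono := strictMono_of_relations hn hσ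
  have hid : ∀ i, σ i = i := fun i => by
    have := Subsingleton.elim (hmono.orderIsoOfSurjective σ σ.surjective) (OrderIso.refl (Fin n))
    exact congrArg (fun f : Fin n ≃o Fin n => f i) this
  have := hσ i j
  rwa [hid, hid] at this

end Gamma

/-! ### Swapping two adjacent entries -/

/-- The adjacent entries `e`, `a` with `a < e`, in this order in the permutation with positions
`τ`, are swapped to obtain the permutation with positions `τ'`. -/
structure AdjacentSwap (n : ℕ) (τ τ' : ℕ → ℤ) (a e : ℕ) : Prop where
  lt : a < e
  e_lt : e < n
  adjacent : τ e + 1 = τ a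
  a_eq : τ' a = τ e
  e_eq : τ' e = τ a
  other : ∀ k < n, k ≠ a → k ≠ e → τ' k = τ k

namespace AdjacentSwap

variable {n : ℕ} {τ τ' : ℕ → ℤ} {a e : ℕ} (hs : AdjacentSwap n τ τ' a e)
  (hτ : DistinctBelow n τ) (hτ' : DistinctBelow n τ')

include hs

include hτ in
-- No position lies strictly between two adjacent ones, so exchanging them reverses only the
-- comparison of `a` with `e`.
theorem lt_iff {j k : ℕ} (hj : j < n) (hk : k < n) (h : ¬ (j = a ∧ k = e)) (h' : ¬ (j = e ∧ k = a)) :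
    τ' j < τ' k ↔ τ j < τ k := by
  obtain ⟨h1, h2, h3, h4, h5, h6⟩ := hs
  have hne (i m : ℕ) (hi : i < n) (hm : m < n) (him : i ≠ m) : τ i ≠ τ m :=
    fun e => him (hτ i m hi hm e)
  have p1 := hne j a hj (by omega)
  have p2 := hne j e hj (by omega)
  have p3 := hne k a hk (by omega)
  have p4 := hne k e hk (by omega)
  by_cases ja : j = a
  · by_cases ka : k = a
    · rw [ja, ka]; simp
    · rw [h6 k hk ka (by omega), ja, h4]; omega
  · by_cases je : j = e
    · by_cases ke : k = e
      · rw [je, ke]; simp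
      · rw [h6 k hk (by omega) ke, je, h5]; omega
    · rw [h6 j hj ja je]
      by_cases ka : k = a
      · rw [ka, h4]; omega
      · by_cases ke : k = e
        · rw [ke, h5]; omega
        · rw [h6 k hk ka ke]

include hτ hτ'

/-- If there are labels between `a` and `e` on both sides of the swapped pair, then the diagonal
rectangulation does not change. -/
theorem walls_eq {p q : ℕ} (hp : a < p) (hpe : p < e) (hp' : τ p < τ e) (hq : a < q) (hqe : q < e)
    (hq' : τ a < τ q) {k : ℕ} (hk : k < n) : leftWall τ' k = leftWall τ k ∧
      rightWall n τ' k = rightWall n τ k ∧ bottomWall n τ' k = bottomWall n τ k ∧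
      topWall τ' k = topWall τ k := by
  have hlt := fun {j k : ℕ} => hs.lt_iff hτ (j := j) (k := k)
  obtain ⟨h1, h2, h3, -⟩ := hs
  refine ⟨?_, ?_, ?_, ?_⟩
  · obtain ⟨l1, l2, l3⟩ := leftWall_spec hτ hk
    have hkp := l3 p
    -- The affected comparison could enter only if the search from `e` reached `a`, and the label
    -- `p` stops it earlier. The other three walls are treated alike, with `q` for the right and top
    -- walls.
    have bound : k = e → p < leftWall τ k := by rintro rfl; omega
    rw [leftWall_eq_iff hτ' hk]
    refine ⟨l1, ?_, fun j hj hjk => (hlt hk (by omega) (by omega) (by omega)).2 (l3 j hj hjk)⟩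
    rcases l2 with l2 | l2
    · exact Or.inl l2
    · exact (Nat.eq_zero_or_pos _).imp_right fun h0 =>
        (hlt (by omega) hk (by omega) (by omega)).2 l2
  · obtain ⟨l0, l1, l2, l3⟩ := rightWall_spec hτ hk
    have hkq := l3 q
    have bound : k = a → rightWall n τ k ≤ q := by rintro rfl; omega
    rw [rightWall_eq_iff hτ' hk]
    refine ⟨l0, l1, ?_, fun j hj hjk => (hlt (by omega) hk (by omega) (by omega)).2 (l3 j hj hjk)⟩
    by_cases hn : rightWall n τ k = n
    · exact Or.inl hn
    · exact Or.inr ((hlt hk (by omega) (by omega) (by omega)).2 (by omega))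
  · obtain ⟨l0, l1, l2, l3⟩ := bottomWall_spec hτ hk
    have hkp := l3 p
    have bound : k = a → bottomWall n τ k ≤ p := by rintro rfl; omega
    rw [bottomWall_eq_iff hτ' hk]
    refine ⟨l0, l1, ?_, fun j hj hjk => (hlt hk (by omega) (by omega) (by omega)).2 (l3 j hj hjk)⟩
    by_cases hn : bottomWall n τ k = n
    · exact Or.inl hn
    · exact Or.inr ((hlt (by omega) hk (by omega) (by omega)).2 (by omega))
  · obtain ⟨l1, l2, l3⟩ := topWall_spec hτ hk
    have hkq := l3 q
    have bound : k = e → q < topWall τ k := by rintro rfl; omega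
    rw [topWall_eq_iff hτ' hk]
    refine ⟨l1, ?_, fun j hj hjk => (hlt (by omega) hk (by omega) (by omega)).2 (l3 j hj hjk)⟩
    rcases l2 with l2 | l2
    · exact Or.inl l2
    · exact (Nat.eq_zero_or_pos _).imp_right fun h0 =>
        (hlt hk (by omega) (by omega) (by omega)).2 l2

omit hτ' in
/-- If the labels between `a` and `e` are separated by the swapped pair in the given way, then `a`
and `e` are never in the same wall shuffle. -/
theorem not_same_shuffle {b c d : ℕ} (hb : a < b) (hbc : b < c) (hcd : c < d) (hd : d < e)
    (h : (τ b < τ e ∧ τ d < τ e ∧ τ a < τ c) ∨ (τ c < τ e ∧ τ a < τ b ∧ τ a < τ d)) (w : ℕ) :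
    ¬ (((a + 1 < w ∧ rightWall n τ a = w) ∨ (w < a ∧ leftWall τ a = w)) ∧
      ((e + 1 < w ∧ rightWall n τ e = w) ∨ (w < e ∧ leftWall τ e = w))) ∧
    ¬ (((a + 1 < w ∧ bottomWall n τ a = w) ∨ (w < a ∧ topWall τ a = w)) ∧
      ((e + 1 < w ∧ bottomWall n τ e = w) ∨ (w < e ∧ topWall τ e = w))) := by
  obtain ⟨h1, h2, h3, -⟩ := hs
  have han : a < n := by omega
  rw [rightWall_eq_iff hτ han, rightWall_eq_iff hτ h2, leftWall_eq_iff hτ han,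
    leftWall_eq_iff hτ h2, bottomWall_eq_iff hτ han, bottomWall_eq_iff hτ h2,
    topWall_eq_iff hτ han, topWall_eq_iff hτ h2]
  constructor
  · rintro ⟨⟨a1, a2, a3, a4, a5⟩ | ⟨a1, a2, a3, a4⟩, ⟨e1, e2, e3, e4, e5⟩ | ⟨e1, e2, e3, e4⟩⟩
    · have := a5 b
      have := a5 c
      omega
    · have := a5 b
      have := a5 c
      have := e4 c
      have := e4 d
      omega
    · omega
    · have := e4 b
      have := e4 c
      omega
  · rintro ⟨⟨a1, a2, a3, a4, a5⟩ | ⟨a1, a2, a3, a4⟩, ⟨e1, e2, e3, e4, e5⟩ | ⟨e1, e2, e3, e4⟩⟩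
    · have := a5 b
      have := a5 c
      omega
    · have := a5 b
      have := a5 c
      have := e4 c
      have := e4 d
      omega
    · omega
    · have := e4 b
      have := e4 c
      omega

omit hs hτ hτ' in
-- Without alternation at three places a predicate on an interval changes at most once; `w` is the
-- first change. Constant predicates fall under the first alternative, so in the second one both
-- blocks are nonempty.
theorem exists_split {P : ℕ → Prop} (h1 : a < e)
    (hP : ∀ b c d, a < b → b < c → c < d → d < e → (P b ↔ P d) → (P b ↔ P c)) :
    (∃ w, a < w ∧ w ≤ e ∧ (∀ k, a < k → k < w → P k) ∧ ∀ k, w ≤ k → k < e → ¬ P k) ∨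
    (∃ w, a + 1 < w ∧ w < e ∧ (∀ k, a < k → k < w → ¬ P k) ∧ ∀ k, w ≤ k → k < e → P k) := by
  classical
  have hex : ∃ w, a < w ∧ (w = e ∨ ¬ (P w ↔ P (a + 1))) := ⟨e, h1, Or.inl rfl⟩
  obtain ⟨w, ⟨hw1, hw2⟩, hmin⟩ : ∃ w, (a < w ∧ (w = e ∨ ¬ (P w ↔ P (a + 1)))) ∧
      ∀ k, k < w → ¬ (a < k ∧ (k = e ∨ ¬ (P k ↔ P (a + 1)))) :=
    ⟨Nat.find hex, Nat.find_spec hex, fun k => Nat.find_min hex⟩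
  have hwe : w ≤ e := not_lt.1 fun h => hmin e h ⟨h1, Or.inl rfl⟩
  have lower : ∀ k, a < k → k < w → (P k ↔ P (a + 1)) := fun k hk hkw => by
    by_contra hc
    exact hmin k hkw ⟨hk, Or.inr hc⟩
  have upper : ∀ k, w ≤ k → k < e → ¬ (P k ↔ P (a + 1)) := by
    intro k hk hke hc
    have hw : ¬ (P w ↔ P (a + 1)) := hw2.resolve_left (by omega)
    have hne : w ≠ a + 1 := by rintro rfl; exact hw Iff.rfl
    rcases hk.eq_or_lt with rfl | hk
    · exact hw hc
    · exact hw (hP (a + 1) w k (by omega) (by omega) hk hke hc.symm).symm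
  by_cases h0 : P (a + 1)
  · exact Or.inl ⟨w, hw1, hwe, fun k hk hk' => (lower k hk hk').2 h0,
      fun k hk hk' hc => upper k hk hk' (iff_of_true hc h0)⟩
  · rcases hwe.eq_or_lt with rfl | hlt
    · exact Or.inl ⟨a + 1, by omega, hw1, by omega,
        fun k hk hk' => (not_congr (lower k hk hk')).2 h0⟩
    · have hne : w ≠ a + 1 := by
        rintro rfl
        exact upper _ le_rfl hlt Iff.rfl
      exact Or.inr ⟨w, by omega, hlt, fun k hk hk' => (not_congr (lower k hk hk')).2 h0,
        fun k hk hk' => by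
          by_contra hc
          exact upper k hk hk' (iff_of_false hc h0)⟩

variable (hn : 0 < n) (hpos : ∀ k < n, 0 ≤ τ k ∧ τ k < n)
  (hpos' : ∀ k < n, 0 ≤ τ' k ∧ τ' k < n)
include hpos hpos'

/-- If the labels between `a` and `e` before the pair are smaller than those after it, then `a` is
left of `e` only after the swap. -/
theorem leftOf_of_split {w : ℕ} (hw : a < w) (hwe : w ≤ e)
    (hlow : ∀ k, a < k → k < w → τ k < τ e) (hhigh : ∀ k, w ≤ k → k < e → ¬ τ k < τ e) :
    ((diagonalPlan hτ' hn).draw (fun w => (coord n τ' w : ℝ))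
      (fun w => (ordinate n τ' w : ℝ))).LeftOf ⟨a, hs.lt.trans hs.e_lt⟩ ⟨e, hs.e_lt⟩ ∧
    ¬ ((diagonalPlan hτ hn).draw (fun w => (coord n τ w : ℝ))
      (fun w => (ordinate n τ w : ℝ))).LeftOf ⟨a, hs.lt.trans hs.e_lt⟩ ⟨e, hs.e_lt⟩ := by
  have hlt := fun {j k : ℕ} => hs.lt_iff hτ (j := j) (k := k)
  obtain ⟨h1, h2, h3, h4, h5, h6⟩ := hs
  have han : a < n := by omega
  have hhigh' : ∀ k, w ≤ k → k < e → τ a < τ k := fun k hk hke => by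
    have := hhigh k hk hke
    have q1 := fun e' => hτ k e (by omega) h2 e'
    have q2 := fun e' => hτ k a (by omega) han e'
    omega
  have hlow' : ∀ k, a < k → k < w → τ' k < τ' a := fun k hk hkw => by
    rw [h4, h6 k (by omega) (by omega) (by omega)]; exact hlow k hk hkw
  have hhigh'' : ∀ k, w ≤ k → k < e → τ' e < τ' k := fun k hk hke => by
    rw [h5, h6 k (by omega) (by omega) (by omega)]; exact hhigh' k hk hke
  constructor
  · rw [Drawing.LeftOf, (generic_fits hτ' hpos' hn).isLeftOf_iff]
    change rightWall n τ' a = leftWall τ' e ∧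
      (ordinate n τ' (bottomWall n τ' a) : ℝ) ≤ ordinate n τ' (topWall τ' e) ∧
      (ordinate n τ' (bottomWall n τ' e) : ℝ) ≤ ordinate n τ' (topWall τ' a)
    rw [Int.cast_le, Int.cast_le]
    have hr : rightWall n τ' a = w := by
      rw [rightWall_eq_iff hτ' han]
      refine ⟨hw, by omega, Or.inr ?_, hlow'⟩
      rcases hwe.eq_or_lt with rfl | h
      · omega
      · have := hhigh'' w le_rfl h; omega
    have hl : leftWall τ' e = w := by
      rw [leftWall_eq_iff hτ' h2]
      refine ⟨hwe, Or.inr ?_, hhigh''⟩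
      rcases (show a ≤ w - 1 by omega).eq_or_lt with h | h
      · rw [← h]; omega
      · have := hlow' (w - 1) h (by omega); omega
    refine ⟨hr.trans hl.symm, ?_, ?_⟩
    · obtain ⟨b0, b1, b2, b3⟩ := bottomWall_spec hτ' han
      obtain ⟨t1, t2, t3⟩ := topWall_spec hτ' h2
      -- If these indices are in this order, so are the ordinates. Otherwise both labels are
      -- recorded on the wall `w`, and the generic placement decides, as `a` now comes first.
      by_cases hc : topWall τ' e < bottomWall n τ' a
      · exact (ordinate_lt_ordinate hτ' hpos' hc b1 (by omega)).le
      · have w1 : a + 1 < w := by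
          by_contra hcon
          have := hhigh'' (bottomWall n τ' a) (by omega)
          rcases lt_trichotomy (bottomWall n τ' a) e with h | h | h
          · omega
          · rw [h] at b2; omega
          · omega
        have hb : bottomWall n τ' a = a + 1 := by
          rw [bottomWall_eq_iff hτ' han]
          exact ⟨by omega, by omega, Or.inr (hlow' _ (by omega) w1), by omega⟩
        have w2 : w < e := by
          by_contra hcon
          have hta : topWall τ' e - 1 ≠ a := by
            intro h; rw [h] at t2; omega
          have := hlow' (topWall τ' e - 1) (by omega) (by omega)
          omega
        have ht : topWall τ' e = e := by
          rw [topWall_eq_iff hτ' h2]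
          exact ⟨le_rfl, Or.inr (hhigh'' _ (by omega) (by omega)), by omega⟩
        rw [hb, ht]
        exact (ordinate_succ_lt_ordinate hτ' hpos' w1 w2 h2 hlow' hhigh'' (by omega)).le
    · obtain ⟨b0, b1, b2, b3⟩ := bottomWall_spec hτ' h2
      obtain ⟨t1, t2, t3⟩ := topWall_spec hτ' han
      have q := fun hb e' => hτ' (bottomWall n τ' e) a hb han e'
      refine (ordinate_lt_ordinate hτ' hpos' (by omega) b1 ?_).le
      by_cases c1 : topWall τ' a = 0
      · exact Or.inl c1
      · by_cases c2 : bottomWall n τ' e = n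
        · exact Or.inr (Or.inl c2)
        · have := q (by omega)
          right; right; omega
  · rw [Drawing.LeftOf, (generic_fits hτ hpos hn).isLeftOf_iff]
    change ¬ (rightWall n τ a = leftWall τ e ∧
      (ordinate n τ (bottomWall n τ a) : ℝ) ≤ ordinate n τ (topWall τ e) ∧
      (ordinate n τ (bottomWall n τ e) : ℝ) ≤ ordinate n τ (topWall τ a))
    rw [Int.cast_le, Int.cast_le]
    rintro ⟨g1, g2, g3⟩
    obtain ⟨r0, r1, r2, r3⟩ := rightWall_spec hτ han
    obtain ⟨l1, l2, l3⟩ := leftWall_spec hτ h2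
    -- The right wall of `a` and the left wall of `e` can coincide before the swap only if there are
    -- labels between them on both sides of the pair.
    have w2 : w < e := by
      by_contra hcon
      have hr : ¬ rightWall n τ a ≤ e := by
        intro hre
        rcases hre.eq_or_lt with h | h
        · rw [h] at r2; omega
        · have := hlow (rightWall n τ a) r0 (by omega); omega
      omega
    have w1 : a + 1 < w := by
      by_contra hcon
      have hla : leftWall τ e - 1 ≠ a := by
        intro h; rw [h] at l2; omega
      have := hhigh' (leftWall τ e - 1) (by omega)
      omega
    have hb : bottomWall n τ a = a + 1 := by
      rw [bottomWall_eq_iff hτ han]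
      have := hlow (a + 1) (by omega) w1
      exact ⟨by omega, by omega, Or.inr (by omega), by omega⟩
    have ht : topWall τ e = e := by
      rw [topWall_eq_iff hτ h2]
      have := hhigh' (e - 1) (by omega) (by omega)
      exact ⟨le_rfl, Or.inr (by omega), by omega⟩
    rw [hb, ht] at g2
    -- Before the swap `e` comes first, so the top of `e` is strictly below the bottom of `a`.
    have := ordinate_lt_ordinate hτ hpos (show a + 1 < e by omega) h2.le
      (Or.inr (Or.inr (by rw [Nat.add_sub_cancel]; omega)))
    omega

/-- If the labels between `a` and `e` before the pair are larger than those after it, then `e` is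
below `a` only before the swap. -/
theorem below_of_split {w : ℕ} (hw : a + 1 < w) (hwe : w < e)
    (hlow : ∀ k, a < k → k < w → ¬ τ k < τ e) (hhigh : ∀ k, w ≤ k → k < e → τ k < τ e) :
    ¬ ((diagonalPlan hτ' hn).draw (fun w => (coord n τ' w : ℝ))
      (fun w => (ordinate n τ' w : ℝ))).Below ⟨e, hs.e_lt⟩ ⟨a, hs.lt.trans hs.e_lt⟩ ∧
    ((diagonalPlan hτ hn).draw (fun w => (coord n τ w : ℝ))
      (fun w => (ordinate n τ w : ℝ))).Below ⟨e, hs.e_lt⟩ ⟨a, hs.lt.trans hs.e_lt⟩ := by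
  obtain ⟨h1, h2, h3, h4, h5, h6⟩ := hs
  have han : a < n := by omega
  have hlow' : ∀ k, a < k → k < w → τ a < τ k := fun k hk hkw => by
    have := hlow k hk hkw
    have q1 := fun e' => hτ k e (by omega) h2 e'
    have q2 := fun e' => hτ k a (by omega) han e'
    omega
  constructor
  · rw [Drawing.Below, (generic_fits hτ' hpos' hn).isBelow_iff]
    change ¬ (topWall τ' e = bottomWall n τ' a ∧
      (coord n τ' (leftWall τ' e) : ℝ) ≤ coord n τ' (rightWall n τ' a) ∧
      (coord n τ' (leftWall τ' a) : ℝ) ≤ coord n τ' (rightWall n τ' e))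
    rw [Int.cast_le, Int.cast_le]
    rintro ⟨g1, g2, g3⟩
    have hr : rightWall n τ' a = a + 1 := by
      rw [rightWall_eq_iff hτ' han]
      have := hlow' (a + 1) (by omega) hw
      have := h6 (a + 1) (by omega) (by omega) (by omega)
      exact ⟨by omega, by omega, Or.inr (by omega), by omega⟩
    have hl : leftWall τ' e = e := by
      rw [leftWall_eq_iff hτ' h2]
      have := hhigh (e - 1) (by omega) (by omega)
      have := h6 (e - 1) (by omega) (by omega) (by omega)
      exact ⟨le_rfl, Or.inr (by omega), by omega⟩
    rw [hr, hl] at g2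
    -- After the swap `a` comes first, so its right edge lies strictly to the left of the left edge
    -- of `e`.
    have := coord_lt_coord hτ' hpos' (show a + 1 < e by omega) h2.le
      (Or.inr (Or.inr (by rw [Nat.add_sub_cancel]; omega)))
    omega
  · rw [Drawing.Below, (generic_fits hτ hpos hn).isBelow_iff]
    change topWall τ e = bottomWall n τ a ∧
      (coord n τ (leftWall τ e) : ℝ) ≤ coord n τ (rightWall n τ a) ∧
      (coord n τ (leftWall τ a) : ℝ) ≤ coord n τ (rightWall n τ e)
    rw [Int.cast_le, Int.cast_le]
    have ht : topWall τ e = w := by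
      rw [topWall_eq_iff hτ h2]
      have := hlow' (w - 1) (by omega) (by omega)
      exact ⟨hwe.le, Or.inr (by omega), hhigh⟩
    have hb : bottomWall n τ a = w := by
      rw [bottomWall_eq_iff hτ han]
      have := hhigh w le_rfl hwe
      exact ⟨by omega, by omega, Or.inr (by omega), hlow'⟩
    have hr : rightWall n τ a = a + 1 := by
      rw [rightWall_eq_iff hτ han]
      exact ⟨by omega, by omega, Or.inr (hlow' _ (by omega) hw), by omega⟩
    have hl : leftWall τ e = e := by
      rw [leftWall_eq_iff hτ h2]
      exact ⟨le_rfl, Or.inr (hhigh _ (by omega) (by omega)), by omega⟩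
    refine ⟨ht.trans hb.symm, ?_, ?_⟩
    -- Before the swap `e` comes first on the horizontal wall `w`, and the generic placement makes
    -- the two tiles overlap.
    · rw [hr, hl]
      exact (coord_lt_coord_succ hτ hpos hw hwe h2 hlow' hhigh (by omega)).le
    · obtain ⟨l1, l2, l3⟩ := leftWall_spec hτ han
      obtain ⟨r0, r1, r2, r3⟩ := rightWall_spec hτ h2
      have q := fun hb e' => hτ (rightWall n τ e) a hb han e'
      refine (coord_lt_coord hτ hpos (by omega) r1 ?_).le
      by_cases c1 : leftWall τ a = 0
      · exact Or.inl c1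
      · by_cases c2 : rightWall n τ e = n
        · exact Or.inr (Or.inl c2)
        · have := q (by omega)
          right; right; omega

end AdjacentSwap

/-! ### The criterion for a cover in the weak order. -/

section Main

variable {n : ℕ}

theorem WeakCover.adjacentSwap {x y : Equiv.Perm (Fin n)} {e a : Fin n} (h : WeakCover x y e a) :
    AdjacentSwap n (position y) (position x) a e := by
  obtain ⟨hae, i, j, hij, y1, y2, x1, x2, hk⟩ := h
  have y1' : y.symm e = i := by rw [← y1, Equiv.symm_apply_apply]
  have y2' : y.symm a = j := by rw [← y2, Equiv.symm_apply_apply]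
  have x1' : x.symm a = i := by rw [← x1, Equiv.symm_apply_apply]
  have x2' : x.symm e = j := by rw [← x2, Equiv.symm_apply_apply]
  refine ⟨hae, e.2, ?_, ?_, ?_, ?_⟩
  · rw [position_fin, position_fin, y1', y2']; omega
  · rw [position_fin, position_fin, x1', y1']
  · rw [position_fin, position_fin, x2', y2']
  · intro k hkn hka hke
    have h1 : y.symm ⟨k, hkn⟩ ≠ i := fun e' => hke (by rw [← y1, ← e']; simp)
    have h2 : y.symm ⟨k, hkn⟩ ≠ j := fun e' => hka (by rw [← y2, ← e']; simp)
    have h3 := hk _ h1 h2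
    rw [Equiv.apply_symm_apply] at h3
    have h4 : x.symm ⟨k, hkn⟩ = y.symm ⟨k, hkn⟩ := by rw [Equiv.symm_apply_eq]; exact h3.symm
    have := position_fin x ⟨k, hkn⟩
    have := position_fin y ⟨k, hkn⟩
    simp only [h4] at *
    omega

theorem before_iff {y : Equiv.Perm (Fin n)} {b c : Fin n} :
    Before y b c ↔ position y b < position y c := by
  rw [position_fin, position_fin, Before, Fin.lt_def, Nat.cast_lt]

theorem isGamma_of_pattern {x y : Equiv.Perm (Fin n)} {e a b c d : Fin n} (hn : 0 < n)
    (h : WeakCover x y e a) (hab : a < b) (hbc : b < c) (hcd : c < d) (hde : d < e)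
    (hp : (Before y b e ∧ Before y d e ∧ Before y a c) ∨
      (Before y c e ∧ Before y a b ∧ Before y a d)) {Q : GRec n} (hQ : IsGamma y Q) :
    IsGamma x Q := by
  have hs := h.adjacentSwap
  have hτ := distinctBelow_position y
  have hτ' := distinctBelow_position x
  simp only [before_iff] at hp
  have hwalls : ∀ k < n, leftWall (position x) k = leftWall (position y) k ∧
      rightWall n (position x) k = rightWall n (position y) k ∧
      bottomWall n (position x) k = bottomWall n (position y) k ∧
      topWall (position x) k = topWall (position y) k := by
    intro k hk
    rcases hp with ⟨p1, p2, p3⟩ | ⟨p1, p2, p3⟩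
    · exact hs.walls_eq hτ hτ' hab (hbc.trans (hcd.trans hde)) p1 (hab.trans hbc)
        (hcd.trans hde) p3 hk
    · exact hs.walls_eq hτ hτ' (hab.trans hbc) (hcd.trans hde) p1 hab
        (hbc.trans (hcd.trans hde)) p2 hk
  have hrho : rho x = rho y := by
    rw [rho_eq x hn, rho_eq y hn]
    simp only [diagonalDrawing, Plan.draw, diagonalPlan, Drawing.mk.injEq, true_and]
    ext1 k
    obtain ⟨w1, w2, w3, w4⟩ := hwalls k k.2
    rw [w1, w2, w3, w4]
  rw [isGamma_iff] at hQ ⊢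
  obtain ⟨R, hR, φ, hφ, hsh⟩ := hQ
  refine ⟨R, hR, ?_⟩
  rw [hrho]
  refine ⟨φ, hφ, fun W => ?_⟩
  have hW := (isWallShuffle_filter_iff y).1 (hsh W)
  rw [isWallShuffle_filter_iff]
  refine ⟨hW.1, fun i j hi hj hij => hW.2 i j hi hj ?_⟩
  -- A shuffle could change only by exchanging `a` and `e`, so it suffices that no wall records
  -- both.
  have key : ∀ s, (rho y).IsWall s → ¬ ((rho y).InShuffle s a ∧ (rho y).InShuffle s e) := by
    have hfits := diagonalPlan_fits hτ hn
    rw [rho_eq y hn, diagonalDrawing]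
    intro s hwall
    rcases hfits.isWall_iff.1 hwall with ⟨w, hw, rfl⟩ | ⟨w, hw, rfl⟩
    · rw [inShuffle_vertSeg_iff hτ hn hfits hw, inShuffle_vertSeg_iff hτ hn hfits hw]
      exact (hs.not_same_shuffle hτ hab hbc hcd hde hp w).1
    · rw [inShuffle_horizSeg_iff hτ hn hfits hw, inShuffle_horizSeg_iff hτ hn hfits hw]
      exact (hs.not_same_shuffle hτ hab hbc hcd hde hp w).2
  have hnot := key W.1 W.2
  refine (hs.lt_iff hτ i.2 j.2 ?_ ?_).1 hij
  · rintro ⟨h1, h2⟩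
    obtain rfl := Fin.ext h1
    obtain rfl := Fin.ext h2
    exact hnot ⟨hi, hj⟩
  · rintro ⟨h1, h2⟩
    obtain rfl := Fin.ext h1
    obtain rfl := Fin.ext h2
    exact hnot ⟨hj, hi⟩

/-- By contraposition: without the pattern, the labels between `a` and `e` split into two blocks,
and one relation between the tiles `a` and `e` holds in exactly one of the tilings. Equal classes
have equal relations label by label (`relations_of_mk_eq`). -/
theorem pattern_of_mk_eq {x y : Equiv.Perm (Fin n)} {e a : Fin n} (hn : 0 < n)
    (h : WeakCover x y e a) (hQ : GRec.mk (genericTiling x hn) = GRec.mk (genericTiling y hn)) :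
    ∃ b c d : Fin n, a < b ∧ b < c ∧ c < d ∧ d < e ∧
      ((Before y b e ∧ Before y d e ∧ Before y a c) ∨
        (Before y c e ∧ Before y a b ∧ Before y a d)) := by
  have hs := h.adjacentSwap
  have hτ := distinctBelow_position y
  have hτ' := distinctBelow_position x
  by_contra hno
  have hsplit := AdjacentSwap.exists_split (a := a) (e := e)
    (P := fun k => position y k < position y e) hs.lt ?_
  · rcases hsplit with ⟨w, w1, w2, w3, w4⟩ | ⟨w, w1, w2, w3, w4⟩
    · have := hs.leftOf_of_split hτ hτ' hn (position_bounds y) (position_bounds x) w1 w2 w3 w4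
      exact this.2 ((relations_of_mk_eq hn hQ a e).2.1 this.1)
    · have := hs.below_of_split hτ hτ' hn (position_bounds y) (position_bounds x) w1 w2 w3 w4
      exact this.1 ((relations_of_mk_eq hn hQ e a).1.2 this.2)
  · intro b c d hb hc hd he hbd
    by_contra hbc
    have hen := e.2
    have after : ∀ k, (a : ℕ) < k → k < (e : ℕ) → ¬ position y k < position y e →
        position y a < position y k := by
      intro k hk hke hk'
      have q1 := fun e' => hτ k e (by omega) e.2 e'
      have q2 := fun e' => hτ k a (by omega) a.2 e'
      have := hs.adjacent
      omega
    refine hno ⟨⟨b, by omega⟩, ⟨c, by omega⟩, ⟨d, by omega⟩, hb, hc, hd, he, ?_⟩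
    simp only [before_iff]
    by_cases hPb : position y b < position y e
    · have hPc : ¬ position y c < position y e := fun hPc => hbc (iff_of_true hPb hPc)
      exact Or.inl ⟨hPb, hbd.1 hPb, after c (by omega) (by omega) hPc⟩
    · have hPc : position y c < position y e := by
        by_contra hPc
        exact hbc (iff_of_false hPb hPc)
      exact Or.inr ⟨hPc, after b hb (by omega) hPb,
        after d (by omega) he fun hPd => hPb (hbd.2 hPd)⟩

end Main

end Rectangulation

open Rectangulation
theorem proposition4p3 (n : ℕ) (hn : 1 ≤ n) :
    ∃ γ : Equiv.Perm (Fin n) → GRec n,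
      (∀ (x : Equiv.Perm (Fin n)) (Q : GRec n), IsGamma x Q ↔ Q = γ x) ∧
      ∀ (x y : Equiv.Perm (Fin n)) (e a : Fin n), WeakCover x y e a →
        (γ x = γ y ↔
          ∃ b c d : Fin n, a < b ∧ b < c ∧ c < d ∧ d < e ∧
            ((Before y b e ∧ Before y d e ∧ Before y a c) ∨
              (Before y c e ∧ Before y a b ∧ Before y a d))) := by
  refine ⟨fun x => GRec.mk (genericTiling x hn), fun x Q => ⟨fun h => ?_, ?_⟩,
    fun x y e a h => ⟨pattern_of_mk_eq hn h, ?_⟩⟩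
  · exact h.unique (isGamma_genericTiling x hn)
  · rintro rfl
    exact isGamma_genericTiling x hn
  · rintro ⟨b, c, d, hab, hbc, hcd, hde, hp⟩
    exact (isGamma_genericTiling x hn).unique
      (isGamma_of_pattern hn h hab hbc hcd hde hp (isGamma_genericTiling y hn))
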